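/- Let $\mathcal L^2$ be the second-order language of set theory, with $\in$, $=$ and $k$-ary relation variables for all $k$, and let $\vdash_2$ be derivability in the standard (natural deduction) system for classical second-order logic with equality and full impredicative comprehension. Let $\mathsf Z^2$ be the theory with the axioms of Extensionality, Foundation, Pairing, Union, Power Set, Infinity (some set contains $\emptyset$ and contains $x\cup\{y\}$ whenever it contains $x$ and $y$) and Comprehensiveness ($\forall x\forall X\exists y\forall z\,(z\in y\leftrightarrow X(z)\wedge z\in x)$), and let $\mathsf{ZF}^2$ be $\mathsf Z^2$ together with the second-order Axiom of Replacement. Let $\zeta^2(X,Y)$ be the conjunction of the axioms of $\mathsf Z^2$ with all first-order quantifiers restricted to $X$ and with $\in$ replaced by $Y$ (so $\langle X,Y\rangle$ is a full Zermelo system), and let $\mathrm{Sat}(X,Y,c)$ be the $\mathcal L^2$-formula saying that the first-order sentence of the language of set theory with code $c$ is true in $\langle X,Y\rangle$, i.e. that there is a satisfaction class, obeying Tarski's clauses on a class of codes which contains $c$ and is closed under immediate subformulas, by which every assignment satisfies $c$. For a first-order sentence $\varphi$ let $\pi(\ulcorner\varphi\urcorner)$ ("$\varphi$ is mathematically definite")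 be the $\mathcal L^2$-sentence $$\forall X\,\forall Y\subseteq X^2\,\bigl(\zeta^2(X,Y)\to \mathrm{Sat}(X,Y,\ulcorner\varphi\urcorner)\bigr)\ \vee\ \forall X\,\forall Y\subseteq X^2\,\bigl(\zeta^2(X,Y)\to \mathrm{Sat}(X,Y,\ulcorner\neg\varphi\urcorner)\bigr).$$ Let $R(0)=\emptyset$, $R(\alpha+1)=\mathcal P(R(\alpha))$ and $R(\lambda)=\bigcup_{\alpha<\lambda}R(\alpha)$ for limit $\lambda$, and let $\chi^1$ be the following form of the Continuum Hypothesis, written as a first-order sentence whose quantifiers (other than those used to define the ranks) are bounded by $R(\omega+4)$: for every $x\subseteq R(\omega+1)$ there is an injection from $x$ into $R(\omega)$ or a bijection from $x$ onto $R(\omega+1)$. Then $$\mathsf{ZF}^2\vdash_2\pi(\ulcorner\chi^1\urcorner).$$ -/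

import Mathlib

/-! Second-order set theory: syntax, a natural deduction system for second-order logic with full
impredicative comprehension, the theories `Z2` and `ZF2`, coded first-order syntax with a
second-order satisfaction predicate, and the Continuum Hypothesis as a rank-bounded first-order
sentence. -/

namespace Kreisel

/-- Formulas of the second-order language of set theory: individual variables, `k`-ary relation
variables for every `k`, the predicate `∈`, equality. Variables are de Bruijn indices. Individual
variables have one index space, and relation variables have one index space for each arity: `all`
binds individual index `0`, and `all₂ k` binds index `0` among the `k`-ary relation variables. The
only individual terms are variables. -/
inductive Fml : Type
  | bot : Fml
  | mem (s t : ℕ) : Fml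
  | eq (s t : ℕ) : Fml
  | rel (k i : ℕ) (ts : Fin k → ℕ) : Fml
  | imp (φ ψ : Fml) : Fml
  | all (φ : Fml) : Fml
  | all₂ (k : ℕ) (φ : Fml) : Fml

/-- Extend a renaming under a binder. -/
def liftRen (ρ : ℕ → ℕ) : ℕ → ℕ
  | 0 => 0
  | i + 1 => ρ i + 1

/-- The renaming that sends index `0` to `t` and removes the binder. -/
def instRen (t : ℕ) : ℕ → ℕ
  | 0 => t
  | i + 1 => i

namespace Fml

/-- Capture-avoiding renaming of the free individual variables (by `ρ`) and of the free `k`-ary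
relation variables (by `τ k`). -/
def ren : Fml → (ℕ → ℕ) → (ℕ → ℕ → ℕ) → Fml
  | bot, _, _ => bot
  | mem s t, ρ, _ => mem (ρ s) (ρ t)
  | eq s t, ρ, _ => eq (ρ s) (ρ t)
  | rel k i ts, ρ, τ => rel k (τ k i) (fun j => ρ (ts j))
  | imp φ ψ, ρ, τ => imp (φ.ren ρ τ) (ψ.ren ρ τ)
  | all φ, ρ, τ => all (φ.ren (liftRen ρ) τ)
  | all₂ k φ, ρ, τ => all₂ k (φ.ren ρ (Function.update τ k (liftRen (τ k))))

/-- Weakening by one fresh individual variable. -/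
def shift (φ : Fml) : Fml := φ.ren Nat.succ (fun _ => id)

/-- Weakening by one fresh `k`-ary relation variable. -/
def shift₂ (k : ℕ) (φ : Fml) : Fml := φ.ren id (Function.update (fun _ => id) k Nat.succ)

/-- The instance of (the matrix of) `all φ` at the variable `t`. -/
def inst (t : ℕ) (φ : Fml) : Fml := φ.ren (instRen t) (fun _ => id)

/-- The instance of (the matrix of) `all₂ k φ` at the `k`-ary relation variable `j`. -/
def inst₂ (k j : ℕ) (φ : Fml) : Fml :=
  φ.ren id (Function.update (fun _ => id) k (instRen j))

def neg (φ : Fml) : Fml := φ.imp bot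
def conj (φ ψ : Fml) : Fml := (φ.imp ψ.neg).neg
def disj (φ ψ : Fml) : Fml := φ.neg.imp ψ
def iff (φ ψ : Fml) : Fml := (φ.imp ψ).conj (ψ.imp φ)
def ex (φ : Fml) : Fml := φ.neg.all.neg
def ex₂ (k : ℕ) (φ : Fml) : Fml := (φ.neg.all₂ k).neg

/-- `∀ x₁ … ∀ xₖ φ`; the quantified variables are the indices `0, …, k - 1` of `φ`. -/
def allN : ℕ → Fml → Fml
  | 0, φ => φ
  | k + 1, φ => allN k φ.all

/-- The comprehension axiom `∃ X ∀ x₁ … ∀ xₖ (X x₁ … xₖ ↔ φ)` for an arbitrary second-order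
formula `φ`, possibly with parameters, in which `X` is not free. -/
def comprehension (k : ℕ) (φ : Fml) : Fml :=
  ex₂ k (allN k (iff (rel k 0 (fun i => (i : ℕ))) (φ.shift₂ k)))

/-- Restrict every individual quantifier to the unary relation variable `X` and replace `∈` by
the binary relation variable `Y`. Meant for sentences. -/
def relativize : Fml → (X Y : ℕ) → Fml
  | bot, _, _ => bot
  | mem s t, _, Y => rel 2 Y ![s, t]
  | eq s t, _, _ => eq s t
  | rel k i ts, _, _ => rel k i ts
  | imp φ ψ, X, Y => imp (φ.relativize X Y) (ψ.relativize X Y)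
  | all φ, X, Y => all (imp (rel 1 X ![0]) (φ.relativize X Y))
  | all₂ k φ, X, Y =>
      all₂ k (φ.relativize (if k = 1 then X + 1 else X) (if k = 2 then Y + 1 else Y))

/-- Bound every individual quantifier by the free individual variable `v`: `∀ x ∈ v`. -/
def bound : Fml → ℕ → Fml
  | bot, _ => bot
  | mem s t, _ => mem s t
  | eq s t, _ => eq s t
  | rel k i ts, _ => rel k i ts
  | imp φ ψ, v => imp (φ.bound v) (ψ.bound v)
  | all φ, v => all (imp (mem 0 (v + 1)) (φ.bound (v + 1)))
  | all₂ k φ, v => all₂ k (φ.bound v)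

end Fml

/-- Natural deduction for classical second-order logic with equality and full comprehension. -/
inductive Deriv : List Fml → Fml → Prop
  | ax {Γ : List Fml} {φ : Fml} : φ ∈ Γ → Deriv Γ φ
  | impI {Γ : List Fml} {φ ψ : Fml} : Deriv (φ :: Γ) ψ → Deriv Γ (φ.imp ψ)
  | impE {Γ : List Fml} {φ ψ : Fml} : Deriv Γ (φ.imp ψ) → Deriv Γ φ → Deriv Γ ψ
  | raa {Γ : List Fml} {φ : Fml} : Deriv (φ.neg :: Γ) Fml.bot → Deriv Γ φ
  | allI {Γ : List Fml} {φ : Fml} : Deriv (Γ.map Fml.shift) φ → Deriv Γ φ.all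
  | allE {Γ : List Fml} {φ : Fml} (t : ℕ) : Deriv Γ φ.all → Deriv Γ (φ.inst t)
  | all₂I {Γ : List Fml} {φ : Fml} (k : ℕ) :
      Deriv (Γ.map (Fml.shift₂ k)) φ → Deriv Γ (φ.all₂ k)
  | all₂E {Γ : List Fml} {φ : Fml} (k j : ℕ) : Deriv Γ (φ.all₂ k) → Deriv Γ (φ.inst₂ k j)
  | eqRefl {Γ : List Fml} (t : ℕ) : Deriv Γ (Fml.eq t t)
  | eqSubst {Γ : List Fml} {s t : ℕ} (φ : Fml) :
      Deriv Γ (Fml.eq s t) → Deriv Γ (φ.inst s) → Deriv Γ (φ.inst t)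
  | comp {Γ : List Fml} (k : ℕ) (φ : Fml) : Deriv Γ (Fml.comprehension k φ)

/-- `T ⊢₂ φ`: the formula `φ` is derivable from finitely many members of `T`. -/
def Proves (T : Set Fml) (φ : Fml) : Prop := ∃ Γ : List Fml, (∀ γ ∈ Γ, γ ∈ T) ∧ Deriv Γ φ

/-! ### Writing formulas with variable names

A `FmlAt` is a formula waiting for the number `d` of individual variables and the numbers `D k` of
`k`-ary relation variables that are in scope. A variable is referred to by its level, i.e. the
number of variables of its kind bound outside it. -/

abbrev FmlAt : Type := ℕ → (ℕ → ℕ) → Fml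

/-- Individual variables, as levels. -/
abbrev Var : Type := ℕ

/-- `k`-ary relation variables, as levels. -/
abbrev RelVar (_k : ℕ) : Type := ℕ

namespace FmlAt

def mem (x y : Var) : FmlAt := fun d _ => .mem (d - 1 - x) (d - 1 - y)
def eq (x y : Var) : FmlAt := fun d _ => .eq (d - 1 - x) (d - 1 - y)
def app₁ (X : RelVar 1) (x : Var) : FmlAt := fun d D => .rel 1 (D 1 - 1 - X) ![d - 1 - x]
def app₂ (Y : RelVar 2) (x y : Var) : FmlAt :=
  fun d D => .rel 2 (D 2 - 1 - Y) ![d - 1 - x, d - 1 - y]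
def bot : FmlAt := fun _ _ => .bot
def neg (φ : FmlAt) : FmlAt := fun d D => (φ d D).neg
def imp (φ ψ : FmlAt) : FmlAt := fun d D => (φ d D).imp (ψ d D)
def conj (φ ψ : FmlAt) : FmlAt := fun d D => (φ d D).conj (ψ d D)
def disj (φ ψ : FmlAt) : FmlAt := fun d D => (φ d D).disj (ψ d D)
def iff (φ ψ : FmlAt) : FmlAt := fun d D => (φ d D).iff (ψ d D)
def all (φ : Var → FmlAt) : FmlAt := fun d D => .all (φ d (d + 1) D)
def ex (φ : Var → FmlAt) : FmlAt := fun d D => .ex (φ d (d + 1) D)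
def all₂ (k : ℕ) (φ : RelVar k → FmlAt) : FmlAt :=
  fun d D => .all₂ k (φ (D k) d (Function.update D k (D k + 1)))
def ex₂ (k : ℕ) (φ : RelVar k → FmlAt) : FmlAt :=
  fun d D => .ex₂ k (φ (D k) d (Function.update D k (D k + 1)))

/-- The formula with no variable in scope. -/
def close (φ : FmlAt) : Fml := φ 0 (fun _ => 0)

local infix:50 " ∈ₛ " => mem
local infix:50 " =ₛ " => eq
local prefix:max "¬ₛ " => neg
local infixr:35 " ∧ₛ " => conj
local infixr:30 " ∨ₛ " => disj
local infixr:25 " ⇒ₛ " => imp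
local infix:20 " ⇔ₛ " => iff

/-! ### The axioms -/

/-- `x = ∅`. -/
def isEmpty (x : Var) : FmlAt := all fun z => ¬ₛ (z ∈ₛ x)

/-- `x ⊆ y`. -/
def sub (x y : Var) : FmlAt := all fun z => z ∈ₛ x ⇒ₛ z ∈ₛ y

/-- `y = x ∪ {z}`. -/
def isAdjoin (y x z : Var) : FmlAt := all fun t => t ∈ₛ y ⇔ₛ t ∈ₛ x ∨ₛ t =ₛ z

/-- `p = {x, y}`. -/
def isUPair (p x y : Var) : FmlAt := all fun t => t ∈ₛ p ⇔ₛ t =ₛ x ∨ₛ t =ₛ y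

/-- `y = 𝒫(x)`. -/
def isPow (y x : Var) : FmlAt := all fun z => z ∈ₛ y ⇔ₛ sub z x

def extensionality : FmlAt :=
  all fun x => all fun y => (all fun z => z ∈ₛ x ⇔ₛ z ∈ₛ y) ⇒ₛ x =ₛ y

def foundation : FmlAt :=
  all fun x => (ex fun y => y ∈ₛ x) ⇒ₛ
    (ex fun y => y ∈ₛ x ∧ₛ all fun z => z ∈ₛ x ⇒ₛ ¬ₛ (z ∈ₛ y))

def pairing : FmlAt := all fun x => all fun y => ex fun p => isUPair p x y

def union : FmlAt :=
  all fun x => ex fun y => all fun z => z ∈ₛ y ⇔ₛ (ex fun t => t ∈ₛ x ∧ₛ z ∈ₛ t)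

def powerSet : FmlAt := all fun x => ex fun y => isPow y x

/-- Infinity: some set contains `∅` and contains `x ∪ {y}` whenever it contains `x` and `y`. In
the absence of Replacement this form, unlike the one with `x ∪ {x}`, yields the existence of
`R(ω)`. -/
def infinity : FmlAt :=
  ex fun a => (ex fun e => isEmpty e ∧ₛ e ∈ₛ a) ∧ₛ
    all fun x => all fun y => x ∈ₛ a ∧ₛ y ∈ₛ a ⇒ₛ (ex fun s => isAdjoin s x y ∧ₛ s ∈ₛ a)

/-- Comprehensiveness: the intersection of a class and a set is a set. -/
def comprehensiveness : FmlAt :=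
  all fun x => all₂ 1 fun X => ex fun y => all fun z => z ∈ₛ y ⇔ₛ app₁ X z ∧ₛ z ∈ₛ x

/-- Replacement: the image of a set under a (partial) class function is a set. -/
def replacement : FmlAt :=
  all₂ 2 fun F =>
    (all fun x => all fun y => all fun z => app₂ F x y ∧ₛ app₂ F x z ⇒ₛ y =ₛ z) ⇒ₛ
      all fun u => ex fun v => all fun y => y ∈ₛ v ⇔ₛ (ex fun x => x ∈ₛ u ∧ₛ app₂ F x y)

/-- The conjunction of the axioms of second-order Zermelo set theory. -/
def zermelo : FmlAt :=
  extensionality ∧ₛ foundation ∧ₛ pairing ∧ₛ union ∧ₛ powerSet ∧ₛ infinity ∧ₛ comprehensiveness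

/-- `ζ²(X, Y)`: the axioms of second-order Zermelo set theory hold in `⟨X, Y⟩`. -/
def zeta (X : RelVar 1) (Y : RelVar 2) : FmlAt :=
  fun _ D => zermelo.close.relativize (D 1 - 1 - X) (D 2 - 1 - Y)

/-! ### Pairs, functions, natural numbers -/

/-- `p = ⟨x, y⟩ = {{x}, {x, y}}`. -/
def isPair (p x y : Var) : FmlAt := all fun z => z ∈ₛ p ⇔ₛ isUPair z x x ∨ₛ isUPair z x y

/-- `⟨x, y⟩ ∈ f`. -/
def maps (f x y : Var) : FmlAt := ex fun p => isPair p x y ∧ₛ p ∈ₛ f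

/-- `f` is a function with domain `x`. -/
def isFunOn (f x : Var) : FmlAt :=
  (all fun p => p ∈ₛ f ⇒ₛ ex fun u => ex fun v => u ∈ₛ x ∧ₛ isPair p u v) ∧ₛ
    all fun u => u ∈ₛ x ⇒ₛ ex fun v => maps f u v ∧ₛ all fun v' => maps f u v' ⇒ₛ v' =ₛ v

/-- `f` is an injective function from `x` into `y`. -/
def isInjection (f x y : Var) : FmlAt :=
  isFunOn f x ∧ₛ (all fun u => all fun v => maps f u v ⇒ₛ v ∈ₛ y) ∧ₛ
    all fun u => all fun u' => all fun v => maps f u v ∧ₛ maps f u' v ⇒ₛ u =ₛ u'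

/-- `f` is a bijective function from `x` onto `y`. -/
def isBijection (f x y : Var) : FmlAt :=
  isInjection f x y ∧ₛ all fun v => v ∈ₛ y ⇒ₛ ex fun u => maps f u v

/-- `x` contains `∅` and is closed under `y ↦ y ∪ {y}`. -/
def isInductive (x : Var) : FmlAt :=
  (ex fun e => isEmpty e ∧ₛ e ∈ₛ x) ∧ₛ
    all fun y => y ∈ₛ x ⇒ₛ ex fun s => isAdjoin s y y ∧ₛ s ∈ₛ x

/-- `w = ω`, the least inductive set. -/
def isOmega (w : Var) : FmlAt := isInductive w ∧ₛ all fun x => isInductive x ⇒ₛ sub w x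

/-- `x` is the von Neumann numeral of `n`. -/
def isNum : ℕ → Var → FmlAt
  | 0, x => isEmpty x
  | n + 1, x => ex fun y => isNum n y ∧ₛ isAdjoin x y y

/-! ### Codes of first-order formulas and satisfaction

`⊥`, `vᵢ ∈ vⱼ`, `vᵢ = vⱼ`, `φ → ψ`, `∀ φ` are coded by the sets `⟨0, 0⟩`, `⟨1, ⟨i, j⟩⟩`,
`⟨2, ⟨i, j⟩⟩`, `⟨3, ⟨⌜φ⌝, ⌜ψ⌝⟩⟩`, `⟨4, ⌜φ⌝⟩`, where `i`, `j` are elements of `ω`. -/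

/-- `c = ⟨n, x⟩`. -/
def isTagged (n : ℕ) (c x : Var) : FmlAt := ex fun t => isNum n t ∧ₛ isPair c t x

/-- `c = ⟨n, ⟨x, y⟩⟩`. -/
def isTagged₂ (n : ℕ) (c x y : Var) : FmlAt := ex fun p => isPair p x y ∧ₛ isTagged n c p

/-- `c = ⌜⊥⌝`. -/
def isBotCode (c : Var) : FmlAt := ex fun e => isEmpty e ∧ₛ isTagged 0 c e

/-- `c' = ⌜¬φ⌝`, where `c = ⌜φ⌝`. -/
def isNegCode (c' c : Var) : FmlAt := ex fun b => isBotCode b ∧ₛ isTagged₂ 3 c' c b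

/-- `c = ⌜φ⌝`. Formulas that are not first-order have no code. -/
def isCode : Fml → Var → FmlAt
  | .bot, c => isBotCode c
  | .mem s t, c => ex fun i => ex fun j => isNum s i ∧ₛ isNum t j ∧ₛ isTagged₂ 1 c i j
  | .eq s t, c => ex fun i => ex fun j => isNum s i ∧ₛ isNum t j ∧ₛ isTagged₂ 2 c i j
  | .imp φ ψ, c => ex fun a => ex fun b => isCode φ a ∧ₛ isCode ψ b ∧ₛ isTagged₂ 3 c a b
  | .all φ, c => ex fun a => isCode φ a ∧ₛ isTagged 4 c a
  | .rel _ _ _, _ => bot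
  | .all₂ _ _, _ => bot

/-- `f` is an assignment in the class `X`: a function from `w = ω` to `X`. -/
def isAssignment (X : RelVar 1) (w f : Var) : FmlAt :=
  isFunOn f w ∧ₛ all fun u => all fun v => maps f u v ⇒ₛ app₁ X v

/-- For assignments `f`, `g` and `w = ω`: `g(0) = a` and `g(j + 1) = f(j)` for all `j`. -/
def isCons (w g a f : Var) : FmlAt :=
  (ex fun e => isEmpty e ∧ₛ maps g e a) ∧ₛ
    all fun j => j ∈ₛ w ⇒ₛ all fun j' => isAdjoin j' j j ⇒ₛ
      all fun v => maps f j v ⇔ₛ maps g j' v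

/-- Tarski's clauses at the code `c`, where `w = ω`: the class `S` of pairs (code, assignment)
satisfies at `c` the clause for satisfaction in `⟨X, Y⟩`, and the immediate subformulas of `c` are
in the class `C`. -/
def tarskiClause (X : RelVar 1) (Y : RelVar 2) (C : RelVar 1) (S : RelVar 2) (w c : Var) :
    FmlAt :=
  (isBotCode c ∧ₛ all fun f => isAssignment X w f ⇒ₛ ¬ₛ (app₂ S c f)) ∨ₛ
  (ex fun i => ex fun j => i ∈ₛ w ∧ₛ j ∈ₛ w ∧ₛ isTagged₂ 1 c i j ∧ₛ
    all fun f => isAssignment X w f ⇒ₛ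
      (app₂ S c f ⇔ₛ (ex fun a => ex fun b => maps f i a ∧ₛ maps f j b ∧ₛ app₂ Y a b))) ∨ₛ
  (ex fun i => ex fun j => i ∈ₛ w ∧ₛ j ∈ₛ w ∧ₛ isTagged₂ 2 c i j ∧ₛ
    all fun f => isAssignment X w f ⇒ₛ
      (app₂ S c f ⇔ₛ (ex fun a => ex fun b => maps f i a ∧ₛ maps f j b ∧ₛ a =ₛ b))) ∨ₛ
  (ex fun c₁ => ex fun c₂ => app₁ C c₁ ∧ₛ app₁ C c₂ ∧ₛ isTagged₂ 3 c c₁ c₂ ∧ₛ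
    all fun f => isAssignment X w f ⇒ₛ
      (app₂ S c f ⇔ₛ (app₂ S c₁ f ⇒ₛ app₂ S c₂ f))) ∨ₛ
  (ex fun c₁ => app₁ C c₁ ∧ₛ isTagged 4 c c₁ ∧ₛ
    all fun f => isAssignment X w f ⇒ₛ
      (app₂ S c f ⇔ₛ
        (all fun a => app₁ X a ⇒ₛ
          all fun g => isAssignment X w g ∧ₛ isCons w g a f ⇒ₛ app₂ S c₁ g)))

/-- `Sat(X, Y, c)`: there are a class `C` of codes that contains `c` and is closed under immediate
subformulas, and a satisfaction class `S` for `C` in the structure `⟨X, Y⟩`, such that all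
assignments satisfy `c` according to `S`. -/
def sat (X : RelVar 1) (Y : RelVar 2) (c : Var) : FmlAt :=
  ex fun w => isOmega w ∧ₛ ex₂ 1 fun C => ex₂ 2 fun S =>
    app₁ C c ∧ₛ (all fun c' => app₁ C c' ⇒ₛ tarskiClause X Y C S w c') ∧ₛ
      all fun f => isAssignment X w f ⇒ₛ app₂ S c f

/-- `∀ X ∀ Y ⊆ X² (ζ²(X, Y) → Sat(X, Y, c))`. -/
def consequence (c : Var) : FmlAt :=
  all₂ 1 fun X => all₂ 2 fun Y =>
    (all fun x => all fun y => app₂ Y x y ⇒ₛ app₁ X x ∧ₛ app₁ X y) ⇒ₛ zeta X Y ⇒ₛ sat X Y c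

/-- `π(c)`: the first-order sentence coded by `c` is mathematically definite, i.e. it or its
negation is a consequence of second-order Zermelo set theory. -/
def isDefinite (c : Var) : FmlAt :=
  consequence c ∨ₛ ex fun c' => isNegCode c' c ∧ₛ consequence c'

/-! ### The Continuum Hypothesis -/

/-- `a = R(ω)`: there is a function `h` on `ω` with `h(0) = ∅` and `h(n + 1) = 𝒫(h(n))`, and `a`
is the union of its values. -/
def isROmega (a : Var) : FmlAt :=
  ex fun w => isOmega w ∧ₛ ex fun h => isFunOn h w ∧ₛ
    (all fun n => all fun u => isEmpty n ∧ₛ maps h n u ⇒ₛ isEmpty u) ∧ₛ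
    (all fun n => all fun m => all fun u => all fun v =>
      n ∈ₛ w ∧ₛ isAdjoin m n n ∧ₛ maps h n u ∧ₛ maps h m v ⇒ₛ isPow v u) ∧ₛ
    all fun z => z ∈ₛ a ⇔ₛ (ex fun n => ex fun u => maps h n u ∧ₛ z ∈ₛ u)

/-- For `a = R(ω)` and `b = R(ω + 1)`: for every `x ⊆ b` there is an injection from `x` into `a`
or a bijection from `x` onto `b`. -/
def ch (a b : Var) : FmlAt :=
  all fun x => sub x b ⇒ₛ (ex fun f => isInjection f x a) ∨ₛ (ex fun f => isBijection f x b)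

/-- The Continuum Hypothesis for the ranks `a = R(ω)`, `b = R(ω + 1)`, all of its quantifiers
being bounded by `r = R(ω + 4)`. -/
def rankBoundedCH : FmlAt :=
  ex fun a => ex fun b => ex fun b₂ => ex fun b₃ => ex fun r =>
    isROmega a ∧ₛ isPow b a ∧ₛ isPow b₂ b ∧ₛ isPow b₃ b₂ ∧ₛ isPow r b₃ ∧ₛ
      fun d D => (ch a b d D).bound (d - 1 - r)

end FmlAt

/-- Second-order Zermelo set theory. -/
def Z2 : Set Fml :=
  {FmlAt.extensionality.close, FmlAt.foundation.close, FmlAt.pairing.close, FmlAt.union.close,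
    FmlAt.powerSet.close, FmlAt.infinity.close, FmlAt.comprehensiveness.close}

/-- Second-order Zermelo-Fraenkel set theory. -/
def ZF2 : Set Fml := Z2 ∪ {FmlAt.replacement.close}

/-- `χ¹`: the Continuum Hypothesis as a first-order sentence. -/
def chi : Fml := FmlAt.rankBoundedCH.close

/-- `π(⌜φ⌝)`: the sentence `∃ c (c = ⌜φ⌝ ∧ π(c))`. -/
def definite (φ : Fml) : Fml :=
  FmlAt.close (FmlAt.ex fun c => FmlAt.conj (FmlAt.isCode φ c) (FmlAt.isDefinite c))

end Kreisel

/-!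
A derivation in second-order logic is never written down here. Instead, Henkin's completeness
theorem for the natural deduction system (`Kreisel.Deriv.of_models`) reduces the claim to its truth
in every general structure that satisfies comprehension and the axioms of `ZF2`; soundness is not
needed. The term structure of a maximal consistent set with witnesses is the countermodel: its
individuals are the individual variables up to provable equality, and its relations are the
relation variables. The rest of the argument takes place inside an arbitrary such structure `S`,
whose relations need not be all the relations on its domain and whose `ω` need not be standard.

The mathematical content is Zermelo's quasi-categoricity up to `R(ω + 4)`. A full Zermelo system
`⟨A, B⟩` in `S` is itself a general structure `S.inner A B`, with the relations of `S`, and it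
satisfies the axioms of `Z2`. In every model of `Z2`, `R(ω)` exists and consists of the hereditarily
finite sets, i.e. it is the least set that contains `∅` and is closed under `x, y ↦ x ∪ {y}`
(`IsZermelo.exists_isROmega`, `IsZermelo.mem_ROmega_iff`). Induction over this set shows that
the relation "some set of pairs is a bisimulation that relates `x` to `y`" is an isomorphism between
the hereditarily finite sets of `S` and those of `⟨A, B⟩` (`exists_iso_HF`). By Comprehensiveness
on both sides, an isomorphism between transitive sets extends to their power sets
(`IsIso.powerSet`); four such steps reach `R(ω + 4)`, so the Continuum Hypothesis, all of
whose quantifiers are bounded there, has the same truth value in `S` and in `⟨A, B⟩`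
(`sat_chi_inner`). Hence whichever of the sentence and its negation is true in `S` is true in
all full Zermelo systems of `S`.

It remains to turn truth in `⟨A, B⟩` into `Sat(A, B, c)` (`isSat_of_sat`). For a fixed
first-order formula, recursion outside `S` on its subformulas yields a formula that defines
satisfaction of each of them by assignments that are sets of `S`; since a set is the code of at most
one formula, the finite union of these relations is a satisfaction class. Replacement provides the
assignments.

Comprehension is applied throughout to predicates written in Lean. The class `GenStr.Dfn` says that
a predicate of assignments is given by a formula with parameters, and instance search finds the
formula.
-/

namespace Kreisel

/-! ### Renaming -/

/-- Prepend a value to an assignment: the new value gets index `0`. -/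
def scons {α : Type*} (a : α) (v : ℕ → α) : ℕ → α
  | 0 => a
  | i + 1 => v i

@[simp] theorem scons_zero {α : Type*} (a : α) (v : ℕ → α) : scons a v 0 = a := rfl
@[simp] theorem scons_succ {α : Type*} (a : α) (v : ℕ → α) (i : ℕ) :
    scons a v (i + 1) = v i := rfl

theorem liftRen_id : liftRen id = id := by
  funext i; cases i <;> rfl

theorem liftRen_comp (ρ ρ' : ℕ → ℕ) : liftRen ρ' ∘ liftRen ρ = liftRen (ρ' ∘ ρ) := by
  funext i; cases i <;> rfl

namespace Fml

theorem ren_ren (φ : Fml) (ρ ρ' : ℕ → ℕ) (τ τ' : ℕ → ℕ → ℕ) :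
    (φ.ren ρ τ).ren ρ' τ' = φ.ren (ρ' ∘ ρ) (fun k => τ' k ∘ τ k) := by
  induction φ generalizing ρ ρ' τ τ' with
  | bot => rfl
  | mem s t => rfl
  | eq s t => rfl
  | rel k i ts => rfl
  | imp φ ψ ih₁ ih₂ => simp only [ren, ih₁, ih₂]
  | all φ ih => simp only [ren, ih, liftRen_comp]
  | all₂ k φ ih =>
    simp only [ren, ih]
    congr 2
    funext k'
    by_cases h : k' = k
    · subst h; simp [liftRen_comp]
    · simp [h]

/-- A strict upper bound for all the indices that occur in a formula, free or bound. -/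
def bd : Fml → ℕ
  | bot => 0
  | mem s t => max (s + 1) (t + 1)
  | eq s t => max (s + 1) (t + 1)
  | rel _ i ts => max (i + 1) (Finset.univ.sup fun j => ts j + 1)
  | imp φ ψ => max φ.bd ψ.bd
  | all φ => φ.bd
  | all₂ _ φ => φ.bd

/-- A renaming matters only below `bd`. Bound indices count as well, so that the bound need not be
lowered under a quantifier. -/
theorem ren_congr (φ : Fml) {n : ℕ} (hn : φ.bd ≤ n) {ρ ρ' : ℕ → ℕ} {τ τ' : ℕ → ℕ → ℕ}
    (hρ : ∀ i < n, ρ i = ρ' i) (hτ : ∀ k, ∀ i < n, τ k i = τ' k i) :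
    φ.ren ρ τ = φ.ren ρ' τ' := by
  have lift_congr : ∀ {σ σ' : ℕ → ℕ}, (∀ i < n, σ i = σ' i) →
      ∀ i < n, liftRen σ i = liftRen σ' i := by
    intro σ σ' h i hi
    cases i with
    | zero => rfl
    | succ i => simp [liftRen, h i (by omega)]
  induction φ generalizing ρ ρ' τ τ' with
  | bot => rfl
  | mem s t => simp only [bd] at hn; simp only [ren]; rw [hρ s (by omega), hρ t (by omega)]
  | eq s t => simp only [bd] at hn; simp only [ren]; rw [hρ s (by omega), hρ t (by omega)]
  | rel k i ts =>
    simp only [bd, max_le_iff, Finset.sup_le_iff] at hn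
    simp only [ren]
    rw [hτ k i (by omega)]
    congr 1
    funext j
    exact hρ _ (hn.2 j (Finset.mem_univ j))
  | imp φ ψ ih₁ ih₂ =>
    simp only [bd, max_le_iff] at hn
    simp only [ren]
    rw [ih₁ hn.1 hρ hτ, ih₂ hn.2 hρ hτ]
  | all φ ih => simp only [ren]; rw [ih hn (lift_congr hρ) hτ]
  | all₂ k φ ih =>
    simp only [ren]
    rw [ih hn hρ]
    intro k' i hi
    by_cases h : k' = k
    · subst h; simpa using lift_congr (hτ k') i hi
    · simpa [h] using hτ k' i hi

theorem ren_id (φ : Fml) : φ.ren id (fun _ => id) = φ := by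
  have h : ∀ k : ℕ, Function.update (fun _ : ℕ => (id : ℕ → ℕ)) k (liftRen id) = fun _ => id := by
    intro k; rw [liftRen_id]; exact Function.update_eq_self k _
  induction φ with
  | bot => rfl
  | mem s t => rfl
  | eq s t => rfl
  | rel k i ts => rfl
  | imp φ ψ ih₁ ih₂ => simp only [ren, ih₁, ih₂]
  | all φ ih => simp only [ren, liftRen_id, ih]
  | all₂ k φ ih => simp only [ren, h, ih]

theorem ren_eq_self (φ : Fml) {n : ℕ} (hn : φ.bd ≤ n) {ρ : ℕ → ℕ} {τ : ℕ → ℕ → ℕ}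
    (hρ : ∀ i < n, ρ i = i) (hτ : ∀ k, ∀ i < n, τ k i = i) : φ.ren ρ τ = φ :=
  (φ.ren_congr hn hρ hτ).trans φ.ren_id

theorem shift_ren (φ : Fml) (ρ : ℕ → ℕ) (τ : ℕ → ℕ → ℕ) :
    φ.shift.ren (liftRen ρ) τ = (φ.ren ρ τ).shift := by
  simp only [shift, ren_ren]; rfl

theorem shift₂_ren (k : ℕ) (φ : Fml) (ρ : ℕ → ℕ) (τ : ℕ → ℕ → ℕ) :
    (φ.shift₂ k).ren ρ (Function.update τ k (liftRen (τ k))) = (φ.ren ρ τ).shift₂ k := by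
  simp only [shift₂, ren_ren]
  congr 1
  funext k'
  by_cases h : k' = k
  · subst h; simp only [Function.update_self]; rfl
  · simp [h]

theorem inst_ren (t : ℕ) (φ : Fml) (ρ : ℕ → ℕ) (τ : ℕ → ℕ → ℕ) :
    (φ.inst t).ren ρ τ = (φ.ren (liftRen ρ) τ).inst (ρ t) := by
  simp only [inst, ren_ren]
  congr 1
  funext i; cases i <;> rfl

theorem inst₂_ren (k j : ℕ) (φ : Fml) (ρ : ℕ → ℕ) (τ : ℕ → ℕ → ℕ) :
    (φ.inst₂ k j).ren ρ τ =
      (φ.ren ρ (Function.update τ k (liftRen (τ k)))).inst₂ k (τ k j) := by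
  simp only [inst₂, ren_ren]
  congr 1
  funext k'
  by_cases h : k' = k
  · subst h; simp only [Function.update_self]; funext i; cases i <;> rfl
  · simp [h]

theorem allN_ren (k : ℕ) (φ : Fml) (ρ : ℕ → ℕ) (τ : ℕ → ℕ → ℕ) :
    (allN k φ).ren ρ τ = allN k (φ.ren (liftRen^[k] ρ) τ) := by
  induction k generalizing φ with
  | zero => rfl
  | succ k ih =>
    simp only [allN, ih, ren, Function.iterate_succ_apply']

theorem liftRen_iterate_of_lt (ρ : ℕ → ℕ) {k i : ℕ} (h : i < k) : liftRen^[k] ρ i = i := by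
  induction k generalizing i with
  | zero => omega
  | succ k ih =>
    rw [Function.iterate_succ_apply']
    cases i with
    | zero => rfl
    | succ i => simp [liftRen, ih (by omega : i < k)]

theorem comprehension_ren (k : ℕ) (φ : Fml) (ρ : ℕ → ℕ) (τ : ℕ → ℕ → ℕ) :
    (comprehension k φ).ren ρ τ = comprehension k (φ.ren (liftRen^[k] ρ) τ) := by
  have h : ∀ j : Fin k, liftRen^[k] ρ j = j := fun j => liftRen_iterate_of_lt ρ j.2
  simp only [comprehension, ex₂, neg, ren, allN_ren, iff, conj, shift₂_ren, Function.update_self,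
    liftRen, h]

end Fml

namespace Deriv

theorem weaken {Γ : List Fml} {φ : Fml} (h : Deriv Γ φ) : ∀ {Δ : List Fml}, Γ ⊆ Δ → Deriv Δ φ := by
  induction h with
  | ax h => exact fun hs => .ax (hs h)
  | impI _ ih => exact fun hs => .impI (ih (List.cons_subset_cons _ hs))
  | impE _ _ ih₁ ih₂ => exact fun hs => .impE (ih₁ hs) (ih₂ hs)
  | raa _ ih => exact fun hs => .raa (ih (List.cons_subset_cons _ hs))
  | allI _ ih => exact fun hs => .allI (ih (List.map_subset _ hs))
  | allE t _ ih => exact fun hs => .allE t (ih hs)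
  | all₂I k _ ih => exact fun hs => .all₂I k (ih (List.map_subset _ hs))
  | all₂E k j _ ih => exact fun hs => .all₂E k j (ih hs)
  | eqRefl t => exact fun _ => .eqRefl t
  | eqSubst φ _ _ ih₁ ih₂ => exact fun hs => .eqSubst φ (ih₁ hs) (ih₂ hs)
  | comp k φ => exact fun _ => .comp k φ

theorem ren {Γ : List Fml} {φ : Fml} (h : Deriv Γ φ) : ∀ (ρ : ℕ → ℕ) (τ : ℕ → ℕ → ℕ),
    Deriv (Γ.map fun γ => γ.ren ρ τ) (φ.ren ρ τ) := by
  induction h with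
  | ax h => exact fun ρ τ => .ax (List.mem_map_of_mem h)
  | impI _ ih => exact fun ρ τ => .impI (ih ρ τ)
  | impE _ _ ih₁ ih₂ => exact fun ρ τ => .impE (ih₁ ρ τ) (ih₂ ρ τ)
  | raa _ ih => exact fun ρ τ => .raa (ih ρ τ)
  | allI _ ih =>
    intro ρ τ
    refine .allI ?_
    have := ih (liftRen ρ) τ
    simpa only [List.map_map, Function.comp_def, Fml.shift_ren] using this
  | allE t _ ih =>
    intro ρ τ
    rw [Fml.inst_ren]
    exact .allE _ (ih ρ τ)
  | all₂I k _ ih =>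
    intro ρ τ
    refine .all₂I k ?_
    have := ih ρ (Function.update τ k (liftRen (τ k)))
    simpa only [List.map_map, Function.comp_def, Fml.shift₂_ren] using this
  | all₂E k j _ ih =>
    intro ρ τ
    rw [Fml.inst₂_ren]
    exact .all₂E k _ (ih ρ τ)
  | eqRefl t => exact fun ρ τ => .eqRefl _
  | eqSubst φ _ _ ih₁ ih₂ =>
    intro ρ τ
    have h₂ := ih₂ ρ τ
    rw [Fml.inst_ren] at h₂ ⊢
    exact .eqSubst _ (ih₁ ρ τ) h₂
  | comp k φ =>
    intro ρ τ
    rw [Fml.comprehension_ren]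
    exact .comp k _

/-- Generalization on a fresh individual variable. -/
theorem all_of_fresh {Γ : List Fml} {ψ : Fml} {t : ℕ} (hΓ : ∀ γ ∈ Γ, γ.bd ≤ t) (hψ : ψ.bd ≤ t)
    (h : Deriv Γ (ψ.inst t)) : Deriv Γ ψ.all := by
  have h' := h.ren (fun i => if i = t then 0 else i + 1) (fun _ => id)
  refine .allI ?_
  have e₁ : (ψ.inst t).ren (fun i => if i = t then 0 else i + 1) (fun _ => id) = ψ := by
    rw [Fml.inst, Fml.ren_ren]
    refine ψ.ren_eq_self hψ ?_ fun _ _ _ => rfl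
    intro i hi
    cases i with
    | zero => simp [instRen]
    | succ i => simp [instRen, show i ≠ t by omega]
  have e₂ : Γ.map (fun γ => γ.ren (fun i => if i = t then 0 else i + 1) (fun _ => id)) =
      Γ.map Fml.shift := by
    refine List.map_congr_left fun γ hγ => γ.ren_congr (hΓ γ hγ) ?_ fun _ _ _ => rfl
    intro i hi
    simp [show i ≠ t by omega]
  rwa [e₁, e₂] at h'

/-- Generalization on a fresh relation variable. -/
theorem all₂_of_fresh {Γ : List Fml} {ψ : Fml} {k t : ℕ} (hΓ : ∀ γ ∈ Γ, γ.bd ≤ t) (hψ : ψ.bd ≤ t)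
    (h : Deriv Γ (ψ.inst₂ k t)) : Deriv Γ (ψ.all₂ k) := by
  have h' := h.ren id (Function.update (fun _ => id) k (fun i => if i = t then 0 else i + 1))
  refine .all₂I k ?_
  have e₁ : (ψ.inst₂ k t).ren id
      (Function.update (fun _ => id) k (fun i => if i = t then 0 else i + 1)) = ψ := by
    rw [Fml.inst₂, Fml.ren_ren]
    refine ψ.ren_eq_self hψ (fun _ _ => rfl) ?_
    intro k' i hi
    by_cases hk : k' = k
    · subst hk
      cases i with
      | zero => simp [instRen]
      | succ i => simp [instRen, show i ≠ t by omega]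
    · simp [hk]
  have e₂ : Γ.map (fun γ => γ.ren id
      (Function.update (fun _ => id) k (fun i => if i = t then 0 else i + 1))) =
      Γ.map (Fml.shift₂ k) := by
    refine List.map_congr_left fun γ hγ => γ.ren_congr (hΓ γ hγ) (fun _ _ => rfl) ?_
    intro k' i hi
    by_cases hk : k' = k
    · subst hk
      simp [show i ≠ t by omega]
    · simp [hk]
  rwa [e₁, e₂] at h'

theorem cut {Γ : List Fml} {φ ψ : Fml} (h₁ : Deriv Γ φ) (h₂ : Deriv (φ :: Γ) ψ) : Deriv Γ ψ :=
  .impE (.impI h₂) h₁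

theorem exfalso {Γ : List Fml} (φ : Fml) (h : Deriv Γ .bot) : Deriv Γ φ :=
  .raa (h.weaken (List.subset_cons_self _ _))

end Deriv

/-! ### Maximal consistent sets with witnesses -/

namespace Fml

/-- A numerical code of a formula, used only to enumerate the formulas. -/
noncomputable def toNat : Fml → ℕ
  | bot => Nat.pair 0 0
  | mem s t => Nat.pair 1 (Nat.pair s t)
  | eq s t => Nat.pair 2 (Nat.pair s t)
  | rel k i ts => Nat.pair 3 (Encodable.encode (⟨k, i, ts⟩ : Σ k : ℕ, ℕ × (Fin k → ℕ)))
  | imp φ ψ => Nat.pair 4 (Nat.pair φ.toNat ψ.toNat)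
  | all φ => Nat.pair 5 φ.toNat
  | all₂ k φ => Nat.pair 6 (Nat.pair k φ.toNat)

theorem toNat_injective : Function.Injective toNat := by
  intro φ
  induction φ with
  | bot => intro ψ h; cases ψ <;> simp_all [toNat, Nat.pair_eq_pair]
  | mem s t => intro ψ h; cases ψ <;> simp_all [toNat, Nat.pair_eq_pair]
  | eq s t => intro ψ h; cases ψ <;> simp_all [toNat, Nat.pair_eq_pair]
  | rel k i ts =>
    intro ψ h
    cases ψ with
    | rel k' i' ts' =>
      simp only [toNat, Nat.pair_eq_pair, true_and, Encodable.encode_inj] at h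
      cases h; rfl
    | _ => simp [toNat, Nat.pair_eq_pair] at h
  | imp φ₁ φ₂ ih₁ ih₂ =>
    intro ψ h
    cases ψ with
    | imp ψ₁ ψ₂ =>
      simp only [toNat, Nat.pair_eq_pair, true_and] at h
      rw [ih₁ h.1, ih₂ h.2]
    | _ => simp [toNat, Nat.pair_eq_pair] at h
  | all φ ih =>
    intro ψ h
    cases ψ with
    | all ψ =>
      simp only [toNat, Nat.pair_eq_pair, true_and] at h
      rw [ih h]
    | _ => simp [toNat, Nat.pair_eq_pair] at h
  | all₂ k φ ih =>
    intro ψ h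
    cases ψ with
    | all₂ k' ψ =>
      simp only [toNat, Nat.pair_eq_pair, true_and] at h
      rw [ih h.2, h.1]
    | _ => simp [toNat, Nat.pair_eq_pair] at h

instance : Countable Fml := toNat_injective.countable

instance : Nonempty Fml := ⟨bot⟩

end Fml

/-- `Γ'` decides `φ`, with a counterexample if `φ` is a universal formula that it refutes. -/
def Decides (Γ' : List Fml) (φ : Fml) : Prop :=
  φ ∈ Γ' ∨ (φ.neg ∈ Γ' ∧ (∀ ψ, φ = .all ψ → ∃ t, (ψ.inst t).neg ∈ Γ') ∧
    ∀ k ψ, φ = .all₂ k ψ → ∃ j, (ψ.inst₂ k j).neg ∈ Γ')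

/-- One step of Lindenbaum's construction. -/
theorem exists_decides {Γ : List Fml} (hΓ : ¬ Deriv Γ .bot) (φ : Fml) :
    ∃ Γ' : List Fml, ¬ Deriv Γ' .bot ∧ Γ ⊆ Γ' ∧ Decides Γ' φ := by
  by_cases h : Deriv (φ :: Γ) .bot
  swap
  · exact ⟨φ :: Γ, h, List.subset_cons_self _ _, .inl List.mem_cons_self⟩
  have hneg : Deriv Γ φ.neg := .impI h
  have hcon : ¬ Deriv (φ.neg :: Γ) .bot := fun h' => hΓ (hneg.cut h')
  -- an index that is fresh for everything in sight
  obtain ⟨t, ht⟩ : ∃ t, ∀ γ ∈ φ :: φ.neg :: Γ, γ.bd ≤ t := by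
    generalize φ :: φ.neg :: Γ = L
    induction L with
    | nil => exact ⟨0, by simp⟩
    | cons a L ih =>
      obtain ⟨t, ht⟩ := ih
      refine ⟨max t a.bd, ?_⟩
      intro γ hγ
      rcases List.mem_cons.1 hγ with rfl | hγ
      · exact le_max_right _ _
      · exact (ht γ hγ).trans (le_max_left _ _)
  have htφ : φ.bd ≤ t := ht φ List.mem_cons_self
  have htΓ : ∀ γ ∈ φ.neg :: Γ, γ.bd ≤ t := fun γ hγ => ht γ (List.mem_cons_of_mem _ hγ)
  have sub : ∀ χ : Fml, Γ ⊆ χ :: φ.neg :: Γ := fun χ γ hγ =>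
    List.mem_cons_of_mem _ (List.mem_cons_of_mem _ hγ)
  cases φ with
  | all ψ =>
    refine ⟨(ψ.inst t).neg :: ψ.all.neg :: Γ, ?_, sub _, .inr ⟨by simp, ?_, by simp⟩⟩
    · intro h'
      exact hcon (.impE (.ax List.mem_cons_self) (Deriv.all_of_fresh htΓ htφ (.raa h')))
    · rintro _ ⟨⟩; exact ⟨t, by simp⟩
  | all₂ k ψ =>
    refine ⟨(ψ.inst₂ k t).neg :: (ψ.all₂ k).neg :: Γ, ?_, sub _, .inr ⟨by simp, by simp, ?_⟩⟩
    · intro h'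
      exact hcon (.impE (.ax List.mem_cons_self) (Deriv.all₂_of_fresh htΓ htφ (.raa h')))
    · rintro _ _ ⟨⟩; exact ⟨t, by simp⟩
  | _ => exact ⟨_, hcon, List.subset_cons_self _ _, .inr ⟨List.mem_cons_self, by simp, by simp⟩⟩

/-- A deductively closed, consistent, complete set of formulas in which every refuted universal
formula has a refuted instance. -/
structure HenkinSet where
  carrier : Set Fml
  closed : ∀ {L : List Fml} {φ : Fml}, (∀ γ ∈ L, γ ∈ carrier) → Deriv L φ → φ ∈ carrier
  bot_notMem : Fml.bot ∉ carrier
  complete : ∀ φ : Fml, φ ∉ carrier → φ.neg ∈ carrier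
  witness : ∀ φ : Fml, (∀ t, φ.inst t ∈ carrier) → φ.all ∈ carrier
  witness₂ : ∀ (k : ℕ) (φ : Fml), (∀ j, φ.inst₂ k j ∈ carrier) → φ.all₂ k ∈ carrier

/-- Lindenbaum's lemma, with witnesses. -/
theorem exists_henkinSet {Γ : List Fml} (hΓ : ¬ Deriv Γ .bot) :
    ∃ H : HenkinSet, ∀ γ ∈ Γ, γ ∈ H.carrier := by
  obtain ⟨e, he⟩ := exists_surjective_nat Fml
  let Stage := {Γ : List Fml // ¬ Deriv Γ .bot}
  have hstep : ∀ (Γ : Stage) (φ : Fml), ∃ Γ' : Stage, Γ.1 ⊆ Γ'.1 ∧ Decides Γ'.1 φ := by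
    intro Γ φ
    obtain ⟨Γ', h₁, h₂, h₃⟩ := exists_decides Γ.2 φ
    exact ⟨⟨Γ', h₁⟩, h₂, h₃⟩
  choose step hsub hdec using hstep
  let G : ℕ → Stage := fun n => Nat.rec ⟨Γ, hΓ⟩ (fun n Γ => step Γ (e n)) n
  have hmono : ∀ {m n}, m ≤ n → (G m).1 ⊆ (G n).1 := by
    intro m n hmn
    induction hmn with
    | refl => exact fun _ h => h
    | step _ ih => exact fun _ h => hsub _ _ (ih h)
  have hfin : ∀ L : List Fml, (∀ γ ∈ L, ∃ n, γ ∈ (G n).1) → ∃ n, L ⊆ (G n).1 := by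
    intro L
    induction L with
    | nil => exact fun _ => ⟨0, by simp⟩
    | cons a L ih =>
      intro h
      obtain ⟨n, hn⟩ := ih fun γ hγ => h γ (List.mem_cons_of_mem _ hγ)
      obtain ⟨m, hm⟩ := h a List.mem_cons_self
      refine ⟨max m n, List.cons_subset.2 ⟨hmono (le_max_left _ _) hm, ?_⟩⟩
      exact fun γ hγ => hmono (le_max_right _ _) (hn hγ)
  have hcon : ∀ L : List Fml, (∀ γ ∈ L, ∃ n, γ ∈ (G n).1) → ¬ Deriv L .bot := by
    intro L hL h
    obtain ⟨n, hn⟩ := hfin L hL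
    exact (G n).2 (h.weaken hn)
  have hall : ∀ φ, ∃ n, Decides (G n).1 φ := by
    intro φ
    obtain ⟨n, rfl⟩ := he φ
    exact ⟨n + 1, hdec (G n) (e n)⟩
  have hcomplete : ∀ φ, (¬ ∃ n, φ ∈ (G n).1) → ∃ n, φ.neg ∈ (G n).1 := by
    intro φ hφ
    obtain ⟨n, h | h⟩ := hall φ
    · exact absurd ⟨n, h⟩ hφ
    · exact ⟨n, h.1⟩
  have hcontra : ∀ φ, (∃ n, φ ∈ (G n).1) → (∃ n, φ.neg ∈ (G n).1) → False := by
    intro φ h₁ h₂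
    refine hcon [φ, φ.neg] ?_ (.impE (φ := φ) (.ax (by simp [Fml.neg])) (.ax (by simp)))
    intro γ hγ
    simp only [List.mem_cons, List.not_mem_nil, or_false] at hγ
    rcases hγ with rfl | rfl
    exacts [h₁, h₂]
  refine ⟨⟨{φ | ∃ n, φ ∈ (G n).1}, ?_, ?_, hcomplete, ?_, ?_⟩, fun γ hγ => ⟨0, hγ⟩⟩
  · intro L φ hL h
    by_contra hφ
    refine hcon (φ.neg :: L) ?_ (.impE (.ax List.mem_cons_self)
      (h.weaken (List.subset_cons_self _ _)))
    intro γ hγ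
    rcases List.mem_cons.1 hγ with rfl | hγ
    exacts [hcomplete φ hφ, hL γ hγ]
  · intro h
    exact hcon [.bot] (by simpa using h) (.ax (by simp))
  · intro φ h
    obtain ⟨n, h' | h'⟩ := hall φ.all
    · exact ⟨n, h'⟩
    · obtain ⟨t, ht⟩ := h'.2.1 φ rfl
      exact (hcontra _ (h t) ⟨n, ht⟩).elim
  · intro k φ h
    obtain ⟨n, h' | h'⟩ := hall (φ.all₂ k)
    · exact ⟨n, h'⟩
    · obtain ⟨t, ht⟩ := h'.2.2 k φ rfl
      exact (hcontra _ (h t) ⟨n, ht⟩).elim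

namespace HenkinSet

variable (H : HenkinSet)

theorem mem_of_deriv {φ : Fml} (h : Deriv [] φ) : φ ∈ H.carrier := H.closed (by simp) h

theorem mp {φ ψ : Fml} (h : φ.imp ψ ∈ H.carrier) (h' : φ ∈ H.carrier) : ψ ∈ H.carrier :=
  H.closed (L := [φ.imp ψ, φ]) (by simp [h, h']) (.impE (φ := φ) (.ax (by simp)) (.ax (by simp)))

theorem imp_mem {φ ψ : Fml} : φ.imp ψ ∈ H.carrier ↔ (φ ∈ H.carrier → ψ ∈ H.carrier) := by
  refine ⟨H.mp, fun h => ?_⟩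
  by_cases hφ : φ ∈ H.carrier
  · exact H.closed (L := [ψ]) (by simp [h hφ]) (.impI (.ax (by simp)))
  · refine H.closed (L := [φ.neg]) (by simp [H.complete φ hφ]) (.impI (Deriv.exfalso _ ?_))
    exact .impE (φ := φ) (.ax (by simp [Fml.neg])) (.ax (by simp))

theorem all_mem {φ : Fml} : φ.all ∈ H.carrier ↔ ∀ t, φ.inst t ∈ H.carrier :=
  ⟨fun h t => H.closed (L := [φ.all]) (by simp [h]) (.allE t (.ax (by simp))), H.witness φ⟩

theorem all₂_mem {k : ℕ} {φ : Fml} : φ.all₂ k ∈ H.carrier ↔ ∀ j, φ.inst₂ k j ∈ H.carrier :=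
  ⟨fun h j => H.closed (L := [φ.all₂ k]) (by simp [h]) (.all₂E k j (.ax (by simp))),
    H.witness₂ k φ⟩

theorem subst {s t : ℕ} (φ : Fml) (h : Fml.eq s t ∈ H.carrier) (h' : φ.inst s ∈ H.carrier) :
    φ.inst t ∈ H.carrier :=
  H.closed (L := [.eq s t, φ.inst s]) (by simp [h, h'])
    (.eqSubst (s := s) φ (.ax (by simp)) (.ax (by simp)))

theorem eq_refl (t : ℕ) : Fml.eq t t ∈ H.carrier := H.mem_of_deriv (.eqRefl t)

theorem eq_symm {s t : ℕ} (h : Fml.eq s t ∈ H.carrier) : Fml.eq t s ∈ H.carrier :=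
  H.subst (.eq 0 (s + 1)) h (H.eq_refl s)

theorem eq_trans {s t u : ℕ} (h : Fml.eq s t ∈ H.carrier) (h' : Fml.eq t u ∈ H.carrier) :
    Fml.eq s u ∈ H.carrier :=
  H.subst (.eq (s + 1) 0) h' h

/-- Provable equality of variables. -/
def setoid : Setoid ℕ where
  r s t := Fml.eq s t ∈ H.carrier
  iseqv := ⟨H.eq_refl, H.eq_symm, H.eq_trans⟩

/-- Provably equal variables may replace each other. -/
theorem ren_mem_of_eq (φ : Fml) (ρ ρ' : ℕ → ℕ) (τ : ℕ → ℕ → ℕ)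
    (h : ∀ i, Fml.eq (ρ i) (ρ' i) ∈ H.carrier) (hφ : φ.ren ρ τ ∈ H.carrier) :
    φ.ren ρ' τ ∈ H.carrier := by
  -- the variables are replaced one at a time
  have key : ∀ n, φ.ren (fun i => if i < n then ρ' i else ρ i) τ ∈ H.carrier := by
    intro n
    induction n with
    | zero => simpa using hφ
    | succ n ih =>
      have e : ∀ t,
          (φ.ren (fun i => if i = n then 0 else (if i < n then ρ' i else ρ i) + 1) τ).inst t =
            φ.ren (fun i => if i = n then t else if i < n then ρ' i else ρ i) τ := by
        intro t
        rw [Fml.inst, Fml.ren_ren]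
        congr 1
        funext i
        by_cases hi : i = n <;> simp [hi, instRen]
      have := H.subst _ (h n) (by
        rw [e]
        convert ih using 2
        funext i
        by_cases hi : i = n <;> simp [hi])
      rw [e] at this
      convert this using 2
      funext i
      rcases lt_trichotomy i n with hi | hi | hi
      · simp [hi, hi.ne, show i < n + 1 by omega]
      · simp [hi]
      · simp [hi.ne', show ¬ i < n by omega, show ¬ i < n + 1 by omega]
  have := key φ.bd
  rwa [φ.ren_congr le_rfl (ρ' := ρ') (τ' := τ) (fun i hi => by simp [hi]) fun _ _ _ => rfl] at this

end HenkinSet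

/-! ### General structures and completeness -/

/-- A general (Henkin) structure for the second-order language of set theory: the `k`-ary relation
variables range over `Rel k`. -/
structure GenStr where
  Dom : Type
  Rel : ℕ → Type
  mem : Dom → Dom → Prop
  app : ∀ {k : ℕ}, Rel k → (Fin k → Dom) → Prop

namespace GenStr

variable (S : GenStr)

/-- Assignments to the relation variables. -/
abbrev RelEnv : Type := ∀ k : ℕ, ℕ → S.Rel k

variable {S}

/-- Assign `R` to the `k`-ary relation variable `0`, moving the others up. -/
def push (V : S.RelEnv) (k : ℕ) (R : S.Rel k) : S.RelEnv := Function.update V k (scons R (V k))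

variable (S)

/-- Satisfaction in a general structure. -/
def Sat : Fml → (ℕ → S.Dom) → S.RelEnv → Prop
  | .bot, _, _ => False
  | .mem s t, v, _ => S.mem (v s) (v t)
  | .eq s t, v, _ => v s = v t
  | .rel k i ts, v, V => S.app (V k i) fun j => v (ts j)
  | .imp φ ψ, v, V => Sat φ v V → Sat ψ v V
  | .all φ, v, V => ∀ a, Sat φ (scons a v) V
  | .all₂ k φ, v, V => ∀ R, Sat φ v (push V k R)

/-- All instances of comprehension hold. -/
def Comprehension : Prop :=
  ∀ (k : ℕ) (φ : Fml) (v : ℕ → S.Dom) (V : S.RelEnv), S.Sat (.comprehension k φ) v V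

theorem sat_ren (φ : Fml) (ρ : ℕ → ℕ) (τ : ℕ → ℕ → ℕ) (v : ℕ → S.Dom) (V : S.RelEnv) :
    S.Sat (φ.ren ρ τ) v V ↔ S.Sat φ (v ∘ ρ) fun k => V k ∘ τ k := by
  induction φ generalizing ρ τ v V with
  | bot => rfl
  | mem s t => rfl
  | eq s t => rfl
  | rel k i ts => rfl
  | imp φ ψ ih₁ ih₂ => simp only [Fml.ren, Sat, ih₁, ih₂]
  | all φ ih =>
    simp only [Fml.ren, Sat, ih]
    refine forall_congr' fun a => ?_
    have : scons a v ∘ liftRen ρ = scons a (v ∘ ρ) := by funext i; cases i <;> rfl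
    rw [this]
  | all₂ k φ ih =>
    simp only [Fml.ren, Sat, ih]
    refine forall_congr' fun R => ?_
    have : (fun k' => push V k R k' ∘ Function.update τ k (liftRen (τ k)) k') =
        push (fun k' => V k' ∘ τ k') k R := by
      funext k'
      by_cases h : k' = k
      · subst h; simp only [push, Function.update_self]; funext i; cases i <;> rfl
      · simp [push, h]
    rw [this]

end GenStr

namespace HenkinSet

variable (H : HenkinSet)

/-- The term structure: individuals are the individual variables up to provable equality, and
`k`-ary relations are the `k`-ary relation variables. -/
noncomputable def model : GenStr where
  Dom := Quotient H.setoid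
  Rel _ := ℕ
  mem a b := Fml.mem a.out b.out ∈ H.carrier
  app {k} i ts := Fml.rel k i (fun j => (ts j).out) ∈ H.carrier

/-- The individual named by a variable. -/
def cls (t : ℕ) : H.model.Dom := Quotient.mk H.setoid t

/-- The assignment of relations named by a renaming of the relation variables. -/
def relEnv (τ : ℕ → ℕ → ℕ) : H.model.RelEnv := τ

/-- A variable that names the given individual. -/
noncomputable def rep (a : H.model.Dom) : ℕ := Quotient.out (s := H.setoid) a

theorem cls_rep (a : H.model.Dom) : H.cls (H.rep a) = a := Quotient.out_eq _

theorem eq_rep (t : ℕ) : Fml.eq t (H.rep (H.cls t)) ∈ H.carrier :=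
  H.setoid.symm (Quotient.mk_out t)

theorem ren_rep_mem (φ : Fml) (ρ : ℕ → ℕ) (τ : ℕ → ℕ → ℕ) :
    φ.ren (fun i => H.rep (H.cls (ρ i))) τ ∈ H.carrier ↔ φ.ren ρ τ ∈ H.carrier :=
  ⟨H.ren_mem_of_eq φ _ _ τ fun _ => H.eq_symm (H.eq_rep _),
    H.ren_mem_of_eq φ _ _ τ fun _ => H.eq_rep _⟩

/-- The truth lemma for the term structure. -/
theorem sat_model (φ : Fml) (ρ : ℕ → ℕ) (τ : ℕ → ℕ → ℕ) :
    H.model.Sat φ (fun i => H.cls (ρ i)) (H.relEnv τ) ↔ φ.ren ρ τ ∈ H.carrier := by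
  induction φ generalizing ρ τ with
  | bot => exact ⟨False.elim, H.bot_notMem⟩
  | mem s t => exact H.ren_rep_mem (.mem s t) ρ τ
  | eq s t => exact Quotient.eq (r := H.setoid)
  | rel k i ts => exact H.ren_rep_mem (.rel k i ts) ρ τ
  | imp φ ψ ih₁ ih₂ => simp only [GenStr.Sat, Fml.ren, H.imp_mem, ih₁, ih₂]
  | all φ ih =>
    have hsurj : Function.Surjective H.cls := fun a => ⟨_, H.cls_rep a⟩
    simp only [GenStr.Sat, Fml.ren, H.all_mem]
    refine hsurj.forall.trans (forall_congr' fun t => ?_)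
    have e : scons (H.cls t) (fun i => H.cls (ρ i)) = fun i => H.cls (scons t ρ i) := by
      funext i; cases i <;> rfl
    have e' : (φ.ren (liftRen ρ) τ).inst t = φ.ren (scons t ρ) τ := by
      rw [Fml.inst, Fml.ren_ren]
      congr 1
      funext i; cases i <;> rfl
    rw [e, e', ih]
  | all₂ k φ ih =>
    simp only [GenStr.Sat, Fml.ren, H.all₂_mem]
    refine forall_congr' fun (j : ℕ) => ?_
    have e : GenStr.push (H.relEnv τ) k j = H.relEnv (Function.update τ k (scons j (τ k))) := rfl
    have e' : Fml.inst₂ k j (φ.ren ρ (Function.update τ k (liftRen (τ k)))) =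
        φ.ren ρ (Function.update τ k (scons j (τ k))) := by
      rw [Fml.inst₂, Fml.ren_ren]
      congr 1
      funext k'
      by_cases h : k' = k
      · subst h; simp only [Function.update_self]; funext i; cases i <;> rfl
      · simp [h]
    rw [e, e', ih]

theorem model_comprehension : H.model.Comprehension := by
  intro k φ v V
  have e : v = fun i => H.cls (H.rep (v i)) := by funext i; exact (H.cls_rep _).symm
  rw [e]
  refine (H.sat_model _ _ V).2 ?_
  exact H.mem_of_deriv ((Deriv.comp (Γ := []) k φ).ren _ _)

end HenkinSet

/-- Henkin's completeness theorem: what holds in all general structures that satisfy comprehension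
and `Γ` is derivable from `Γ`. -/
theorem Deriv.of_models {Γ : List Fml} {φ : Fml}
    (h : ∀ S : GenStr, S.Comprehension → ∀ v V, (∀ γ ∈ Γ, S.Sat γ v V) → S.Sat φ v V) :
    Deriv Γ φ := by
  refine .raa ?_
  by_contra hcon
  obtain ⟨H, hH⟩ := exists_henkinSet hcon
  have key : ∀ χ : Fml, H.model.Sat χ H.cls (H.relEnv fun _ => id) ↔ χ ∈ H.carrier := by
    intro χ
    have := H.sat_model χ id fun _ => id
    rwa [Fml.ren_id] at this
  have hφ : φ ∈ H.carrier := (key φ).1 <| h H.model H.model_comprehension _ _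
    fun γ hγ => (key γ).2 (hH γ (List.mem_cons_of_mem _ hγ))
  exact H.bot_notMem (H.mp (hH _ List.mem_cons_self) hφ)

/-! ### Set-theoretic notions in a binary relation

Each predicate in the namespace `In` is the meaning, in a structure with membership relation `E`,
of the formula of the same name in the namespace `FmlAt`. -/

namespace In

variable {M : Type} (E : M → M → Prop)

/-- `x = ∅`. -/
def isEmpty (x : M) : Prop := ∀ z, ¬ E z x
/-- `x ⊆ y`. -/
def sub (x y : M) : Prop := ∀ z, E z x → E z y
/-- `y = x ∪ {z}`. -/
def isAdjoin (y x z : M) : Prop := ∀ t, E t y ↔ E t x ∨ t = z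
/-- `p = {x, y}`. -/
def isUPair (p x y : M) : Prop := ∀ t, E t p ↔ t = x ∨ t = y
/-- `y = 𝒫(x)`. -/
def isPow (y x : M) : Prop := ∀ z, E z y ↔ sub E z x
/-- `p = ⟨x, y⟩`, the Kuratowski pair. -/
def isPair (p x y : M) : Prop := ∀ z, E z p ↔ isUPair E z x x ∨ isUPair E z x y
/-- `⟨x, y⟩ ∈ f`. -/
def maps (f x y : M) : Prop := ∃ p, isPair E p x y ∧ E p f
/-- `f` is a function with domain `x`. -/
def isFunOn (f x : M) : Prop :=
  (∀ p, E p f → ∃ u v, E u x ∧ isPair E p u v) ∧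
    ∀ u, E u x → ∃ v, maps E f u v ∧ ∀ v', maps E f u v' → v' = v
/-- `x` contains `∅` and is closed under `y ↦ y ∪ {y}`. -/
def isInductive (x : M) : Prop :=
  (∃ e, isEmpty E e ∧ E e x) ∧ ∀ y, E y x → ∃ s, isAdjoin E s y y ∧ E s x
/-- `w` is the least inductive set. -/
def isOmega (w : M) : Prop := isInductive E w ∧ ∀ x, isInductive E x → sub E w x
/-- `x` is the numeral of the (standard) number `n`. -/
def isNum : ℕ → M → Prop
  | 0, x => isEmpty E x
  | n + 1, x => ∃ y, isNum n y ∧ isAdjoin E x y y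
/-- `c = ⟨n, x⟩`. -/
def isTagged (n : ℕ) (c x : M) : Prop := ∃ t, isNum E n t ∧ isPair E c t x
/-- `c = ⟨n, ⟨x, y⟩⟩`. -/
def isTagged₂ (n : ℕ) (c x y : M) : Prop := ∃ p, isPair E p x y ∧ isTagged E n c p
/-- `c = ⌜⊥⌝`. -/
def isBotCode (c : M) : Prop := ∃ e, isEmpty E e ∧ isTagged E 0 c e
/-- `c' = ⌜¬φ⌝`, where `c = ⌜φ⌝`. -/
def isNegCode (c' c : M) : Prop := ∃ b, isBotCode E b ∧ isTagged₂ E 3 c' c b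
/-- `c = ⌜φ⌝`; false unless `φ` is first-order. -/
def isCode : Fml → M → Prop
  | .bot, c => isBotCode E c
  | .mem s t, c => ∃ i j, isNum E s i ∧ isNum E t j ∧ isTagged₂ E 1 c i j
  | .eq s t, c => ∃ i j, isNum E s i ∧ isNum E t j ∧ isTagged₂ E 2 c i j
  | .imp φ ψ, c => ∃ a b, isCode φ a ∧ isCode ψ b ∧ isTagged₂ E 3 c a b
  | .all φ, c => ∃ a, isCode φ a ∧ isTagged E 4 c a
  | .rel _ _ _, _ => False
  | .all₂ _ _, _ => False
/-- `f` is a function from `w` to the class `X`. -/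
def isAssignment (X : M → Prop) (w f : M) : Prop := isFunOn E f w ∧ ∀ u v, maps E f u v → X v
/-- `g(0) = a` and `g(j + 1) = f(j)` for all `j` in `w`. -/
def isCons (w g a f : M) : Prop :=
  (∃ e, isEmpty E e ∧ maps E g e a) ∧
    ∀ j, E j w → ∀ j', isAdjoin E j' j j → ∀ v, maps E f j v ↔ maps E g j' v
/-- The class `S` obeys Tarski's clause for `⟨X, Y⟩` at the code `c`, whose immediate subformulas
have codes in `C`. -/
def tarskiClause (X : M → Prop) (Y : M → M → Prop) (C : M → Prop) (S : M → M → Prop) (w c : M) :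
    Prop :=
  (isBotCode E c ∧ ∀ f, isAssignment E X w f → ¬ S c f) ∨
  (∃ i j, E i w ∧ E j w ∧ isTagged₂ E 1 c i j ∧ ∀ f, isAssignment E X w f →
    (S c f ↔ ∃ a b, maps E f i a ∧ maps E f j b ∧ Y a b)) ∨
  (∃ i j, E i w ∧ E j w ∧ isTagged₂ E 2 c i j ∧ ∀ f, isAssignment E X w f →
    (S c f ↔ ∃ a b, maps E f i a ∧ maps E f j b ∧ a = b)) ∨
  (∃ c₁ c₂, C c₁ ∧ C c₂ ∧ isTagged₂ E 3 c c₁ c₂ ∧ ∀ f, isAssignment E X w f →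
    (S c f ↔ (S c₁ f → S c₂ f))) ∨
  (∃ c₁, C c₁ ∧ isTagged E 4 c c₁ ∧ ∀ f, isAssignment E X w f →
    (S c f ↔ ∀ a, X a → ∀ g, isAssignment E X w g ∧ isCons E w g a f → S c₁ g))
/-- `a = R(ω)`, the union of the values of the function `n ↦ R(n)` on `ω`. -/
def isROmega (a : M) : Prop :=
  ∃ w, isOmega E w ∧ ∃ h, isFunOn E h w ∧
    (∀ n u, isEmpty E n ∧ maps E h n u → isEmpty E u) ∧
    (∀ n m u v, E n w ∧ isAdjoin E m n n ∧ maps E h n u ∧ maps E h m v → isPow E v u) ∧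
    ∀ z, E z a ↔ ∃ n u, maps E h n u ∧ E z u

end In

/-! ### Evaluating formulas written with variable names -/

/-- The value of the individual variable of level `x` when `d` individual variables are in
scope. -/
def look {α : Type*} (d : ℕ) (v : ℕ → α) (x : ℕ) : α := v (d - 1 - x)

theorem look_new {α : Type*} (d : ℕ) (v : ℕ → α) (a : α) : look (d + 1) (scons a v) d = a := by
  simp [look]

theorem look_old {α : Type*} {d x : ℕ} (h : x < d) (v : ℕ → α) (a : α) :
    look (d + 1) (scons a v) x = look d v x := by
  have : d + 1 - 1 - x = (d - 1 - x) + 1 := by omega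
  simp only [look, this, scons_succ]

namespace GenStr

variable (S : GenStr)

/-- The value of the `k`-ary relation variable of level `X` when `D k` such variables are in
scope. -/
def look₂ {S : GenStr} (k : ℕ) (D : ℕ → ℕ) (V : S.RelEnv) (X : ℕ) : S.Rel k := V k (D k - 1 - X)

/-- The class given by a unary relation. -/
def ext₁ {S : GenStr} (A : S.Rel 1) (x : S.Dom) : Prop := S.app A ![x]

/-- The binary relation on individuals given by a binary relation. -/
def ext₂ {S : GenStr} (B : S.Rel 2) (x y : S.Dom) : Prop := S.app B ![x, y]

variable {S}

theorem look₂_new (k : ℕ) (D : ℕ → ℕ) (V : S.RelEnv) (R : S.Rel k) :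
    look₂ k (Function.update D k (D k + 1)) (push V k R) (D k) = R := by
  simp [look₂, push]

theorem look₂_old (k : ℕ) (D : ℕ → ℕ) {X : ℕ} (h : X < D k) (V : S.RelEnv) (R : S.Rel k) :
    look₂ k (Function.update D k (D k + 1)) (push V k R) X = look₂ k D V X := by
  have : D k + 1 - 1 - X = (D k - 1 - X) + 1 := by omega
  simp only [look₂, push, Function.update_self, this, scons_succ]

theorem look₂_other {k k' : ℕ} (hk : k ≠ k') (D : ℕ → ℕ) {X : ℕ} (V : S.RelEnv) (R : S.Rel k')
    (m : ℕ) : look₂ k (Function.update D k' m) (push V k' R) X = look₂ k D V X := by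
  simp [look₂, push, hk]

variable (S)
variable {d : ℕ} {D : ℕ → ℕ} {v : ℕ → S.Dom} {V : S.RelEnv}

section Connectives

variable (φ ψ : Fml)

theorem sat_conj' : S.Sat (φ.conj ψ) v V ↔ S.Sat φ v V ∧ S.Sat ψ v V := by
  simp only [Fml.conj, Fml.neg, Sat]; tauto
theorem sat_disj' : S.Sat (φ.disj ψ) v V ↔ S.Sat φ v V ∨ S.Sat ψ v V := by
  simp only [Fml.disj, Fml.neg, Sat]; tauto
theorem sat_iff' : S.Sat (φ.iff ψ) v V ↔ (S.Sat φ v V ↔ S.Sat ψ v V) := by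
  simp only [Fml.iff, sat_conj', Sat]; tauto
theorem sat_ex' : S.Sat φ.ex v V ↔ ∃ a, S.Sat φ (scons a v) V := by
  simp only [Fml.ex, Fml.neg, Sat]
  exact ⟨fun h => by by_contra h'; exact h fun a ha => h' ⟨a, ha⟩, fun ⟨a, ha⟩ h => h a ha⟩
theorem sat_ex₂' (k : ℕ) : S.Sat (φ.ex₂ k) v V ↔ ∃ R, S.Sat φ v (push V k R) := by
  simp only [Fml.ex₂, Fml.neg, Sat]
  exact ⟨fun h => by by_contra h'; exact h fun a ha => h' ⟨a, ha⟩, fun ⟨a, ha⟩ h => h a ha⟩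

end Connectives

section Named

variable (φ ψ : FmlAt) (φ' : Var → FmlAt)

theorem sat_mem (x y : ℕ) : S.Sat (FmlAt.mem x y d D) v V ↔ S.mem (look d v x) (look d v y) :=
  Iff.rfl
theorem sat_eq (x y : ℕ) : S.Sat (FmlAt.eq x y d D) v V ↔ look d v x = look d v y := Iff.rfl
theorem sat_app₁ (X x : ℕ) :
    S.Sat (FmlAt.app₁ X x d D) v V ↔ ext₁ (look₂ 1 D V X) (look d v x) := by
  refine Iff.of_eq (congrArg (S.app _) ?_)
  funext j; fin_cases j; rfl
theorem sat_app₂ (Y x y : ℕ) :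
    S.Sat (FmlAt.app₂ Y x y d D) v V ↔ ext₂ (look₂ 2 D V Y) (look d v x) (look d v y) := by
  refine Iff.of_eq (congrArg (S.app _) ?_)
  funext j; fin_cases j <;> rfl
theorem sat_bot : S.Sat (FmlAt.bot d D) v V ↔ False := Iff.rfl
theorem sat_neg : S.Sat (FmlAt.neg φ d D) v V ↔ ¬ S.Sat (φ d D) v V := Iff.rfl
theorem sat_imp : S.Sat (FmlAt.imp φ ψ d D) v V ↔ (S.Sat (φ d D) v V → S.Sat (ψ d D) v V) :=
  Iff.rfl
theorem sat_conj : S.Sat (FmlAt.conj φ ψ d D) v V ↔ S.Sat (φ d D) v V ∧ S.Sat (ψ d D) v V :=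
  S.sat_conj' _ _
theorem sat_disj : S.Sat (FmlAt.disj φ ψ d D) v V ↔ S.Sat (φ d D) v V ∨ S.Sat (ψ d D) v V :=
  S.sat_disj' _ _
theorem sat_iff : S.Sat (FmlAt.iff φ ψ d D) v V ↔ (S.Sat (φ d D) v V ↔ S.Sat (ψ d D) v V) :=
  S.sat_iff' _ _
theorem sat_all : S.Sat (FmlAt.all φ' d D) v V ↔ ∀ a, S.Sat (φ' d (d + 1) D) (scons a v) V :=
  Iff.rfl
theorem sat_ex : S.Sat (FmlAt.ex φ' d D) v V ↔ ∃ a, S.Sat (φ' d (d + 1) D) (scons a v) V :=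
  S.sat_ex' _
theorem sat_all₂ (k : ℕ) (φ' : RelVar k → FmlAt) : S.Sat (FmlAt.all₂ k φ' d D) v V ↔
    ∀ R, S.Sat (φ' (D k) d (Function.update D k (D k + 1))) v (push V k R) := Iff.rfl
theorem sat_ex₂ (k : ℕ) (φ' : RelVar k → FmlAt) : S.Sat (FmlAt.ex₂ k φ' d D) v V ↔
    ∃ R, S.Sat (φ' (D k) d (Function.update D k (D k + 1))) v (push V k R) := S.sat_ex₂' _ k

end Named

attribute [simp] sat_mem sat_eq sat_app₁ sat_app₂ sat_bot sat_neg sat_imp sat_conj sat_disj sat_iff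
  sat_all sat_ex sat_all₂ sat_ex₂ look_new look_old look₂_new look₂_old look₂_other

section Notions

variable {x y z p f w a b c c' g h : ℕ}

@[simp] theorem sat_isEmpty (hx : x < d) :
    S.Sat (FmlAt.isEmpty x d D) v V ↔ In.isEmpty S.mem (look d v x) := by
  simp (disch := omega) [FmlAt.isEmpty, In.isEmpty]

@[simp] theorem sat_sub (hx : x < d) (hy : y < d) :
    S.Sat (FmlAt.sub x y d D) v V ↔ In.sub S.mem (look d v x) (look d v y) := by
  simp (disch := omega) [FmlAt.sub, In.sub]

@[simp] theorem sat_isAdjoin (hy : y < d) (hx : x < d) (hz : z < d) :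
    S.Sat (FmlAt.isAdjoin y x z d D) v V ↔
      In.isAdjoin S.mem (look d v y) (look d v x) (look d v z) := by
  simp (disch := omega) [FmlAt.isAdjoin, In.isAdjoin]

@[simp] theorem sat_isUPair (hp : p < d) (hx : x < d) (hy : y < d) :
    S.Sat (FmlAt.isUPair p x y d D) v V ↔
      In.isUPair S.mem (look d v p) (look d v x) (look d v y) := by
  simp (disch := omega) [FmlAt.isUPair, In.isUPair]

@[simp] theorem sat_isPow (hy : y < d) (hx : x < d) :
    S.Sat (FmlAt.isPow y x d D) v V ↔ In.isPow S.mem (look d v y) (look d v x) := by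
  simp (disch := omega) [FmlAt.isPow, In.isPow]

@[simp] theorem sat_isPair (hp : p < d) (hx : x < d) (hy : y < d) :
    S.Sat (FmlAt.isPair p x y d D) v V ↔
      In.isPair S.mem (look d v p) (look d v x) (look d v y) := by
  simp (disch := omega) [FmlAt.isPair, In.isPair]

@[simp] theorem sat_maps (hf : f < d) (hx : x < d) (hy : y < d) :
    S.Sat (FmlAt.maps f x y d D) v V ↔
      In.maps S.mem (look d v f) (look d v x) (look d v y) := by
  simp (disch := omega) [FmlAt.maps, In.maps]

@[simp] theorem sat_isFunOn (hf : f < d) (hx : x < d) :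
    S.Sat (FmlAt.isFunOn f x d D) v V ↔ In.isFunOn S.mem (look d v f) (look d v x) := by
  simp (disch := omega) [FmlAt.isFunOn, In.isFunOn]

@[simp] theorem sat_isInductive (hx : x < d) :
    S.Sat (FmlAt.isInductive x d D) v V ↔ In.isInductive S.mem (look d v x) := by
  simp (disch := omega) [FmlAt.isInductive, In.isInductive]

@[simp] theorem sat_isOmega (hx : x < d) :
    S.Sat (FmlAt.isOmega x d D) v V ↔ In.isOmega S.mem (look d v x) := by
  simp (disch := omega) [FmlAt.isOmega, In.isOmega]

@[simp] theorem sat_isNum (n : ℕ) (hx : x < d) :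
    S.Sat (FmlAt.isNum n x d D) v V ↔ In.isNum S.mem n (look d v x) := by
  induction n generalizing x d v with
  | zero => simp (disch := omega) [FmlAt.isNum, In.isNum]
  | succ n ih =>
    simp only [FmlAt.isNum, In.isNum, sat_ex, sat_conj]
    refine exists_congr fun a => ?_
    rw [ih (by omega)]
    simp (disch := omega)

@[simp] theorem sat_isTagged (n : ℕ) (hc : c < d) (hx : x < d) :
    S.Sat (FmlAt.isTagged n c x d D) v V ↔ In.isTagged S.mem n (look d v c) (look d v x) := by
  simp (disch := omega) [FmlAt.isTagged, In.isTagged]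

@[simp] theorem sat_isTagged₂ (n : ℕ) (hc : c < d) (hx : x < d) (hy : y < d) :
    S.Sat (FmlAt.isTagged₂ n c x y d D) v V ↔
      In.isTagged₂ S.mem n (look d v c) (look d v x) (look d v y) := by
  simp (disch := omega) [FmlAt.isTagged₂, In.isTagged₂]

@[simp] theorem sat_isBotCode (hc : c < d) :
    S.Sat (FmlAt.isBotCode c d D) v V ↔ In.isBotCode S.mem (look d v c) := by
  simp (disch := omega) [FmlAt.isBotCode, In.isBotCode]

@[simp] theorem sat_isNegCode (hc' : c' < d) (hc : c < d) :
    S.Sat (FmlAt.isNegCode c' c d D) v V ↔ In.isNegCode S.mem (look d v c') (look d v c) := by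
  simp (disch := omega) [FmlAt.isNegCode, In.isNegCode]

@[simp] theorem sat_isCode (φ : Fml) (hc : c < d) :
    S.Sat (FmlAt.isCode φ c d D) v V ↔ In.isCode S.mem φ (look d v c) := by
  induction φ generalizing c d v with
  | bot => simp (disch := omega) [FmlAt.isCode, In.isCode]
  | mem s t => simp (disch := omega) [FmlAt.isCode, In.isCode]
  | eq s t => simp (disch := omega) [FmlAt.isCode, In.isCode]
  | rel k i ts => simp (disch := omega) [FmlAt.isCode, In.isCode]
  | imp φ ψ ih₁ ih₂ =>
    simp only [FmlAt.isCode, In.isCode, sat_ex, sat_conj]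
    refine exists_congr fun a => exists_congr fun b => ?_
    rw [ih₁ (by omega), ih₂ (by omega)]
    simp (disch := omega)
  | all φ ih =>
    simp only [FmlAt.isCode, In.isCode, sat_ex, sat_conj]
    refine exists_congr fun a => ?_
    rw [ih (by omega)]
    simp (disch := omega)
  | all₂ k φ => simp (disch := omega) [FmlAt.isCode, In.isCode]

@[simp] theorem sat_isAssignment (X : ℕ) (hw : w < d) (hf : f < d) :
    S.Sat (FmlAt.isAssignment X w f d D) v V ↔
      In.isAssignment S.mem (ext₁ (look₂ 1 D V X)) (look d v w) (look d v f) := by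
  simp (disch := omega) [FmlAt.isAssignment, In.isAssignment]

@[simp] theorem sat_isCons (hw : w < d) (hg : g < d) (ha : a < d) (hf : f < d) :
    S.Sat (FmlAt.isCons w g a f d D) v V ↔
      In.isCons S.mem (look d v w) (look d v g) (look d v a) (look d v f) := by
  simp (disch := omega) [FmlAt.isCons, In.isCons]

@[simp] theorem sat_tarskiClause (X Y C Z : ℕ) (hw : w < d) (hc : c < d) :
    S.Sat (FmlAt.tarskiClause X Y C Z w c d D) v V ↔
      In.tarskiClause S.mem (ext₁ (look₂ 1 D V X)) (ext₂ (look₂ 2 D V Y)) (ext₁ (look₂ 1 D V C))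
        (ext₂ (look₂ 2 D V Z)) (look d v w) (look d v c) := by
  simp (disch := omega) [FmlAt.tarskiClause, In.tarskiClause]

@[simp] theorem sat_isROmega (ha : a < d) :
    S.Sat (FmlAt.isROmega a d D) v V ↔ In.isROmega S.mem (look d v a) := by
  simp (disch := omega) [FmlAt.isROmega, In.isROmega]

end Notions

/-- The meaning of `Sat(X, Y, c)`. -/
def IsSat (X : S.Dom → Prop) (Y : S.Dom → S.Dom → Prop) (c : S.Dom) : Prop :=
  ∃ w, In.isOmega S.mem w ∧ ∃ (C : S.Rel 1) (Z : S.Rel 2), ext₁ C c ∧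
    (∀ c', ext₁ C c' → In.tarskiClause S.mem X Y (ext₁ C) (ext₂ Z) w c') ∧
    ∀ f, In.isAssignment S.mem X w f → ext₂ Z c f

/-- The sentence with code `c` is true in all full Zermelo systems. -/
def IsConsequence (v : ℕ → S.Dom) (V : S.RelEnv) (c : S.Dom) : Prop :=
  ∀ (A : S.Rel 1) (B : S.Rel 2), (∀ x y, ext₂ B x y → ext₁ A x ∧ ext₁ A y) →
    S.Sat (FmlAt.zermelo.close.relativize 0 0) v (push (push V 1 A) 2 B) →
      S.IsSat (ext₁ A) (ext₂ B) c

theorem sat_sat {X Y c : ℕ} (hX : X < D 1) (hY : Y < D 2) (hc : c < d) :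
    S.Sat (FmlAt.sat X Y c d D) v V ↔
      S.IsSat (ext₁ (look₂ 1 D V X)) (ext₂ (look₂ 2 D V Y)) (look d v c) := by
  have hY' : Y < Function.update D 1 (D 1 + 1) 2 := by simpa using hY
  simp only [FmlAt.sat, IsSat, sat_ex, sat_conj, sat_ex₂, sat_all, sat_imp]
  refine exists_congr fun w => and_congr (by simp (disch := omega)) <|
    exists_congr fun C => exists_congr fun Z => ?_
  simp (disch := first | omega | assumption) only [sat_app₁, sat_app₂, sat_isAssignment,
    sat_tarskiClause, look_old, look_new, look₂_old, look₂_new, look₂_other]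

theorem sat_consequence {c : ℕ} (hc : c < d) :
    S.Sat (FmlAt.consequence c d D) v V ↔ S.IsConsequence v V (look d v c) := by
  simp only [FmlAt.consequence, IsConsequence, sat_all₂, sat_imp, FmlAt.zeta]
  refine forall_congr' fun A => forall_congr' fun B => ?_
  rw [sat_sat S (by simp) (by simp) hc]
  simp (disch := first | omega | assumption) only [sat_all, sat_imp, sat_conj, sat_app₁, sat_app₂,
    look_old, look_new, look₂_new, look₂_other]
  simp

theorem sat_definite (φ : Fml) : S.Sat (definite φ) v V ↔ ∃ c, In.isCode S.mem φ c ∧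
    (S.IsConsequence (scons c v) V c ∨
      ∃ c', In.isNegCode S.mem c' c ∧ S.IsConsequence (scons c' (scons c v)) V c') := by
  simp (disch := omega) only [definite, FmlAt.close, FmlAt.isDefinite, sat_ex, sat_conj, sat_disj,
    sat_consequence, sat_isCode, sat_isNegCode, look_new, look_old]

end GenStr

/-! ### Comprehension for definable predicates -/

namespace GenStr

variable (S : GenStr)

/-- The value of a variable or a constant. -/
def tval {α : Type*} (v : ℕ → α) : ℕ ⊕ α → α := Sum.elim v id

/-- A predicate of assignments that is given by a formula, with individual and relation
parameters. -/
class Dfn (P : (ℕ → S.Dom) → Prop) : Prop where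
  out : ∃ (φ : Fml) (V : S.RelEnv) (s : ℕ → ℕ ⊕ S.Dom), ∀ v, P v ↔ S.Sat φ (fun i => tval v (s i)) V

/-- A variable or a constant, as a function of the assignment. -/
class IsTerm {S : GenStr} (t : (ℕ → S.Dom) → S.Dom) : Prop where
  out : ∃ s : ℕ ⊕ S.Dom, ∀ v, t v = tval v s

instance (i : ℕ) : IsTerm (S := S) fun v => v i := ⟨.inl i, fun _ => rfl⟩
instance (c : S.Dom) : IsTerm (S := S) fun _ => c := ⟨.inr c, fun _ => rfl⟩

/-- Put the parameters of two formulas into alternate places. -/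
def interleave {α : Type*} (s t : ℕ → α) (i : ℕ) : α := if i % 2 = 0 then s (i / 2) else t (i / 2)

theorem interleave_even {α : Type*} (s t : ℕ → α) (i : ℕ) : interleave s t (2 * i) = s i := by
  simp [interleave]

theorem interleave_odd {α : Type*} (s t : ℕ → α) (i : ℕ) : interleave s t (2 * i + 1) = t i := by
  have h₁ : (2 * i + 1) % 2 = 1 := by omega
  have h₂ : (2 * i + 1) / 2 = i := by omega
  simp [interleave, h₁, h₂]

section Closure

variable {S}

instance Dfn.imp (P Q : (ℕ → S.Dom) → Prop) [hP : S.Dfn P] [hQ : S.Dfn Q] :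
    S.Dfn fun v => P v → Q v := by
  obtain ⟨φ, V, s, hφ⟩ := hP
  obtain ⟨ψ, W, t, hψ⟩ := hQ
  refine ⟨(φ.ren (2 * ·) fun _ => (2 * ·)).imp (ψ.ren (2 * · + 1) fun _ => (2 * · + 1)),
    fun k => interleave (V k) (W k), interleave s t, fun v => ?_⟩
  simp only [Sat, sat_ren, hφ, hψ, Function.comp_def, interleave_even, interleave_odd]

instance Dfn.all (P : (ℕ → S.Dom) → S.Dom → Prop)
    [hP : S.Dfn fun w => P (fun i => w (i + 1)) (w 0)] : S.Dfn fun v => ∀ a, P v a := by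
  obtain ⟨φ, V, s, hφ⟩ := hP
  classical
  -- every place that refers to the bound variable becomes the place `0`
  let ρ : ℕ → ℕ := fun i => if s i = .inl 0 then 0 else i + 1
  let s' : ℕ → ℕ ⊕ S.Dom := fun i => (s i).map Nat.pred id
  refine ⟨(φ.ren ρ fun _ => id).all, V, s', fun v => ?_⟩
  simp only [Sat, sat_ren]
  refine forall_congr' fun a => (hφ (scons a v)).trans (Iff.of_eq ?_)
  congr 1
  funext i
  rcases h : s i with (_ | n) | c <;> simp [ρ, s', h, tval]

theorem Dfn.of_iff {P Q : (ℕ → S.Dom) → Prop} (hP : S.Dfn P) (h : ∀ v, Q v ↔ P v) : S.Dfn Q := by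
  rwa [show Q = P from funext fun v => propext (h v)]

/-- Variables and constants may be substituted into definable predicates. -/
theorem Dfn.subst {P : (ℕ → S.Dom) → Prop} (hP : S.Dfn P) (t : ℕ → (ℕ → S.Dom) → S.Dom)
    (ht : ∀ i, IsTerm (t i)) : S.Dfn fun v => P fun i => t i v := by
  obtain ⟨φ, V, s, hφ⟩ := hP
  choose u hu using fun i => (ht i).out
  refine ⟨φ, V, fun i => Sum.elim u .inr (s i), fun v => (hφ _).trans (Iff.of_eq ?_)⟩
  congr 1
  funext i
  rcases h : s i with n | c
  · simpa [h, tval] using hu n v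
  · simp [h, tval]

theorem Dfn.subst₁ {P : S.Dom → Prop} (hP : S.Dfn fun v => P (v 0))
    (t : (ℕ → S.Dom) → S.Dom) [IsTerm t] : S.Dfn fun v => P (t v) :=
  hP.subst (fun _ => t) fun _ => inferInstance

theorem Dfn.subst₂ {P : S.Dom → S.Dom → Prop} (hP : S.Dfn fun v => P (v 0) (v 1))
    (t u : (ℕ → S.Dom) → S.Dom) [IsTerm t] [IsTerm u] : S.Dfn fun v => P (t v) (u v) :=
  hP.subst (fun | 0 => t | _ => u) fun i => by rcases i with _ | _ <;> assumption

theorem Dfn.subst₃ {P : S.Dom → S.Dom → S.Dom → Prop} (hP : S.Dfn fun v => P (v 0) (v 1) (v 2))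
    (t u r : (ℕ → S.Dom) → S.Dom) [IsTerm t] [IsTerm u] [IsTerm r] :
    S.Dfn fun v => P (t v) (u v) (r v) :=
  hP.subst (fun | 0 => t | 1 => u | _ => r) fun i => by
    rcases i with _ | _ | _ <;> assumption

theorem Dfn.subst₄ {P : S.Dom → S.Dom → S.Dom → S.Dom → Prop}
    (hP : S.Dfn fun v => P (v 0) (v 1) (v 2) (v 3))
    (t u r q : (ℕ → S.Dom) → S.Dom) [IsTerm t] [IsTerm u] [IsTerm r] [IsTerm q] :
    S.Dfn fun v => P (t v) (u v) (r v) (q v) :=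
  hP.subst (fun | 0 => t | 1 => u | 2 => r | _ => q) fun i => by
    rcases i with _ | _ | _ | _ <;> assumption

end Closure

/-- A Henkin structure: a general structure that satisfies comprehension and has relations of every
arity. -/
class Henkin (S : GenStr) : Prop where
  nonempty_rel : ∀ k, Nonempty (S.Rel k)
  comprehension : S.Comprehension

/-- A class of the structure: the extension of a unary relation. -/
def Cls (P : S.Dom → Prop) : Prop := ∃ A : S.Rel 1, ∀ x, ext₁ A x ↔ P x

section Henkin

variable {S}

theorem sat_allN (k : ℕ) (φ : Fml) (v : ℕ → S.Dom) (V : S.RelEnv) :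
    S.Sat (.allN k φ) v V ↔
      ∀ ts : Fin k → S.Dom, S.Sat φ (fun i => if h : i < k then ts ⟨i, h⟩ else v (i - k)) V := by
  induction k generalizing φ with
  | zero => simp [Fml.allN]
  | succ k ih =>
    rw [Fml.allN, ih, Fin.forall_fin_succ_pi, forall_comm]
    simp only [Sat]
    refine forall_congr' fun ts => forall_congr' fun a => Iff.of_eq ?_
    congr 1
    funext i
    rcases i with _ | i
    · simp
    · by_cases h : i < k
      · simp only [scons_succ, h, dif_pos, Nat.add_lt_add_iff_right]; rfl
      · simp only [scons_succ, h, dif_neg, Nat.add_lt_add_iff_right, not_false_eq_true,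
          Nat.add_sub_add_right]

variable [hS : S.Henkin]

instance : Nonempty S.RelEnv := ⟨fun k _ => (hS.nonempty_rel k).some⟩

instance Dfn.mem (t u : (ℕ → S.Dom) → S.Dom) [ht : IsTerm t] [hu : IsTerm u] :
    S.Dfn fun v => S.mem (t v) (u v) := by
  have h : S.Dfn fun v => S.mem (v 0) (v 1) :=
    ⟨.mem 0 1, Classical.arbitrary _, .inl, fun v => Iff.rfl⟩
  exact h.subst₂ t u

instance Dfn.eq (t u : (ℕ → S.Dom) → S.Dom) [ht : IsTerm t] [hu : IsTerm u] :
    S.Dfn fun v => t v = u v := by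
  have h : S.Dfn fun v => v 0 = v 1 :=
    ⟨.eq 0 1, Classical.arbitrary _, .inl, fun v => Iff.rfl⟩
  exact h.subst₂ t u

instance Dfn.ext₁ (A : S.Rel 1) (t : (ℕ → S.Dom) → S.Dom) [ht : IsTerm t] :
    S.Dfn fun v => ext₁ A (t v) := by
  have h : S.Dfn fun v => GenStr.ext₁ A (v 0) := by
    refine ⟨.rel 1 0 ![0], push (Classical.arbitrary _) 1 A, .inl, fun v => Iff.of_eq ?_⟩
    simp only [Sat, push, Function.update_self, scons_zero]
    refine congrArg (S.app A) ?_
    funext j; fin_cases j; rfl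
  exact h.subst₁ t

instance Dfn.ext₂ (B : S.Rel 2) (t u : (ℕ → S.Dom) → S.Dom) [ht : IsTerm t] [hu : IsTerm u] :
    S.Dfn fun v => ext₂ B (t v) (u v) := by
  have h : S.Dfn fun v => GenStr.ext₂ B (v 0) (v 1) := by
    refine ⟨.rel 2 0 ![0, 1], push (Classical.arbitrary _) 2 B, .inl, fun v => Iff.of_eq ?_⟩
    simp only [Sat, push, Function.update_self, scons_zero]
    refine congrArg (S.app B) ?_
    funext j; fin_cases j <;> rfl
  exact h.subst₂ t u

instance Dfn.const (p : Prop) : S.Dfn fun _ => p := by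
  by_cases h : p
  · exact ⟨.imp .bot .bot, Classical.arbitrary _, .inl, fun v => by simp [h, Sat]⟩
  · exact ⟨.bot, Classical.arbitrary _, .inl, fun v => by simp [h, Sat]⟩

instance Dfn.not (P : (ℕ → S.Dom) → Prop) [hP : S.Dfn P] : S.Dfn fun v => ¬ P v :=
  Dfn.imp P fun _ => False

instance Dfn.and (P Q : (ℕ → S.Dom) → Prop) [hP : S.Dfn P] [hQ : S.Dfn Q] :
    S.Dfn fun v => P v ∧ Q v :=
  Dfn.of_iff (inferInstance : (S.Dfn fun v => ¬ (P v → ¬ Q v))) fun v => by simp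

instance Dfn.or (P Q : (ℕ → S.Dom) → Prop) [hP : S.Dfn P] [hQ : S.Dfn Q] :
    S.Dfn fun v => P v ∨ Q v :=
  Dfn.of_iff (inferInstance : (S.Dfn fun v => ¬ P v → Q v)) fun v => by tauto

instance Dfn.iff (P Q : (ℕ → S.Dom) → Prop) [hP : S.Dfn P] [hQ : S.Dfn Q] :
    S.Dfn fun v => P v ↔ Q v :=
  Dfn.of_iff (inferInstance : (S.Dfn fun v => (P v → Q v) ∧ (Q v → P v))) fun _ => iff_def

instance Dfn.ex (P : (ℕ → S.Dom) → S.Dom → Prop)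
    [hP : S.Dfn fun w => P (fun i => w (i + 1)) (w 0)] : S.Dfn fun v => ∃ a, P v a :=
  Dfn.of_iff (inferInstance : (S.Dfn fun v => ¬ ∀ a, ¬ P v a)) fun v => by simp

/-- Comprehension, semantically. -/
theorem exists_rel (k : ℕ) (P : (ℕ → S.Dom) → Prop) [hP : S.Dfn P] (v₀ : ℕ → S.Dom) :
    ∃ R : S.Rel k, ∀ ts : Fin k → S.Dom,
      S.app R ts ↔ P fun i => if h : i < k then ts ⟨i, h⟩ else v₀ (i - k) := by
  obtain ⟨φ, V, s, hφ⟩ := hP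
  -- variables with an index below `k` keep it, and the parameters are moved above `k`
  let isVar : ℕ → Prop := fun i => ∃ n < k, s i = .inl n
  classical
  let ρ : ℕ → ℕ := fun i => if isVar i then (s i).elim id (fun _ => 0) else k + i
  let w : ℕ → S.Dom := fun i => (s i).elim (fun n => v₀ (n - k)) id
  have h := hS.comprehension k (φ.ren ρ fun _ => id) w V
  rw [Fml.comprehension, sat_ex₂'] at h
  obtain ⟨R, hR⟩ := h
  refine ⟨R, fun ts => ?_⟩
  have h := (sat_allN k _ _ _).1 hR ts
  rw [sat_iff', Fml.shift₂, sat_ren, sat_ren] at h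
  have e : (fun j : Fin k => if h : (j : ℕ) < k then ts ⟨j, h⟩ else w (j - k)) = ts := by
    funext j; simp
  simp only [Sat, e] at h
  have e' : push V k R k 0 = R := by simp [push]
  rw [e'] at h
  rw [hφ, h]
  refine Iff.of_eq ?_
  congr 1
  · funext i
    rcases hi : s i with n | c
    · by_cases hn : n < k
      · have : isVar i := ⟨n, hn, hi⟩
        simp [ρ, this, hi, tval, hn]
      · have : ¬ isVar i := by
          rintro ⟨m, hm, hm'⟩
          rw [hi] at hm'
          cases hm'
          exact hn hm
        simp [ρ, this, hi, tval, hn, w]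
    · have : ¬ isVar i := by
        rintro ⟨m, hm, hm'⟩
        rw [hi] at hm'
        cases hm'
      simp [ρ, this, hi, tval, w]
  · funext k' i
    by_cases hk : k' = k
    · subst hk; simp [push]
    · simp [push, hk]

theorem Cls.of_dfn {P : S.Dom → Prop} (h : S.Dfn fun v => P (v 0)) : S.Cls P := by
  rcases isEmpty_or_nonempty S.Dom with h' | ⟨⟨a⟩⟩
  · exact ⟨(hS.nonempty_rel 1).some, fun x => h'.elim x⟩
  · obtain ⟨A, hA⟩ := exists_rel 1 (fun v => P (v 0)) fun _ => a
    exact ⟨A, fun x => hA ![x]⟩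

theorem exists_ext₂ {P : S.Dom → S.Dom → Prop} (h : S.Dfn fun v => P (v 0) (v 1)) :
    ∃ B : S.Rel 2, ∀ x y, GenStr.ext₂ B x y ↔ P x y := by
  rcases isEmpty_or_nonempty S.Dom with h' | ⟨⟨a⟩⟩
  · exact ⟨(hS.nonempty_rel 2).some, fun x => h'.elim x⟩
  · obtain ⟨A, hA⟩ := exists_rel 2 (fun v => P (v 0) (v 1)) fun _ => a
    exact ⟨A, fun x y => hA ![x, y]⟩

section Notions

variable (t u r : (ℕ → S.Dom) → S.Dom) [IsTerm t] [IsTerm u] [IsTerm r]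

instance : S.Dfn fun v => In.isEmpty S.mem (t v) :=
  Dfn.subst₁ (by unfold In.isEmpty; infer_instance) t
instance : S.Dfn fun v => In.sub S.mem (t v) (u v) :=
  Dfn.subst₂ (by unfold In.sub; infer_instance) t u
instance : S.Dfn fun v => In.isAdjoin S.mem (t v) (u v) (r v) :=
  Dfn.subst₃ (by unfold In.isAdjoin; infer_instance) t u r
instance : S.Dfn fun v => In.isUPair S.mem (t v) (u v) (r v) :=
  Dfn.subst₃ (by unfold In.isUPair; infer_instance) t u r
instance : S.Dfn fun v => In.isPow S.mem (t v) (u v) :=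
  Dfn.subst₂ (by unfold In.isPow; infer_instance) t u
instance : S.Dfn fun v => In.isPair S.mem (t v) (u v) (r v) :=
  Dfn.subst₃ (by unfold In.isPair; infer_instance) t u r
instance : S.Dfn fun v => In.maps S.mem (t v) (u v) (r v) :=
  Dfn.subst₃ (by unfold In.maps; infer_instance) t u r
instance : S.Dfn fun v => In.isFunOn S.mem (t v) (u v) :=
  Dfn.subst₂ (by unfold In.isFunOn; infer_instance) t u
instance : S.Dfn fun v => In.isInductive S.mem (t v) :=
  Dfn.subst₁ (by unfold In.isInductive; infer_instance) t

end Notions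

end Henkin

end GenStr

/-! ### Relativization and inner structures -/

namespace Fml

/-- Every free individual variable of the formula satisfies `P`. -/
def Only : Fml → (ℕ → Bool) → Prop
  | bot, _ => True
  | mem s t, P => P s ∧ P t
  | eq s t, P => P s ∧ P t
  | rel _ _ ts, P => ∀ j, P (ts j)
  | imp φ ψ, P => φ.Only P ∧ ψ.Only P
  | all φ, P => φ.Only (scons true P)
  | all₂ _ φ, P => φ.Only P

instance decidableOnly : (φ : Fml) → (P : ℕ → Bool) → Decidable (φ.Only P)
  | bot, _ => inferInstanceAs (Decidable True)
  | mem s t, P => inferInstanceAs (Decidable (P s ∧ P t))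
  | eq s t, P => inferInstanceAs (Decidable (P s ∧ P t))
  | rel k _ ts, P => inferInstanceAs (Decidable (∀ j : Fin k, P (ts j)))
  | imp φ ψ, P =>
    have := decidableOnly φ P
    have := decidableOnly ψ P
    inferInstanceAs (Decidable (φ.Only P ∧ ψ.Only P))
  | all φ, P => decidableOnly φ (scons true P)
  | all₂ _ φ, P => decidableOnly φ P

/-- First-order formulas. -/
def isFO : Fml → Bool
  | bot => true
  | mem _ _ => true
  | eq _ _ => true
  | rel _ _ _ => false
  | imp φ ψ => φ.isFO && ψ.isFO
  | all φ => φ.isFO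
  | all₂ _ _ => false

theorem only_true (φ : Fml) : φ.Only fun _ => true := by
  have h : scons true (fun _ => true) = fun _ => true := by funext i; cases i <;> rfl
  induction φ with
  | all φ ih => simpa only [Only, h] using ih
  | _ => simp_all [Only]

end Fml

namespace GenStr

/-- The structure `⟨A, B⟩`, with the relations of the given structure. -/
def inner (S : GenStr) (A : S.Rel 1) (B : S.Rel 2) : GenStr where
  Dom := {x : S.Dom // ext₁ A x}
  Rel := S.Rel
  mem x y := ext₂ B x y
  app R ts := S.app R fun j => (ts j).1

theorem push_self {S : GenStr} (V : S.RelEnv) (k : ℕ) (R : S.Rel k) : push V k R k 0 = R := by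
  simp [push]

theorem push_of_ne {S : GenStr} (V : S.RelEnv) {k k' : ℕ} (R : S.Rel k) (h : k' ≠ k) (i : ℕ) :
    push V k R k' i = V k' i := by
  simp [push, h]

theorem sat_shift₂ {S : GenStr} (φ : Fml) (k : ℕ) (v : ℕ → S.Dom) (V : S.RelEnv) (R : S.Rel k) :
    S.Sat (φ.shift₂ k) v (push V k R) ↔ S.Sat φ v V := by
  rw [Fml.shift₂, sat_ren]
  refine Iff.of_eq ?_
  congr 1
  funext k' i
  by_cases hk : k' = k
  · subst hk; simp [push]
  · simp [push, hk]

section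

variable {S : GenStr} {A : S.Rel 1} {B : S.Rel 2}

/-- Relativization expresses satisfaction in the inner structure. The assignments need to agree only
at the free variables: a sentence can be evaluated at values outside of `A`. -/
theorem sat_relativize (φ : Fml) (P : ℕ → Bool) (hφ : φ.Only P) (v : ℕ → S.Dom)
    (v' : ℕ → (S.inner A B).Dom) (hv : ∀ i, P i → v i = (v' i).1) (V : S.RelEnv) (X Y : ℕ)
    (hX : V 1 X = A) (hY : V 2 Y = B) :
    S.Sat (φ.relativize X Y) v V ↔ (S.inner A B).Sat φ v' V := by
  induction φ generalizing P v v' V X Y with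
  | bot => rfl
  | mem s t =>
    have e : (fun j => v (![s, t] j)) = ![(v' s).1, (v' t).1] := by
      funext j; fin_cases j
      exacts [hv s hφ.1, hv t hφ.2]
    simp only [Fml.relativize, Sat, hY, e]
    rfl
  | eq s t =>
    simp only [Fml.relativize, Sat, hv s hφ.1, hv t hφ.2]
    exact Subtype.ext_iff.symm
  | rel k i ts =>
    have e : (fun j => v (ts j)) = fun j => (v' (ts j)).1 := funext fun j => hv _ (hφ j)
    simp only [Fml.relativize, Sat, e]
    rfl
  | imp φ ψ ih₁ ih₂ =>
    simp only [Fml.relativize, Sat, ih₁ P hφ.1 v v' hv V X Y hX hY,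
      ih₂ P hφ.2 v v' hv V X Y hX hY]
  | all φ ih =>
    have e : ∀ a, (fun j => scons a v (![0] j)) = ![a] := by
      intro a; funext j; fin_cases j; rfl
    simp only [Fml.relativize, Sat, hX, e]
    refine ⟨fun h a => ?_, fun h a ha => ?_⟩
    · refine (ih _ hφ (scons a.1 v) (scons a v') ?_ V X Y hX hY).1 (h a.1 a.2)
      rintro (_ | i) hi
      exacts [rfl, hv i hi]
    · refine (ih _ hφ (scons a v) (scons ⟨a, ha⟩ v') ?_ V X Y hX hY).2 (h ⟨a, ha⟩)
      rintro (_ | i) hi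
      exacts [rfl, hv i hi]
  | all₂ k φ ih =>
    simp only [Fml.relativize, Sat]
    refine forall_congr' fun R => ih P hφ v v' hv (push V k R) _ _ ?_ ?_
    · by_cases hk : k = 1
      · subst hk; simpa [push] using hX
      · simpa [push, hk, Ne.symm hk] using hX
    · by_cases hk : k = 2
      · subst hk; simpa [push] using hY
      · simpa [push, hk, Ne.symm hk] using hY

/-- Inner structures inherit comprehension, by relativization of the defining formula. -/
instance inner_henkin [hS : S.Henkin] : (S.inner A B).Henkin where
  nonempty_rel := hS.nonempty_rel
  comprehension := by
    intro k φ v V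
    -- the relations `A` and `B` become values of relation variables
    let φ' : Fml := (φ.shift₂ 1).shift₂ 2
    let V' : S.RelEnv := push (push V 1 A) 2 B
    let W : (ℕ → S.Dom) → Prop := fun w => S.Sat (φ'.relativize 0 0) w V'
    have hW : S.Dfn W := ⟨_, V', .inl, fun w => Iff.rfl⟩
    obtain ⟨R, hR⟩ := exists_rel k W fun i => (v i).1
    refine (sat_ex₂' _ _ k).2 ⟨R, (sat_allN k _ _ _).2 fun ts => ?_⟩
    have h := hR fun j => (ts j).1
    rw [sat_iff']
    have e : (fun j : Fin k => if h : (j : ℕ) < k then ts ⟨j, h⟩ else v (j - k)) = ts := by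
      funext j; simp
    have e' : push (S := S.inner A B) V k R k 0 = R := push_self (S := S.inner A B) V k R
    simp only [Sat, e, e']
    refine h.trans ((sat_relativize (A := A) (B := B) φ' _ φ'.only_true _
      (fun i => if h : i < k then ts ⟨i, h⟩ else v (i - k)) ?_ V' 0 0 ?_ ?_).trans ?_)
    · intro i _
      by_cases hi : i < k <;> simp [hi]
    · exact (push_of_ne (S := S) _ _ (by decide) 0).trans (push_self (S := S) V 1 A)
    · exact push_self (S := S) (push (S := S) V 1 A) 2 B
    · exact ((sat_shift₂ (S := S.inner A B) (Fml.shift₂ 1 φ) 2 _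
        (push (S := S.inner A B) V 1 A) B).trans
        (sat_shift₂ (S := S.inner A B) φ 1 _ V A)).trans
        (sat_shift₂ (S := S.inner A B) φ k _ V R).symm

end

/-! ### Models of Zermelo set theory -/

/-- The axioms of second-order Zermelo set theory hold in the structure. -/
structure IsZermelo (S : GenStr) : Prop where
  ext : ∀ x y, (∀ z, S.mem z x ↔ S.mem z y) → x = y
  foundation : ∀ x, (∃ y, S.mem y x) → ∃ y, S.mem y x ∧ ∀ z, S.mem z x → ¬ S.mem z y
  pairing : ∀ x y, ∃ p, In.isUPair S.mem p x y
  union : ∀ x, ∃ y, ∀ z, S.mem z y ↔ ∃ t, S.mem t x ∧ S.mem z t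
  powerSet : ∀ x, ∃ y, In.isPow S.mem y x
  infinity : ∃ a, (∃ e, In.isEmpty S.mem e ∧ S.mem e a) ∧
    ∀ x y, S.mem x a ∧ S.mem y a → ∃ s, In.isAdjoin S.mem s x y ∧ S.mem s a
  comprehensiveness : ∀ x (A : S.Rel 1), ∃ y, ∀ z, S.mem z y ↔ ext₁ A z ∧ S.mem z x

theorem sat_zermelo {S : GenStr} (v : ℕ → S.Dom) (V : S.RelEnv) :
    S.Sat FmlAt.zermelo.close v V ↔ S.IsZermelo := by
  simp (disch := omega) [FmlAt.close, FmlAt.zermelo, FmlAt.extensionality, FmlAt.foundation,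
    FmlAt.pairing, FmlAt.union, FmlAt.powerSet, FmlAt.infinity, FmlAt.comprehensiveness]
  constructor
  · rintro ⟨h₁, h₂, h₃, h₄, h₅, h₆, h₇⟩
    exact ⟨h₁, fun x ⟨y, hy⟩ => h₂ x y hy, h₃, h₄, h₅, by simpa using h₆, h₇⟩
  · rintro ⟨h₁, h₂, h₃, h₄, h₅, h₆, h₇⟩
    exact ⟨h₁, fun x y hy => h₂ x ⟨y, hy⟩, h₃, h₄, h₅, by simpa using h₆, h₇⟩

/-- `ζ²(A, B)` says that the inner structure is a model of Zermelo set theory. -/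
theorem IsZermelo.of_relativize {S : GenStr} {A : S.Rel 1} {B : S.Rel 2} (v : ℕ → S.Dom)
    (V : S.RelEnv)
    (h : S.Sat (FmlAt.zermelo.close.relativize 0 0) v (push (push V 1 A) 2 B)) :
    (S.inner A B).IsZermelo := by
  have only : FmlAt.zermelo.close.Only fun _ => false := by decide
  have hA : push (push V 1 A) 2 B 1 0 = A := (push_of_ne _ _ (by decide) 0).trans (push_self _ _ _)
  have : Nonempty (S.inner A B).Dom := by
    have conj : ∀ {φ ψ : Fml} {W : S.RelEnv}, S.Sat ((φ.conj ψ).relativize 0 0) v W →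
        S.Sat (φ.relativize 0 0) v W ∧ S.Sat (ψ.relativize 0 0) v W :=
      fun h => (S.sat_conj' _ _).1 h
    by_contra hne
    refine (conj (conj (conj (conj (conj (conj h).2).2).2).2).2).1 fun a ha => ?_
    refine (hne ⟨⟨a, ?_⟩⟩).elim
    have e : (fun j => scons a v (![0] j)) = ![a] := by funext j; fin_cases j; rfl
    simp only [Sat, hA, e] at ha
    exact ha
  obtain ⟨a⟩ := this
  refine (sat_zermelo (fun _ => a) (push (push V 1 A) 2 B)).1 ?_
  exact (sat_relativize _ _ only v _ (fun _ => by simp) _ 0 0 hA (push_self _ _ _)).1 h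

end GenStr

open In

namespace GenStr

local infix:50 " ε " => GenStr.mem _

/-! ### Elementary Zermelo set theory -/

namespace IsZermelo

variable {S : GenStr} (hZ : S.IsZermelo)
include hZ

theorem upair_unique {p q x y : S.Dom} (hp : isUPair S.mem p x y) (hq : isUPair S.mem q x y) :
    p = q := hZ.ext _ _ fun z => (hp z).trans (hq z).symm

theorem adjoin_unique {p q x y : S.Dom} (hp : isAdjoin S.mem p x y) (hq : isAdjoin S.mem q x y) :
    p = q := hZ.ext _ _ fun z => (hp z).trans (hq z).symm

theorem pow_unique {p q x : S.Dom} (hp : isPow S.mem p x) (hq : isPow S.mem q x) :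
    p = q := hZ.ext _ _ fun z => (hp z).trans (hq z).symm

theorem pair_unique {p q x y : S.Dom} (hp : isPair S.mem p x y) (hq : isPair S.mem q x y) :
    p = q := hZ.ext _ _ fun z => (hp z).trans (hq z).symm

theorem empty_unique {x y : S.Dom} (hx : isEmpty S.mem x) (hy : isEmpty S.mem y) : x = y :=
  hZ.ext _ _ fun z => iff_of_false (hx z) (hy z)

theorem exists_empty : ∃ e, isEmpty S.mem e :=
  let ⟨_, ⟨e, he, _⟩, _⟩ := hZ.infinity; ⟨e, he⟩

theorem exists_union₂ (x y : S.Dom) : ∃ u, ∀ z, z ε u ↔ z ε x ∨ z ε y := by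
  obtain ⟨p, hp⟩ := hZ.pairing x y
  obtain ⟨u, hu⟩ := hZ.union p
  refine ⟨u, fun z => (hu z).trans ⟨?_, ?_⟩⟩
  · rintro ⟨t, ht, hz⟩
    rcases (hp t).1 ht with rfl | rfl
    exacts [.inl hz, .inr hz]
  · rintro (hz | hz)
    exacts [⟨x, (hp x).2 (.inl rfl), hz⟩, ⟨y, (hp y).2 (.inr rfl), hz⟩]

theorem exists_adjoin (x y : S.Dom) : ∃ s, isAdjoin S.mem s x y := by
  obtain ⟨p, hp⟩ := hZ.pairing y y
  obtain ⟨u, hu⟩ := hZ.exists_union₂ x p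
  exact ⟨u, fun t => by rw [hu, hp, or_self]⟩

theorem exists_pair (x y : S.Dom) : ∃ p, isPair S.mem p x y := by
  obtain ⟨a, ha⟩ := hZ.pairing x x
  obtain ⟨b, hb⟩ := hZ.pairing x y
  obtain ⟨p, hp⟩ := hZ.pairing a b
  refine ⟨p, fun z => (hp z).trans ⟨?_, ?_⟩⟩
  · rintro (rfl | rfl)
    exacts [.inl ha, .inr hb]
  · rintro (h | h)
    exacts [.inl (hZ.upair_unique h ha), .inr (hZ.upair_unique h hb)]

theorem pair_inj {p x y x' y' : S.Dom} (h : isPair S.mem p x y) (h' : isPair S.mem p x' y') :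
    x = x' ∧ y = y' := by
  obtain ⟨a, ha⟩ := hZ.pairing x x
  obtain ⟨b, hb⟩ := hZ.pairing x y
  obtain ⟨a', ha'⟩ := hZ.pairing x' x'
  obtain ⟨b', hb'⟩ := hZ.pairing x' y'
  have hxx : x = x' := by
    rcases (h' a).1 ((h a).2 (.inl ha)) with h₁ | h₁
    · exact (by simpa using (h₁ x).1 ((ha x).2 (.inl rfl)))
    · exact (by simpa using (ha x').1 ((h₁ x').2 (.inl rfl)) : x' = x).symm
  subst hxx
  refine ⟨rfl, ?_⟩
  have h₁ : y = x ∨ y = y' := by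
    rcases (h' b).1 ((h b).2 (.inr hb)) with h₁ | h₁
    · exact .inl (by simpa using (h₁ y).1 ((hb y).2 (.inr rfl)))
    · exact (h₁ y).1 ((hb y).2 (.inr rfl))
  have h₂ : y' = x ∨ y' = y := by
    rcases (h b').1 ((h' b').2 (.inr hb')) with h₁ | h₁
    · exact .inl (by simpa using (h₁ y').1 ((hb' y').2 (.inr rfl)))
    · exact (h₁ y').1 ((hb' y').2 (.inr rfl))
  rcases h₁ with rfl | h₁
  · rcases h₂ with rfl | h₂
    exacts [rfl, h₂.symm]
  · exact h₁

theorem mem_asymm {x y : S.Dom} (h : x ε y) : ¬ y ε x := by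
  intro h'
  obtain ⟨p, hp⟩ := hZ.pairing x y
  obtain ⟨z, hz, hz'⟩ := hZ.foundation p ⟨x, (hp x).2 (.inl rfl)⟩
  rcases (hp z).1 hz with rfl | rfl
  · exact hz' y ((hp y).2 (.inr rfl)) h'
  · exact hz' x ((hp x).2 (.inl rfl)) h

theorem succ_inj {s x y : S.Dom} (hx : isAdjoin S.mem s x x) (hy : isAdjoin S.mem s y y) :
    x = y := by
  rcases (hy x).1 ((hx x).2 (.inr rfl)) with h | h
  · rcases (hx y).1 ((hy y).2 (.inr rfl)) with h' | h'
    · exact (hZ.mem_asymm h h').elim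
    · exact h'.symm
  · exact h

omit hZ in
theorem succ_not_empty {s x y : S.Dom} (hs : isAdjoin S.mem s x y) : ¬ isEmpty S.mem s :=
  fun h => h y ((hs y).2 (.inr rfl))

variable [S.Henkin]

/-- Separation for definable predicates. -/
theorem exists_sep (P : S.Dom → Prop) (hP : S.Dfn fun v => P (v 0)) (x : S.Dom) :
    ∃ y, ∀ z, z ε y ↔ P z ∧ z ε x := by
  obtain ⟨A, hA⟩ := Cls.of_dfn hP
  obtain ⟨y, hy⟩ := hZ.comprehensiveness x A
  exact ⟨y, fun z => by rw [hy, hA]⟩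

end IsZermelo

/-! ### The hereditarily finite sets -/

/-- `a` contains `∅` and is closed under `x, y ↦ x ∪ {y}`. -/
def AdjClosed {S : GenStr} (a : S.Dom) : Prop :=
  (∀ e, isEmpty S.mem e → e ε a) ∧ ∀ x y s, x ε a → y ε a → isAdjoin S.mem s x y → s ε a

/-- `V` is the set of the hereditarily finite sets, the least set that contains `∅` and is closed
under `x, y ↦ x ∪ {y}`. -/
def IsHF {S : GenStr} (V : S.Dom) : Prop := ∀ x, x ε V ↔ ∀ a : S.Dom, AdjClosed a → x ε a

instance {S : GenStr} [S.Henkin] (t : (ℕ → S.Dom) → S.Dom) [IsTerm t] :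
    S.Dfn fun v => AdjClosed (t v) :=
  Dfn.subst₁ (by unfold AdjClosed; infer_instance) t

namespace IsZermelo

variable {S : GenStr} (hZ : S.IsZermelo) [S.Henkin]
include hZ

/-- The least set of this kind is the intersection of all of them; one exists by Infinity. -/
theorem exists_isHF : ∃ V : S.Dom, IsHF V := by
  obtain ⟨a, ⟨e, he, hea⟩, ha⟩ := hZ.infinity
  have hcl : AdjClosed a := by
    refine ⟨fun e' he' => hZ.empty_unique he he' ▸ hea, fun x y s hx hy hs => ?_⟩
    obtain ⟨s', hs', h⟩ := ha x y ⟨hx, hy⟩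
    exact hZ.adjoin_unique hs' hs ▸ h
  obtain ⟨V, hV⟩ := hZ.exists_sep (fun x => ∀ a : S.Dom, AdjClosed a → x ε a) inferInstance a
  exact ⟨V, fun x => (hV x).trans ⟨And.left, fun h => ⟨h, h a hcl⟩⟩⟩

end IsZermelo

namespace IsHF

variable {S : GenStr} {V : S.Dom} (hV : IsHF V)
include hV

theorem adjClosed : AdjClosed V :=
  ⟨fun e he => (hV e).2 fun _ ha => ha.1 e he, fun x y s hx hy hs => (hV s).2 fun a ha =>
    ha.2 x y s ((hV x).1 hx a ha) ((hV y).1 hy a ha) hs⟩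

variable (hZ : S.IsZermelo) [S.Henkin]
include hZ

/-- Induction over the hereditarily finite sets. -/
theorem induction (P : S.Dom → Prop) (hP : S.Dfn fun v => P (v 0))
    (h₀ : ∀ e, isEmpty S.mem e → P e)
    (hs : ∀ x y s, x ε V → y ε V → P x → P y → isAdjoin S.mem s x y → P s) :
    ∀ x, x ε V → P x := by
  intro x hx
  obtain ⟨a, ha⟩ := hZ.exists_sep P hP V
  refine ((ha x).1 ((hV x).1 hx a ⟨fun e he => ?_, fun x y s hx hy h => ?_⟩)).1
  · exact (ha e).2 ⟨h₀ e he, hV.adjClosed.1 e he⟩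
  · rw [ha] at hx hy ⊢
    exact ⟨hs x y s hx.2 hy.2 hx.1 hy.1 h, hV.adjClosed.2 x y s hx.2 hy.2 h⟩

theorem trans {x y : S.Dom} (hy : y ε V) (hx : x ε y) : x ε V := by
  refine hV.induction hZ (fun y => ∀ x, x ε y → x ε V) inferInstance ?_ ?_ y hy x hx
  · exact fun e he x hx => (he x hx).elim
  · intro x y s _ hy ihx _ hs z hz
    rcases (hs z).1 hz with h | rfl
    exacts [ihx z h, hy]

theorem union₂ {x y u : S.Dom} (hx : x ε V) (hy : y ε V) (hu : ∀ z, z ε u ↔ z ε x ∨ z ε y) :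
    u ε V := by
  refine hV.induction hZ (fun x => ∀ u, (∀ z, z ε u ↔ z ε x ∨ z ε y) → u ε V) inferInstance
    ?_ ?_ x hx u hu
  · intro e he u hu
    have : u = y := hZ.ext _ _ fun z => by rw [hu]; simp [he z]
    rwa [this]
  · intro x t s _ ht ihx _ hs u hu
    obtain ⟨u', hu'⟩ := hZ.exists_union₂ x y
    refine hV.adjClosed.2 u' t u (ihx u' hu') ht fun z => ?_
    rw [hu, hs, hu']
    tauto

omit [S.Henkin] in
theorem upair {p x y : S.Dom} (hx : x ε V) (hy : y ε V) (hp : isUPair S.mem p x y) : p ε V := by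
  obtain ⟨e, he⟩ := hZ.exists_empty
  obtain ⟨s, hs⟩ := hZ.exists_adjoin e x
  refine hV.adjClosed.2 s y p (hV.adjClosed.2 e x s (hV.adjClosed.1 e he) hx hs) hy fun t => ?_
  rw [hp, hs]
  simp [he t]

omit [S.Henkin] in
theorem pair {p x y : S.Dom} (hx : x ε V) (hy : y ε V) (hp : isPair S.mem p x y) : p ε V := by
  obtain ⟨a, ha⟩ := hZ.pairing x x
  obtain ⟨b, hb⟩ := hZ.pairing x y
  refine hV.upair hZ (hV.upair hZ hx hx ha) (hV.upair hZ hx hy hb) fun t => (hp t).trans ⟨?_, ?_⟩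
  · rintro (h | h)
    exacts [.inl (hZ.upair_unique h ha), .inr (hZ.upair_unique h hb)]
  · rintro (rfl | rfl)
    exacts [.inl ha, .inr hb]

theorem of_pair {p x y : S.Dom} (hp : isPair S.mem p x y) (hpV : p ε V) : x ε V ∧ y ε V := by
  obtain ⟨b, hb⟩ := hZ.pairing x y
  have hbV : b ε V := hV.trans hZ hpV ((hp b).2 (.inr hb))
  exact ⟨hV.trans hZ hbV ((hb x).2 (.inl rfl)), hV.trans hZ hbV ((hb y).2 (.inr rfl))⟩

/-- The set of the sets `z ∪ {y}`, `z ∈ u`. -/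
theorem exists_image_adjoin {u y : S.Dom} (hu : u ε V) (hy : y ε V) :
    ∃ q, q ε V ∧ ∀ t, t ε q ↔ ∃ z, z ε u ∧ isAdjoin S.mem t z y := by
  refine hV.induction hZ (fun u => ∃ q, q ε V ∧ ∀ t, t ε q ↔ ∃ z, z ε u ∧ isAdjoin S.mem t z y)
    inferInstance ?_ ?_ u hu
  · intro e he
    exact ⟨e, hV.adjClosed.1 e he, fun t => iff_of_false (he t) fun ⟨z, hz, _⟩ => he z hz⟩
  · rintro u x s hu hx ⟨q, hqV, hq⟩ _ hs
    obtain ⟨r, hr⟩ := hZ.exists_adjoin x y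
    obtain ⟨q', hq'⟩ := hZ.exists_adjoin q r
    have hrV := hV.adjClosed.2 x y r hx hy hr
    refine ⟨q', hV.adjClosed.2 q r q' hqV hrV hq', fun t => ?_⟩
    rw [hq', hq]
    constructor
    · rintro (⟨z, hz, ht⟩ | rfl)
      exacts [⟨z, (hs z).2 (.inl hz), ht⟩, ⟨x, (hs x).2 (.inr rfl), hr⟩]
    · rintro ⟨z, hz, ht⟩
      rcases (hs z).1 hz with h | rfl
      exacts [.inl ⟨z, h, ht⟩, .inr (hZ.adjoin_unique ht hr)]

/-- The subsets of `x ∪ {y}` are the subsets `z` of `x` and the sets `z ∪ {y}`. -/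
theorem pow {x p : S.Dom} (hx : x ε V) (hp : isPow S.mem p x) : p ε V := by
  suffices h : ∃ p, p ε V ∧ isPow S.mem p x by
    obtain ⟨q, hqV, hq⟩ := h
    exact hZ.pow_unique hq hp ▸ hqV
  refine hV.induction hZ (fun x => ∃ p, p ε V ∧ isPow S.mem p x) inferInstance ?_ ?_ x hx
  · intro e he
    obtain ⟨s, hs⟩ := hZ.exists_adjoin e e
    have heV := hV.adjClosed.1 e he
    refine ⟨s, hV.adjClosed.2 e e s heV heV hs, fun z => ?_⟩
    rw [hs]
    constructor
    · rintro (h | rfl)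
      exacts [(he z h).elim, fun _ h => h]
    · exact fun h => .inr (hZ.empty_unique (fun t ht => he t (h t ht)) he)
  · rintro x y s hx hy ⟨p, hpV, hp⟩ _ hs
    obtain ⟨q, hqV, hq⟩ := hV.exists_image_adjoin hZ hpV hy
    obtain ⟨u, hu⟩ := hZ.exists_union₂ p q
    refine ⟨u, hV.union₂ hZ hpV hqV hu, fun z => ?_⟩
    rw [hu, hp, hq]
    constructor
    · rintro (h | ⟨z', hz', hz⟩) t ht
      · exact (hs t).2 (.inl (h t ht))
      · exact (hs t).2 (((hz t).1 ht).imp (fun h => (hp z').1 hz' t h) id)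
    · intro h
      by_cases hyz : y ε z
      · obtain ⟨z', hz'⟩ := hZ.exists_sep (fun t => t ε x) inferInstance z
        refine .inr ⟨z', (hp z').2 fun t ht => ((hz' t).1 ht).1, fun t => ⟨fun ht => ?_, ?_⟩⟩
        · exact ((hs t).1 (h t ht)).imp (fun h => (hz' t).2 ⟨h, ht⟩) id
        · rintro (ht | rfl)
          exacts [((hz' t).1 ht).2, hyz]
      · refine .inl fun t ht => ?_
        rcases (hs t).1 (h t ht) with h | rfl
        exacts [h, (hyz ht).elim]

end IsHF

/-! ### The natural numbers -/

namespace IsZermelo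

variable {S : GenStr} (hZ : S.IsZermelo) [S.Henkin]
include hZ

theorem exists_isOmega : ∃ w, isOmega S.mem w := by
  obtain ⟨V, hV⟩ := hZ.exists_isHF
  have hind : isInductive S.mem V := by
    obtain ⟨e, he⟩ := hZ.exists_empty
    refine ⟨⟨e, he, hV.adjClosed.1 e he⟩, fun y hy => ?_⟩
    obtain ⟨s, hs⟩ := hZ.exists_adjoin y y
    exact ⟨s, hs, hV.adjClosed.2 y y s hy hy hs⟩
  obtain ⟨w, hw⟩ := hZ.exists_sep (fun x => ∀ a, isInductive S.mem a → x ε a) inferInstance V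
  have hw' : ∀ x, x ε w ↔ ∀ a, isInductive S.mem a → x ε a := fun x =>
    (hw x).trans ⟨And.left, fun h => ⟨h, h V hind⟩⟩
  refine ⟨w, ⟨?_, fun y hy => ?_⟩, fun a ha x hx => (hw' x).1 hx a ha⟩
  · obtain ⟨e, he⟩ := hZ.exists_empty
    refine ⟨e, he, (hw' e).2 fun a ⟨⟨e', he', h⟩, _⟩ => ?_⟩
    exact hZ.empty_unique he' he ▸ h
  · obtain ⟨s, hs⟩ := hZ.exists_adjoin y y
    refine ⟨s, hs, (hw' s).2 fun a ha => ?_⟩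
    obtain ⟨s', hs', h⟩ := ha.2 y ((hw' y).1 hy a ha)
    exact hZ.adjoin_unique hs' hs ▸ h

variable {w : S.Dom} (hw : isOmega S.mem w)
include hw

omit [S.Henkin] in
theorem zero_mem_omega {e : S.Dom} (he : isEmpty S.mem e) : e ε w := by
  obtain ⟨⟨⟨e', he', h⟩, _⟩, _⟩ := hw
  exact hZ.empty_unique he' he ▸ h

omit [S.Henkin] in
theorem succ_mem_omega {n m : S.Dom} (hn : n ε w) (hm : isAdjoin S.mem m n n) : m ε w := by
  obtain ⟨s', hs', h⟩ := hw.1.2 n hn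
  exact hZ.adjoin_unique hs' hm ▸ h

theorem omega_induction (P : S.Dom → Prop) (hP : S.Dfn fun v => P (v 0))
    (h₀ : ∀ e, isEmpty S.mem e → P e)
    (hs : ∀ n m, n ε w → P n → isAdjoin S.mem m n n → P m) : ∀ n, n ε w → P n := by
  intro n hn
  obtain ⟨a, ha⟩ := hZ.exists_sep P hP w
  refine ((ha n).1 (hw.2 a ⟨?_, fun y hy => ?_⟩ n hn)).1
  · obtain ⟨e, he⟩ := hZ.exists_empty
    exact ⟨e, he, (ha e).2 ⟨h₀ e he, hZ.zero_mem_omega hw he⟩⟩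
  · obtain ⟨s, hs'⟩ := hZ.exists_adjoin y y
    rw [ha] at hy
    exact ⟨s, hs', (ha s).2 ⟨hs y s hy.2 hy.1 hs', hZ.succ_mem_omega hw hy.2 hs'⟩⟩

theorem omega_cases {n : S.Dom} (hn : n ε w) :
    isEmpty S.mem n ∨ ∃ m, m ε w ∧ isAdjoin S.mem n m m :=
  hZ.omega_induction hw (fun n => isEmpty S.mem n ∨ ∃ m, m ε w ∧ isAdjoin S.mem n m m)
    inferInstance (fun _ => .inl) (fun n _ hn _ hm => .inr ⟨n, hn, hm⟩) n hn

end IsZermelo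

/-! ### `R(ω)` is the set of the hereditarily finite sets -/

namespace IsZermelo

variable {S : GenStr} (hZ : S.IsZermelo)
include hZ

theorem mem_of_maps {h w n u : S.Dom} (hh : isFunOn S.mem h w) (hm : maps S.mem h n u) : n ε w := by
  obtain ⟨p, hp, hph⟩ := hm
  obtain ⟨n', u', hn', hp'⟩ := hh.1 p hph
  exact (hZ.pair_inj hp hp').1 ▸ hn'

theorem maps_unique {h w n u u' : S.Dom} (hh : isFunOn S.mem h w) (hu : maps S.mem h n u)
    (hu' : maps S.mem h n u') : u = u' := by
  obtain ⟨v, _, hv⟩ := hh.2 n (hZ.mem_of_maps hh hu)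
  exact (hv u hu).trans (hv u' hu').symm

variable [S.Henkin]

/-- `R(ω)` consists of the hereditarily finite sets: every `R(n)` is one, since they are closed
under power sets, and every hereditarily finite set is a subset of some `R(n)`, since these form a
cumulative hierarchy. -/
theorem mem_ROmega_iff {V a : S.Dom} (hV : IsHF V) (ha : isROmega S.mem a) (z : S.Dom) :
    z ε a ↔ z ε V := by
  obtain ⟨w, hw, h, hfun, h₀, hsucc, ha⟩ := ha
  have hval : ∀ n, n ε w → ∃ u, maps S.mem h n u := fun n hn =>
    let ⟨u, hu, _⟩ := hfun.2 n hn; ⟨u, hu⟩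
  rw [ha]
  constructor
  · rintro ⟨n, u, hu, hz⟩
    refine hV.trans hZ ?_ hz
    refine hZ.omega_induction hw (fun n => ∀ u, maps S.mem h n u → u ε V) inferInstance ?_ ?_ n
      (hZ.mem_of_maps hfun hu) u hu
    · exact fun e he u hu => hV.adjClosed.1 u (h₀ e u ⟨he, hu⟩)
    · intro n m hn ih hm v hv
      obtain ⟨u, hu⟩ := hval n hn
      exact hV.pow hZ (ih u hu) (hsucc n m u v ⟨hn, hm, hu, hv⟩)
  · intro hz
    have mono : ∀ n, n ε w → ∀ m u v, isAdjoin S.mem m n n → maps S.mem h n u →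
        maps S.mem h m v → sub S.mem u v := by
      refine hZ.omega_induction hw _ inferInstance ?_ ?_
      · exact fun e he m u v _ hu _ z hz => (h₀ e u ⟨he, hu⟩ z hz).elim
      · intro n n' hn ih hn' m u' v hm hu' hv z hz
        obtain ⟨u, hu⟩ := hval n hn
        have hn'w := hZ.succ_mem_omega hw hn hn'
        have p₁ := hsucc n n' u u' ⟨hn, hn', hu, hu'⟩
        have p₂ := hsucc n' m u' v ⟨hn'w, hm, hu', hv⟩
        refine (p₂ z).2 fun t ht => ?_
        exact ih n' u u' hn' hu hu' t ((p₁ z).1 hz t ht)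
    have directed : ∀ n, n ε w → ∀ m, m ε w → ∃ k, k ε w ∧ ∀ u u' u'', maps S.mem h n u →
        maps S.mem h m u' → maps S.mem h k u'' → sub S.mem u u'' ∧ sub S.mem u' u'' := by
      refine hZ.omega_induction hw _ inferInstance ?_ ?_
      · intro e he m hm
        refine ⟨m, hm, fun u u' u'' hu hu' hu'' => ⟨?_, ?_⟩⟩
        · exact fun z hz => (h₀ e u ⟨he, hu⟩ z hz).elim
        · exact hZ.maps_unique hfun hu' hu'' ▸ fun _ h => h
      · intro n n' hn ih hn' m' hm'
        have hn'w := hZ.succ_mem_omega hw hn hn'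
        rcases hZ.omega_cases hw hm' with he | ⟨m, hm, hmm'⟩
        · refine ⟨n', hn'w, fun u u' u'' hu hu' hu'' => ⟨?_, ?_⟩⟩
          · exact hZ.maps_unique hfun hu hu'' ▸ fun _ h => h
          · exact fun z hz => (h₀ m' u' ⟨he, hu'⟩ z hz).elim
        · obtain ⟨k, hk, hkk⟩ := ih m hm
          obtain ⟨k', hk'⟩ := hZ.exists_adjoin k k
          refine ⟨k', hZ.succ_mem_omega hw hk hk', fun v v' v'' hv hv' hv'' => ?_⟩
          obtain ⟨u, hu⟩ := hval n hn
          obtain ⟨u', hu'⟩ := hval m hm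
          obtain ⟨u'', hu''⟩ := hval k hk
          have p := hsucc n n' u v ⟨hn, hn', hu, hv⟩
          have p' := hsucc m m' u' v' ⟨hm, hmm', hu', hv'⟩
          have p'' := hsucc k k' u'' v'' ⟨hk, hk', hu'', hv''⟩
          obtain ⟨s, s'⟩ := hkk u u' u'' hu hu' hu''
          exact ⟨fun z hz => (p'' z).2 fun t ht => s t ((p z).1 hz t ht),
            fun z hz => (p'' z).2 fun t ht => s' t ((p' z).1 hz t ht)⟩
    have bounded : ∀ x, x ε V → ∃ n u, n ε w ∧ maps S.mem h n u ∧ sub S.mem x u := by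
      refine hV.induction hZ _ inferInstance ?_ ?_
      · intro e he
        obtain ⟨u, hu⟩ := hval e (hZ.zero_mem_omega hw he)
        exact ⟨e, u, hZ.zero_mem_omega hw he, hu, fun z hz => (he z hz).elim⟩
      · rintro x y s - - ⟨n, u, hn, hu, hxu⟩ ⟨m, u', hm, hu', hyu⟩ hs
        obtain ⟨m', hm'⟩ := hZ.exists_adjoin m m
        have hm'w := hZ.succ_mem_omega hw hm hm'
        obtain ⟨v, hv⟩ := hval m' hm'w
        have p := hsucc m m' u' v ⟨hm, hm', hu', hv⟩
        obtain ⟨k, hk, hkk⟩ := directed n hn m' hm'w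
        obtain ⟨u'', hu''⟩ := hval k hk
        obtain ⟨s₁, s₂⟩ := hkk u v u'' hu hv hu''
        refine ⟨k, u'', hk, hu'', fun t ht => ?_⟩
        rcases (hs t).1 ht with ht | rfl
        exacts [s₁ t (hxu t ht), s₂ _ ((p _).2 hyu)]
    obtain ⟨n, u, hn, hu, hzu⟩ := bounded z hz
    obtain ⟨m, hm⟩ := hZ.exists_adjoin n n
    obtain ⟨v, hv⟩ := hval m (hZ.succ_mem_omega hw hn hm)
    exact ⟨m, v, hv, (hsucc n m u v ⟨hn, hm, hu, hv⟩ z).2 hzu⟩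

/-- `g` contains `⟨0, ∅⟩` and contains `⟨n + 1, 𝒫(x)⟩` whenever it contains `⟨n, x⟩`. -/
def RankClosed {S : GenStr} (g : S.Dom) : Prop :=
  (∀ e p, isEmpty S.mem e → isPair S.mem p e e → p ε g) ∧
    ∀ p n x m y q, p ε g → isPair S.mem p n x → isAdjoin S.mem m n n → isPow S.mem y x →
      isPair S.mem q m y → q ε g

/-- `R(ω)` exists. Without Replacement the function `n ↦ R(n)` is obtained as the least
`RankClosed` subset of the set of the hereditarily finite sets. -/
theorem exists_isROmega : ∃ a, isROmega S.mem a := by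
  obtain ⟨V, hV⟩ := hZ.exists_isHF
  obtain ⟨w, hw⟩ := hZ.exists_isOmega
  have hVcl : RankClosed V := by
    refine ⟨fun e p he hp => ?_, fun p n x m y q hp hpx hm hy hq => ?_⟩
    · exact hV.pair hZ (hV.adjClosed.1 e he) (hV.adjClosed.1 e he) hp
    · obtain ⟨hn, hx⟩ := hV.of_pair hZ hpx hp
      exact hV.pair hZ (hV.adjClosed.2 n n m hn hn hm) (hV.pow hZ hx hy) hq
  obtain ⟨h, hh⟩ := hZ.exists_sep (fun p => ∀ g : S.Dom, RankClosed g → p ε g)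
    (by unfold RankClosed; infer_instance) V
  have hh' : ∀ p, p ε h ↔ ∀ g : S.Dom, RankClosed g → p ε g := fun x =>
    (hh x).trans ⟨And.left, fun h => ⟨h, h V hVcl⟩⟩
  have hcl : RankClosed h := by
    refine ⟨fun e p he hp => (hh' p).2 fun g hg => hg.1 e p he hp,
      fun p n x m y q hp hpx hm hy hq => (hh' q).2 fun g hg => ?_⟩
    exact hg.2 p n x m y q ((hh' p).1 hp g hg) hpx hm hy hq
  have ind : ∀ P : S.Dom → Prop, (S.Dfn fun v => P (v 0)) →
      (∀ e p, isEmpty S.mem e → isPair S.mem p e e → P p) →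
      (∀ p n x m y q, p ε h → P p → isPair S.mem p n x → isAdjoin S.mem m n n →
        isPow S.mem y x → isPair S.mem q m y → P q) → ∀ p, p ε h → P p := by
    intro P hP h₀ hs p hp
    obtain ⟨g, hg⟩ := hZ.exists_sep P hP h
    refine ((hg p).1 ((hh' p).1 hp g
      ⟨fun e p he hp => ?_, fun p n x m y q hp hpx hm hy hq => ?_⟩)).1
    · exact (hg p).2 ⟨h₀ e p he hp, hcl.1 e p he hp⟩
    · rw [hg] at hp ⊢
      exact ⟨hs p n x m y q hp.2 hp.1 hpx hm hy hq, hcl.2 p n x m y q hp.2 hpx hm hy hq⟩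
  have inv : ∀ p, p ε h → (∃ e, isEmpty S.mem e ∧ isPair S.mem p e e) ∨
      ∃ q n x m y, q ε h ∧ isPair S.mem q n x ∧ isAdjoin S.mem m n n ∧ isPow S.mem y x ∧
        isPair S.mem p m y := by
    refine ind _ inferInstance (fun e p he hp => .inl ⟨e, he, hp⟩) ?_
    exact fun p n x m y q hp _ hpx hm hy hq => .inr ⟨p, n, x, m, y, hp, hpx, hm, hy, hq⟩
  have dom : ∀ p, p ε h → ∃ n x, n ε w ∧ isPair S.mem p n x := by
    refine ind _ inferInstance (fun e p he hp => ⟨e, e, hZ.zero_mem_omega hw he, hp⟩) ?_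
    rintro p n x m y q - ⟨n', x', hn', hp'⟩ hpx hm hy hq
    rw [(hZ.pair_inj hp' hpx).1] at hn'
    exact ⟨m, y, hZ.succ_mem_omega hw hn' hm, hq⟩
  have total : ∀ n, n ε w → ∃ x, maps S.mem h n x := by
    refine hZ.omega_induction hw _ inferInstance ?_ ?_
    · intro e he
      obtain ⟨p, hp⟩ := hZ.exists_pair e e
      exact ⟨e, p, hp, hcl.1 e p he hp⟩
    · rintro n m hn ⟨x, p, hp, hph⟩ hm
      obtain ⟨y, hy⟩ := hZ.powerSet x
      obtain ⟨q, hq⟩ := hZ.exists_pair m y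
      exact ⟨y, q, hq, hcl.2 p n x m y q hph hp hm hy hq⟩
  have uniq : ∀ p, p ε h → ∀ n x x', isPair S.mem p n x → maps S.mem h n x' → x' = x := by
    refine ind _ inferInstance ?_ ?_
    · rintro e p he hp n x x' hpx ⟨p', hp', hp'h⟩
      obtain ⟨rfl, rfl⟩ := hZ.pair_inj hp hpx
      rcases inv p' hp'h with ⟨e', he', hpe⟩ | ⟨q, n, y, m, z, _, _, hm, _, hpm⟩
      · rw [(hZ.pair_inj hp' hpe).2, hZ.empty_unique he' he]
      · rw [(hZ.pair_inj hp' hpm).1] at he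
        exact (succ_not_empty hm he).elim
    · rintro p n x m y q hp ih hpx hm hy hq n' y₁ x' hqn ⟨p', hp', hp'h⟩
      obtain ⟨rfl, rfl⟩ := hZ.pair_inj hq hqn
      rcases inv p' hp'h with ⟨e', he', hpe⟩ | ⟨q₂, n₂, x₂, m₂, y₂, hq₂, hqx₂, hm₂, hy₂, hpm⟩
      · rw [← (hZ.pair_inj hp' hpe).1] at he'
        exact (succ_not_empty hm he').elim
      · obtain ⟨rfl, rfl⟩ := hZ.pair_inj hp' hpm
        have := hZ.succ_inj hm hm₂
        subst this
        have := ih n x x₂ hpx ⟨q₂, hqx₂, hq₂⟩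
        subst this
        exact hZ.pow_unique hy₂ hy
  have huniq : ∀ n x x', maps S.mem h n x → maps S.mem h n x' → x' = x :=
    fun n x x' ⟨p, hp, hph⟩ hx' => uniq p hph n x x' hp hx'
  obtain ⟨a, ha⟩ := hZ.exists_sep (fun z => ∃ n u, maps S.mem h n u ∧ z ε u) inferInstance V
  refine ⟨a, w, hw, h, ⟨fun p hp => ?_, fun u hu => ?_⟩, ?_, ?_, fun z => (ha z).trans
    ⟨And.left, fun hz => ⟨hz, ?_⟩⟩⟩
  · obtain ⟨n, x, hn, hp⟩ := dom p hp
    exact ⟨n, x, hn, hp⟩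
  · obtain ⟨x, hx⟩ := total u hu
    exact ⟨x, hx, fun x' hx' => huniq u x x' hx hx'⟩
  · rintro n u ⟨hn, hu⟩
    obtain ⟨p, hp⟩ := hZ.exists_pair n n
    have := huniq n u n hu ⟨p, hp, hcl.1 n p hn hp⟩
    rwa [← this]
  · rintro n m u v ⟨hn, hm, ⟨p, hp, hph⟩, hv⟩
    obtain ⟨y, hy⟩ := hZ.powerSet u
    obtain ⟨q, hq⟩ := hZ.exists_pair m y
    have := huniq m v y hv ⟨q, hq, hcl.2 p n u m y q hph hp hm hy hq⟩
    rwa [← this]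
  · obtain ⟨n, u, ⟨p, hp, hph⟩, hzu⟩ := hz
    exact hV.trans hZ (hV.of_pair hZ hp ((hh p).1 hph).2).2 hzu

end IsZermelo

/-! ### Isomorphisms with inner structures -/

/-- `∈`-induction over the hereditarily finite sets. -/
theorem IsHF.mem_induction {S : GenStr} [S.Henkin] {V : S.Dom} (hV : IsHF V) (hZ : S.IsZermelo)
    (P : S.Dom → Prop) (hP : S.Dfn fun v => P (v 0))
    (h : ∀ x, x ε V → (∀ z, z ε x → P z) → P x) : ∀ x, x ε V → P x := by
  have : ∀ (t : (ℕ → S.Dom) → S.Dom) [IsTerm t], S.Dfn fun v => P (t v) := fun t _ => hP.subst₁ t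
  suffices h' : ∀ x, x ε V → P x ∧ ∀ z, z ε x → P z from fun x hx => (h' x hx).1
  refine hV.induction hZ _ inferInstance ?_ ?_
  · exact fun e he => ⟨h e (hV.adjClosed.1 e he) fun z hz => (he z hz).elim,
      fun z hz => (he z hz).elim⟩
  · rintro x y s hx hy ⟨-, ihx⟩ ⟨ihy, -⟩ hs
    have hall : ∀ z, z ε s → P z := by
      intro z hz
      rcases (hs z).1 hz with hz | rfl
      exacts [ihx z hz, ihy]
    exact ⟨h s (hV.adjClosed.2 x y s hx hy hs) hall, hall⟩

section Inner

variable {S : GenStr} [S.Henkin] {A : S.Rel 1} {B : S.Rel 2}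

/-- Predicates definable in a structure are definable in its inner structures. -/
theorem Dfn.inner {P : S.Dom → Prop} (hP : S.Dfn fun v => P (v 0)) :
    (S.inner A B).Dfn fun v => P (v 0).1 := by
  obtain ⟨R, hR⟩ := Cls.of_dfn hP
  refine Dfn.of_iff (Dfn.ext₁ (S := S.inner A B) R fun v => v 0) fun v => (hR _).symm.trans ?_
  refine Iff.of_eq (congrArg (S.app R) ?_)
  funext j; fin_cases j; rfl

/-- The definable relation `J` restricts to an isomorphism from the transitive set `a` onto the
transitive set `b` of the inner structure. -/
structure IsIso (J : S.Dom → S.Dom → Prop) (a : S.Dom) (b : (S.inner A B).Dom) : Prop where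
  dfn : S.Dfn fun v => J (v 0) (v 1)
  trans_left : ∀ x y, y ε a → x ε y → x ε a
  trans_right : ∀ x y, y ε b → x ε y → x ε b
  left_mem : ∀ x (y : (S.inner A B).Dom), J x y.1 → x ε a
  right_mem : ∀ x (y : (S.inner A B).Dom), J x y.1 → y ε b
  total : ∀ x, x ε a → ∃ y : (S.inner A B).Dom, J x y.1
  onto : ∀ y, y ε b → ∃ x, J x y.1
  unique : ∀ x (y y' : (S.inner A B).Dom), J x y.1 → J x y'.1 → y = y'
  inj : ∀ x x' (y : (S.inner A B).Dom), J x y.1 → J x' y.1 → x = x'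
  mem_iff : ∀ x x' (y y' : (S.inner A B).Dom), J x y.1 → J x' y'.1 → (x ε x' ↔ y ε y')

/-- The extension of a relation between the elements of `a` and those of `b` to their subsets. -/
def liftRel (S : GenStr) (A : S.Rel 1) (B : S.Rel 2) (J : S.Dom → S.Dom → Prop) (x y : S.Dom) :
    Prop :=
  (∀ x', x' ε x → ∃ y', ext₂ B y' y ∧ ext₁ A y' ∧ J x' y') ∧
    ∀ y', ext₂ B y' y → ext₁ A y' → ∃ x', x' ε x ∧ J x' y'

/-- An isomorphism between transitive sets extends to their power sets. Comprehensiveness provides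
the image of a subset in the inner structure, and the preimage of a subset in the structure itself. -/
theorem IsIso.powerSet (hZ : S.IsZermelo) (hN : (S.inner A B).IsZermelo)
    {J : S.Dom → S.Dom → Prop} {a p : S.Dom} {b q : (S.inner A B).Dom} (h : IsIso J a b)
    (hp : isPow S.mem p a) (hq : isPow (S.inner A B).mem q b) :
    ∃ J' : S.Dom → S.Dom → Prop, IsIso J' p q ∧ J' a b.1 ∧
      ∀ x (y : (S.inner A B).Dom), J x y.1 → J' x y.1 := by
  have : ∀ (t u : (ℕ → S.Dom) → S.Dom) [IsTerm t] [IsTerm u], S.Dfn fun v => J (t v) (u v) :=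
    fun t u _ _ => h.dfn.subst₂ t u
  -- the conditions on the elements, for individuals of the inner structure
  have key : ∀ x (y : (S.inner A B).Dom), liftRel S A B J x y.1 ↔
      (∀ x', x' ε x → ∃ y' : (S.inner A B).Dom, y' ε y ∧ J x' y'.1) ∧
        ∀ y' : (S.inner A B).Dom, y' ε y → ∃ x', x' ε x ∧ J x' y'.1 := by
    intro x y
    refine and_congr (forall₂_congr fun x' _ => ⟨?_, ?_⟩) ⟨?_, ?_⟩
    · exact fun ⟨y', h₁, h₂, h₃⟩ => ⟨⟨y', h₂⟩, h₁, h₃⟩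
    · exact fun ⟨y', h₁, h₃⟩ => ⟨y'.1, h₁, y'.2, h₃⟩
    · exact fun h y' hy' => h y'.1 hy' y'.2
    · exact fun h y' hy' hA => h ⟨y', hA⟩ hy'
  have ext : ∀ x (y : (S.inner A B).Dom), J x y.1 → liftRel S A B J x y.1 := by
    intro x y hxy
    refine (key x y).2 ⟨fun x' hx' => ?_, fun y' hy' => ?_⟩
    · obtain ⟨y', hy'⟩ := h.total x' (h.trans_left x' x (h.left_mem x y hxy) hx')
      exact ⟨y', (h.mem_iff _ _ _ _ hy' hxy).1 hx', hy'⟩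
    · obtain ⟨x', hx'⟩ := h.onto y' (h.trans_right y' y (h.right_mem x y hxy) hy')
      exact ⟨x', (h.mem_iff _ _ _ _ hx' hxy).2 hy', hx'⟩
  have uniq : ∀ x (y y' : (S.inner A B).Dom), liftRel S A B J x y.1 → liftRel S A B J x y'.1 →
      y = y' := by
    have sub : ∀ x (y y' : (S.inner A B).Dom), liftRel S A B J x y.1 → liftRel S A B J x y'.1 →
        ∀ z, z ε y → z ε y' := by
      intro x y y' hy hy' z hz
      obtain ⟨x', hx', hxz⟩ := ((key x y).1 hy).2 z hz
      obtain ⟨z', hz', hxz'⟩ := ((key x y').1 hy').1 x' hx'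
      exact h.unique _ _ _ hxz' hxz ▸ hz'
    exact fun x y y' hy hy' => hN.ext _ _ fun z => ⟨sub x y y' hy hy' z, sub x y' y hy' hy z⟩
  have inj : ∀ x x' (y : (S.inner A B).Dom), liftRel S A B J x y.1 → liftRel S A B J x' y.1 →
      x = x' := by
    have sub : ∀ x x' (y : (S.inner A B).Dom), liftRel S A B J x y.1 → liftRel S A B J x' y.1 →
        ∀ z, z ε x → z ε x' := by
      intro x x' y hy hy' z hz
      obtain ⟨y', hyy, hzy⟩ := ((key x y).1 hy).1 z hz
      obtain ⟨z', hz', hzy'⟩ := ((key x' y).1 hy').2 y' hyy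
      exact h.inj _ _ _ hzy' hzy ▸ hz'
    exact fun x x' y hy hy' => hZ.ext _ _ fun z => ⟨sub x x' y hy hy' z, sub x' x y hy' hy z⟩
  refine ⟨fun x y => x ε p ∧ liftRel S A B J x y, ⟨?_, ?_, ?_, ?_, ?_, ?_, ?_, ?_, ?_, ?_⟩, ?_, ?_⟩
  · unfold liftRel
    infer_instance
  · intro x y hy hx
    exact (hp x).2 fun z hz => h.trans_left z x ((hp y).1 hy x hx) hz
  · intro x y hy hx
    exact (hq x).2 fun z hz => h.trans_right z x ((hq y).1 hy x hx) hz
  · exact fun x y hxy => hxy.1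
  · intro x y hxy
    refine (hq y).2 fun z hz => ?_
    obtain ⟨x', _, hxz⟩ := ((key x y).1 hxy.2).2 z hz
    exact h.right_mem _ _ hxz
  · intro x hx
    obtain ⟨y, hy⟩ := hN.exists_sep (fun z => ∃ x', x' ε x ∧ J x' z.1)
      (Dfn.inner (P := fun z => ∃ x', x' ε x ∧ J x' z) inferInstance) b
    refine ⟨y, hx, (key x y).2 ⟨fun x' hx' => ?_, fun z hz => ((hy z).1 hz).1⟩⟩
    obtain ⟨z, hz⟩ := h.total x' ((hp x).1 hx x' hx')
    exact ⟨z, (hy z).2 ⟨⟨x', hx', hz⟩, h.right_mem _ _ hz⟩, hz⟩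
  · intro y hy
    obtain ⟨x, hx⟩ := hZ.exists_sep (fun z => ∃ y', ext₂ B y' y.1 ∧ ext₁ A y' ∧ J z y')
      inferInstance a
    refine ⟨x, (hp x).2 fun z hz => ((hx z).1 hz).2, (key x y).2 ⟨fun x' hx' => ?_,
      fun z hz => ?_⟩⟩
    · obtain ⟨⟨y', h₁, h₂, h₃⟩, -⟩ := (hx x').1 hx'
      exact ⟨⟨y', h₂⟩, h₁, h₃⟩
    · obtain ⟨x', hx'⟩ := h.onto z ((hq y).1 hy z hz)
      exact ⟨x', (hx x').2 ⟨⟨z.1, hz, z.2, hx'⟩, h.left_mem _ _ hx'⟩, hx'⟩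
  · exact fun x y y' hy hy' => uniq x y y' hy.2 hy'.2
  · exact fun x x' y hy hy' => inj x x' y hy.2 hy'.2
  · rintro x u y v ⟨-, hxy⟩ ⟨-, huv⟩
    constructor
    · intro hxu
      obtain ⟨y', hy', hxy'⟩ := ((key u v).1 huv).1 x hxu
      exact uniq x _ _ (ext x y' hxy') hxy ▸ hy'
    · intro hyv
      obtain ⟨x', hx', hxy'⟩ := ((key u v).1 huv).2 y hyv
      exact inj _ _ y (ext x' y hxy') hxy ▸ hx'
  · refine ⟨(hp a).2 fun _ h => h, (key a b).2 ⟨fun x hx => ?_, fun y hy => ?_⟩⟩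
    · obtain ⟨y, hy⟩ := h.total x hx
      exact ⟨y, h.right_mem _ _ hy, hy⟩
    · obtain ⟨x, hx⟩ := h.onto y hy
      exact ⟨x, h.left_mem _ _ hx, hx⟩
  · intro x y hxy
    exact ⟨(hp x).2 fun z hz => h.trans_left z x (h.left_mem _ _ hxy) hz, ext x y hxy⟩

omit [S.Henkin] in
/-- An isomorphism preserves the truth of first-order formulas bounded by its domain. -/
theorem IsIso.sat_bound {J : S.Dom → S.Dom → Prop} {a : S.Dom} {b : (S.inner A B).Dom}
    (h : IsIso J a b) (φ : Fml) (hφ : φ.isFO = true) (P : ℕ → Bool) (hP : φ.Only P) (i : ℕ)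
    (v : ℕ → S.Dom) (v' : ℕ → (S.inner A B).Dom) (hv : ∀ j, P j = true → J (v j) (v' j).1)
    (hi : v i = a) (hi' : v' i = b) (V : S.RelEnv) (V' : (S.inner A B).RelEnv) :
    S.Sat (φ.bound i) v V ↔ (S.inner A B).Sat (φ.bound i) v' V' := by
  induction φ generalizing P i v v' with
  | bot => rfl
  | mem s t => exact h.mem_iff _ _ _ _ (hv s hP.1) (hv t hP.2)
  | eq s t =>
    refine ⟨fun e => ?_, fun e => ?_⟩
    · exact h.unique (v t) _ _ ((show v s = v t from e) ▸ hv s hP.1) (hv t hP.2)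
    · exact h.inj _ _ (v' t) ((show v' s = v' t from e) ▸ hv s hP.1) (hv t hP.2)
  | rel k i ts => cases hφ
  | imp φ ψ ih₁ ih₂ =>
    simp only [Fml.isFO, Bool.and_eq_true] at hφ
    exact imp_congr (ih₁ hφ.1 P hP.1 i v v' hv hi hi') (ih₂ hφ.2 P hP.2 i v v' hv hi hi')
  | all φ ih =>
    have step : ∀ x (y : (S.inner A B).Dom), J x y.1 →
        (S.Sat (φ.bound (i + 1)) (scons x v) V ↔
          (S.inner A B).Sat (φ.bound (i + 1)) (scons y v') V') := by
      intro x y hxy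
      refine ih hφ _ hP (i + 1) _ _ ?_ hi hi'
      rintro (_ | j) hj
      exacts [hxy, hv j hj]
    simp only [Fml.bound, Sat, scons_zero, scons_succ, hi, hi']
    refine ⟨fun H y hy => ?_, fun H x hx => ?_⟩
    · obtain ⟨x, hx⟩ := h.onto y hy
      exact (step x y hx).1 (H x (h.left_mem _ _ hx))
    · obtain ⟨y, hy⟩ := h.total x hx
      exact (step x y hy).2 (H y (h.right_mem _ _ hy))
  | all₂ k φ => cases hφ

/-! ### Bisimulations and the hereditarily finite sets -/

/-- The set `b` of ordered pairs is a bisimulation between the structure and the inner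
structure. -/
def IsBisim (A : S.Rel 1) (B : S.Rel 2) (b : S.Dom) : Prop :=
  ∀ x y, maps S.mem b x y → ext₁ A y ∧ (∀ x', x' ε x → ∃ y', ext₂ B y' y ∧ maps S.mem b x' y') ∧
    ∀ y', ext₂ B y' y → ext₁ A y' → ∃ x', x' ε x ∧ maps S.mem b x' y'

/-- Some set-sized bisimulation relates `x` and `y`. -/
def Bisim (A : S.Rel 1) (B : S.Rel 2) (x y : S.Dom) : Prop :=
  ∃ b, IsBisim A B b ∧ maps S.mem b x y

instance (t u : (ℕ → S.Dom) → S.Dom) [IsTerm t] [IsTerm u] : S.Dfn fun v => Bisim A B (t v) (u v) :=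
  Dfn.subst₂ (by unfold Bisim IsBisim; infer_instance) t u

omit [S.Henkin] in
theorem Bisim.forth {x y : S.Dom} (h : Bisim A B x y) {x' : S.Dom} (hx : x' ε x) :
    ∃ y' : (S.inner A B).Dom, ext₂ B y'.1 y ∧ Bisim A B x' y'.1 := by
  obtain ⟨b, hb, hxy⟩ := h
  obtain ⟨y', hy', hm⟩ := (hb x y hxy).2.1 x' hx
  exact ⟨⟨y', (hb x' y' hm).1⟩, hy', b, hb, hm⟩

omit [S.Henkin] in
theorem Bisim.back {x y : S.Dom} (h : Bisim A B x y) {y' : (S.inner A B).Dom} (hy : ext₂ B y'.1 y) :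
    ∃ x', x' ε x ∧ Bisim A B x' y'.1 := by
  obtain ⟨b, hb, hxy⟩ := h
  obtain ⟨x', hx', hm⟩ := (hb x y hxy).2.2 y'.1 hy y'.2
  exact ⟨x', hx', b, hb, hm⟩

omit [S.Henkin] in
theorem maps_adjoin_pair (hZ : S.IsZermelo) {b b' p x y : S.Dom} (hp : isPair S.mem p x y)
    (hb : isAdjoin S.mem b' b p) (u v : S.Dom) :
    maps S.mem b' u v ↔ maps S.mem b u v ∨ u = x ∧ v = y := by
  constructor
  · rintro ⟨q, hq, hqb⟩
    rcases (hb q).1 hqb with h | rfl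
    exacts [.inl ⟨q, hq, h⟩, .inr (hZ.pair_inj hq hp)]
  · rintro (⟨q, hq, h⟩ | ⟨rfl, rfl⟩)
    exacts [⟨q, hq, (hb q).2 (.inl h)⟩, ⟨p, hp, (hb p).2 (.inr rfl)⟩]

omit [S.Henkin] in
theorem bisim_empty (hZ : S.IsZermelo) {e : S.Dom} {e' : (S.inner A B).Dom} (he : isEmpty S.mem e)
    (he' : isEmpty (S.inner A B).mem e') : Bisim A B e e'.1 := by
  obtain ⟨p, hp⟩ := hZ.exists_pair e e'.1
  obtain ⟨b, hb⟩ := hZ.exists_adjoin e p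
  have hmaps := maps_adjoin_pair hZ hp hb
  refine ⟨b, fun x y hxy => ?_, (hmaps _ _).2 (.inr ⟨rfl, rfl⟩)⟩
  rcases (hmaps x y).1 hxy with ⟨q, -, hq⟩ | ⟨rfl, rfl⟩
  · exact (he q hq).elim
  · exact ⟨e'.2, fun x hx => (he x hx).elim, fun y hy hA => (he' ⟨y, hA⟩ hy).elim⟩

omit [S.Henkin] in
theorem bisim_adjoin (hZ : S.IsZermelo) {x x' s : S.Dom} {y y' t : (S.inner A B).Dom}
    (h : Bisim A B x y.1) (h' : Bisim A B x' y'.1) (hs : isAdjoin S.mem s x x')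
    (ht : isAdjoin (S.inner A B).mem t y y') : Bisim A B s t.1 := by
  obtain ⟨b, hb, hxy⟩ := h
  obtain ⟨b', hb', hxy'⟩ := h'
  obtain ⟨c, hc⟩ := hZ.exists_union₂ b b'
  obtain ⟨p, hp⟩ := hZ.exists_pair s t.1
  obtain ⟨d, hd⟩ := hZ.exists_adjoin c p
  have hmaps := maps_adjoin_pair hZ hp hd
  have hb_d : ∀ u v, maps S.mem b u v → maps S.mem d u v := fun u v ⟨q, hq, hqb⟩ =>
    (hmaps u v).2 (.inl ⟨q, hq, (hc q).2 (.inl hqb)⟩)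
  have hb'_d : ∀ u v, maps S.mem b' u v → maps S.mem d u v := fun u v ⟨q, hq, hqb⟩ =>
    (hmaps u v).2 (.inl ⟨q, hq, (hc q).2 (.inr hqb)⟩)
  have lift : ∀ {b}, IsBisim A B b → (∀ u v, maps S.mem b u v → maps S.mem d u v) → ∀ u v,
      maps S.mem b u v → ext₁ A v ∧ (∀ u', u' ε u → ∃ v', ext₂ B v' v ∧ maps S.mem d u' v') ∧
        ∀ v', ext₂ B v' v → ext₁ A v' → ∃ u', u' ε u ∧ maps S.mem d u' v' := by
    intro b hb hbd u v huv
    obtain ⟨h₁, h₂, h₃⟩ := hb u v huv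
    refine ⟨h₁, fun u' hu' => ?_, fun v' hv' hA => ?_⟩
    · obtain ⟨v', hv', hm⟩ := h₂ u' hu'
      exact ⟨v', hv', hbd _ _ hm⟩
    · obtain ⟨u', hu', hm⟩ := h₃ v' hv' hA
      exact ⟨u', hu', hbd _ _ hm⟩
  refine ⟨d, fun u v huv => ?_, (hmaps _ _).2 (.inr ⟨rfl, rfl⟩)⟩
  rcases (hmaps u v).1 huv with ⟨q, hq, hqc⟩ | ⟨rfl, rfl⟩
  · rcases (hc q).1 hqc with h | h
    exacts [lift hb hb_d u v ⟨q, hq, h⟩, lift hb' hb'_d u v ⟨q, hq, h⟩]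
  · refine ⟨t.2, fun u' hu' => ?_, fun v' hv' hA => ?_⟩
    · rcases (hs u').1 hu' with h | rfl
      · obtain ⟨v', hv', hm⟩ := (hb x y.1 hxy).2.1 u' h
        exact ⟨v', (ht ⟨v', (hb _ _ hm).1⟩).2 (.inl hv'), hb_d _ _ hm⟩
      · exact ⟨y'.1, (ht y').2 (.inr rfl), hb'_d _ _ hxy'⟩
    · rcases (ht ⟨v', hA⟩).1 hv' with h | h
      · obtain ⟨u', hu', hm⟩ := (hb x y.1 hxy).2.2 v' h hA
        exact ⟨u', (hs u').2 (.inl hu'), hb_d _ _ hm⟩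
      · refine ⟨x', (hs x').2 (.inr rfl), hb'_d _ _ ?_⟩
        rw [show v' = y'.1 from congrArg Subtype.val h]
        exact hxy'

/-- Bisimilarity is an isomorphism between the sets of the hereditarily finite sets. -/
theorem exists_iso_HF (hZ : S.IsZermelo) (hN : (S.inner A B).IsZermelo) {V : S.Dom}
    {W : (S.inner A B).Dom} (hV : IsHF V) (hW : IsHF W) :
    ∃ J : S.Dom → S.Dom → Prop, IsIso J V W := by
  have total : ∀ x, x ε V → ∃ y : (S.inner A B).Dom, y ε W ∧ Bisim A B x y.1 := by
    suffices h : ∀ x, x ε V → ∃ y, ext₁ A y ∧ ext₂ B y W.1 ∧ Bisim A B x y from fun x hx =>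
      let ⟨y, h₁, h₂, h₃⟩ := h x hx; ⟨⟨y, h₁⟩, h₂, h₃⟩
    refine hV.induction hZ _ inferInstance ?_ ?_
    · intro e he
      obtain ⟨e', he'⟩ := hN.exists_empty
      exact ⟨e'.1, e'.2, hW.adjClosed.1 e' he', bisim_empty hZ he he'⟩
    · rintro x x' s - - ⟨y, hy, hyW, hxy⟩ ⟨y', hy', hyW', hxy'⟩ hs
      obtain ⟨t, ht⟩ := hN.exists_adjoin ⟨y, hy⟩ ⟨y', hy'⟩
      exact ⟨t.1, t.2, hW.adjClosed.2 ⟨y, hy⟩ ⟨y', hy'⟩ t hyW hyW' ht,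
        bisim_adjoin hZ hxy hxy' hs ht⟩
  have onto : ∀ y, y ε W → ∃ x, x ε V ∧ Bisim A B x y.1 := by
    refine hW.induction hN _ (Dfn.inner (P := fun y => ∃ x, x ε V ∧ Bisim A B x y) inferInstance)
      ?_ ?_
    · intro e' he'
      obtain ⟨e, he⟩ := hZ.exists_empty
      exact ⟨e, hV.adjClosed.1 e he, bisim_empty hZ he he'⟩
    · rintro y y' t - - ⟨x, hx, hxy⟩ ⟨x', hx', hxy'⟩ ht
      obtain ⟨s, hs⟩ := hZ.exists_adjoin x x'
      exact ⟨s, hV.adjClosed.2 _ _ s hx hx' hs, bisim_adjoin hZ hxy hxy' hs ht⟩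
  have uniq : ∀ x, x ε V → ∀ y y' : (S.inner A B).Dom, Bisim A B x y.1 → Bisim A B x y'.1 →
      y = y' := by
    suffices h : ∀ x, x ε V → ∀ y y', ext₁ A y → ext₁ A y' → Bisim A B x y → Bisim A B x y' →
        y = y' from fun x hx y y' hy hy' => Subtype.ext (h x hx y.1 y'.1 y.2 y'.2 hy hy')
    refine hV.mem_induction hZ _ inferInstance fun x hx ih y y' hy hy' hxy hxy' => ?_
    have sub : ∀ y y' : (S.inner A B).Dom, Bisim A B x y.1 → Bisim A B x y'.1 →
        ∀ z, z ε y → z ε y' := by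
      intro y y' hy hy' z hz
      obtain ⟨x', hx', hm⟩ := hy.back hz
      obtain ⟨z', hz', hm'⟩ := hy'.forth hx'
      have := ih x' hx' z.1 z'.1 z.2 z'.2 hm hm'
      exact (Subtype.ext this : z = z') ▸ hz'
    exact congrArg Subtype.val (hN.ext ⟨y, hy⟩ ⟨y', hy'⟩ fun z =>
      ⟨sub _ _ hxy hxy' z, sub ⟨y', hy'⟩ ⟨y, hy⟩ hxy' hxy z⟩)
  have inj : ∀ x, x ε V → ∀ (x' : S.Dom) (y : (S.inner A B).Dom), Bisim A B x y.1 →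
      Bisim A B x' y.1 → x = x' := by
    suffices h : ∀ x, x ε V → ∀ x' y, Bisim A B x y → Bisim A B x' y → x = x' from
      fun x hx x' y => h x hx x' y.1
    refine hV.mem_induction hZ _ inferInstance fun x hx ih x' y hxy hxy' => hZ.ext _ _ fun z =>
      ⟨fun hz => ?_, fun hz => ?_⟩
    · obtain ⟨y', hy', hm⟩ := hxy.forth hz
      obtain ⟨z', hz', hm'⟩ := hxy'.back hy'
      exact ih z hz z' y'.1 hm hm' ▸ hz'
    · obtain ⟨y', hy', hm⟩ := hxy'.forth hz
      obtain ⟨z', hz', hm'⟩ := hxy.back hy'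
      exact ih z' hz' z y'.1 hm' hm ▸ hz'
  refine ⟨fun x y => x ε V ∧ Bisim A B x y, ⟨inferInstance, fun x y hy hx => hV.trans hZ hy hx,
    fun x y hy hx => hW.trans hN hy hx, fun x y h => h.1, ?_, ?_, onto,
    fun x y y' h h' => uniq x h.1 y y' h.2 h'.2, fun x x' y h h' => inj x h.1 x' y h.2 h'.2, ?_⟩⟩
  · rintro x y ⟨hx, hxy⟩
    obtain ⟨y', hy', hxy'⟩ := total x hx
    exact uniq x hx _ _ hxy' hxy ▸ hy'
  · intro x hx
    obtain ⟨y, -, hy⟩ := total x hx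
    exact ⟨y, hx, hy⟩
  · rintro x x' y y' ⟨hx, hxy⟩ ⟨hx', hxy'⟩
    constructor
    · intro h
      obtain ⟨z, hz, hxz⟩ := hxy'.forth h
      exact uniq x hx _ _ hxz hxy ▸ hz
    · intro h
      obtain ⟨z, hz, hzy⟩ := hxy'.back (y' := y) h
      exact (inj x hx z y hxy hzy) ▸ hz

/-! ### The Continuum Hypothesis in inner structures -/

end Inner

/-- `a`, `b`, `b₂`, `b₃`, `r` are `R(ω)`, …, `R(ω + 4)`. -/
def IsRanks {S : GenStr} (a b b₂ b₃ r : S.Dom) : Prop :=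
  isROmega S.mem a ∧ isPow S.mem b a ∧ isPow S.mem b₂ b ∧ isPow S.mem b₃ b₂ ∧ isPow S.mem r b₃

/-- The matrix is evaluated with the five ranks as the values of the free variables `4`, …, `0`. -/
theorem sat_chi {S : GenStr} (v : ℕ → S.Dom) (V : S.RelEnv) : S.Sat chi v V ↔
    ∃ a b b₂ b₃ r, IsRanks a b b₂ b₃ r ∧ S.Sat ((FmlAt.ch 0 1 5 fun _ => 0).bound 0)
      (scons r (scons b₃ (scons b₂ (scons b (scons a v))))) V := by
  simp (disch := omega) only [chi, FmlAt.close, FmlAt.rankBoundedCH, sat_ex, sat_conj, sat_isROmega,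
    sat_isPow, look_new, look_old, IsRanks, and_assoc]

theorem IsZermelo.exists_isRanks {S : GenStr} [S.Henkin] (hZ : S.IsZermelo) :
    ∃ a b b₂ b₃ r : S.Dom, IsRanks a b b₂ b₃ r := by
  obtain ⟨a, ha⟩ := hZ.exists_isROmega
  obtain ⟨b, hb⟩ := hZ.powerSet a
  obtain ⟨b₂, hb₂⟩ := hZ.powerSet b
  obtain ⟨b₃, hb₃⟩ := hZ.powerSet b₂
  obtain ⟨r, hr⟩ := hZ.powerSet b₃
  exact ⟨a, b, b₂, b₃, r, ha, hb, hb₂, hb₃, hr⟩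

theorem IsZermelo.isHF_of_isROmega {S : GenStr} [S.Henkin] (hZ : S.IsZermelo) {a : S.Dom}
    (ha : isROmega S.mem a) : IsHF a := by
  obtain ⟨V, hV⟩ := hZ.exists_isHF
  exact fun x => (hZ.mem_ROmega_iff hV ha x).trans (hV x)

theorem IsZermelo.sat_chi_iff {S : GenStr} [S.Henkin] (hZ : S.IsZermelo) {a b b₂ b₃ r : S.Dom}
    (h : IsRanks a b b₂ b₃ r) (v : ℕ → S.Dom) (V : S.RelEnv) : S.Sat chi v V ↔
      S.Sat ((FmlAt.ch 0 1 5 fun _ => 0).bound 0)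
        (scons r (scons b₃ (scons b₂ (scons b (scons a v))))) V := by
  rw [sat_chi]
  refine ⟨?_, fun hs => ⟨a, b, b₂, b₃, r, h, hs⟩⟩
  rintro ⟨a', b', b₂', b₃', r', h', hs⟩
  obtain ⟨h₁, h₂, h₃, h₄, h₅⟩ := h
  obtain ⟨h₁', h₂', h₃', h₄', h₅'⟩ := h'
  have : a' = a := hZ.ext _ _ fun z => (hZ.mem_ROmega_iff (hZ.isHF_of_isROmega h₁) h₁' z)
  subst this
  obtain rfl := hZ.pow_unique h₂ h₂'
  obtain rfl := hZ.pow_unique h₃ h₃'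
  obtain rfl := hZ.pow_unique h₄ h₄'
  obtain rfl := hZ.pow_unique h₅ h₅'
  exact hs

/-- The Continuum Hypothesis has the same truth value in a model of Zermelo set theory and in its
inner models. -/
theorem sat_chi_inner {S : GenStr} [S.Henkin] {A : S.Rel 1} {B : S.Rel 2} (hZ : S.IsZermelo)
    (hN : (S.inner A B).IsZermelo) (v : ℕ → S.Dom) (V : S.RelEnv)
    (v' : ℕ → (S.inner A B).Dom) (V' : (S.inner A B).RelEnv) :
    S.Sat chi v V ↔ (S.inner A B).Sat chi v' V' := by
  obtain ⟨a, b, b₂, b₃, r, h⟩ := hZ.exists_isRanks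
  obtain ⟨a', b', b₂', b₃', r', h'⟩ := hN.exists_isRanks
  rw [hZ.sat_chi_iff h, hN.sat_chi_iff h']
  obtain ⟨h₀, h₁, h₂, h₃, h₄⟩ := h
  obtain ⟨h₀', h₁', h₂', h₃', h₄'⟩ := h'
  obtain ⟨J₀, hJ₀⟩ := exists_iso_HF hZ hN (hZ.isHF_of_isROmega h₀) (hN.isHF_of_isROmega h₀')
  obtain ⟨J₁, hJ₁, e₁, s₁⟩ := hJ₀.powerSet hZ hN h₁ h₁'
  obtain ⟨J₂, hJ₂, e₂, s₂⟩ := hJ₁.powerSet hZ hN h₂ h₂'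
  obtain ⟨J₃, hJ₃, e₃, s₃⟩ := hJ₂.powerSet hZ hN h₃ h₃'
  obtain ⟨J₄, hJ₄, e₄, s₄⟩ := hJ₃.powerSet hZ hN h₄ h₄'
  refine hJ₄.sat_bound _ (by decide) (fun i => i == 3 || i == 4) (by decide) 0 _ _ ?_ rfl rfl _ _
  intro j hj
  simp only [Bool.or_eq_true, beq_iff_eq] at hj
  rcases hj with rfl | rfl
  · exact s₄ _ _ (s₃ _ _ e₂)
  · exact s₄ _ _ (s₃ _ _ (s₂ _ _ e₁))

/-! ### Numerals and codes -/

section Definability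

variable {S : GenStr} [S.Henkin]
variable (t u r q : (ℕ → S.Dom) → S.Dom) [IsTerm t] [IsTerm u] [IsTerm r] [IsTerm q]

instance (n : ℕ) : S.Dfn fun v => isNum S.mem n (t v) := by
  have h : S.Dfn fun v => isNum S.mem n (v 0) := by
    induction n with
    | zero => unfold isNum; infer_instance
    | succ n ih =>
      have : ∀ (t : (ℕ → S.Dom) → S.Dom) [IsTerm t], S.Dfn fun v => isNum S.mem n (t v) :=
        fun t _ => ih.subst₁ t
      unfold isNum; infer_instance
  exact h.subst₁ t

instance (n : ℕ) : S.Dfn fun v => isTagged S.mem n (t v) (u v) :=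
  Dfn.subst₂ (by unfold isTagged; infer_instance) t u
instance (n : ℕ) : S.Dfn fun v => isTagged₂ S.mem n (t v) (u v) (r v) :=
  Dfn.subst₃ (by unfold isTagged₂; infer_instance) t u r
instance : S.Dfn fun v => isBotCode S.mem (t v) :=
  Dfn.subst₁ (by unfold isBotCode; infer_instance) t

instance (φ : Fml) : S.Dfn fun v => isCode S.mem φ (t v) := by
  have h : S.Dfn fun v => isCode S.mem φ (v 0) := by
    induction φ with
    | imp φ ψ ih₁ ih₂ =>
      have h₁ : ∀ (t : (ℕ → S.Dom) → S.Dom) [IsTerm t], S.Dfn fun v => isCode S.mem φ (t v) :=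
        fun t _ => ih₁.subst₁ t
      have h₂ : ∀ (t : (ℕ → S.Dom) → S.Dom) [IsTerm t], S.Dfn fun v => isCode S.mem ψ (t v) :=
        fun t _ => ih₂.subst₁ t
      unfold isCode; infer_instance
    | all φ ih =>
      have h : ∀ (t : (ℕ → S.Dom) → S.Dom) [IsTerm t], S.Dfn fun v => isCode S.mem φ (t v) :=
        fun t _ => ih.subst₁ t
      unfold isCode; infer_instance
    | _ => unfold isCode; infer_instance
  exact h.subst₁ t

instance (A : S.Rel 1) : S.Dfn fun v => isAssignment S.mem (ext₁ A) (t v) (u v) :=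
  Dfn.subst₂ (by unfold isAssignment; infer_instance) t u
instance : S.Dfn fun v => isCons S.mem (t v) (u v) (r v) (q v) :=
  Dfn.subst₄ (by unfold isCons; infer_instance) t u r q

/-- Closure under finite disjunctions. -/
theorem Dfn.exists_mem_list {ι : Type} (L : List ι) (P : ι → (ℕ → S.Dom) → Prop)
    (hP : ∀ i, S.Dfn (P i)) : S.Dfn fun v => ∃ i ∈ L, P i v := by
  induction L with
  | nil => exact Dfn.of_iff (Dfn.const False) fun v => by simp
  | cons a L ih =>
    have := hP a
    exact Dfn.of_iff (Dfn.or (P a) fun v => ∃ i ∈ L, P i v) fun v => by simp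

end Definability

namespace IsZermelo

variable {S : GenStr} (hZ : S.IsZermelo)
include hZ

theorem exists_isNum (n : ℕ) : ∃ x, isNum S.mem n x := by
  induction n with
  | zero => exact hZ.exists_empty
  | succ n ih =>
    obtain ⟨x, hx⟩ := ih
    obtain ⟨y, hy⟩ := hZ.exists_adjoin x x
    exact ⟨y, x, hx, hy⟩

theorem num_unique {n : ℕ} {x y : S.Dom} (hx : isNum S.mem n x) (hy : isNum S.mem n y) :
    x = y := by
  induction n generalizing x y with
  | zero => exact hZ.empty_unique hx hy
  | succ n ih =>
    obtain ⟨x', hx', hx⟩ := hx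
    obtain ⟨y', hy', hy⟩ := hy
    obtain rfl := ih hx' hy'
    exact hZ.adjoin_unique hx hy

theorem num_inj {m n : ℕ} {x : S.Dom} (hm : isNum S.mem m x) (hn : isNum S.mem n x) : m = n := by
  induction m generalizing n x with
  | zero =>
    cases n with
    | zero => rfl
    | succ n =>
      obtain ⟨y, _, hy⟩ := hn
      exact (succ_not_empty hy hm).elim
  | succ m ih =>
    obtain ⟨y, hy, hxy⟩ := hm
    cases n with
    | zero => exact (succ_not_empty hxy hn).elim
    | succ n =>
      obtain ⟨z, hz, hxz⟩ := hn
      obtain rfl := hZ.succ_inj hxy hxz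
      rw [ih hy hz]

theorem num_mem_omega {w : S.Dom} (hw : isOmega S.mem w) {n : ℕ} {x : S.Dom}
    (hx : isNum S.mem n x) : x ε w := by
  induction n generalizing x with
  | zero => exact hZ.zero_mem_omega hw hx
  | succ n ih =>
    obtain ⟨y, hy, hxy⟩ := hx
    exact hZ.succ_mem_omega hw (ih hy) hxy

theorem tagged_inj {m n : ℕ} {c x y : S.Dom} (h : isTagged S.mem m c x)
    (h' : isTagged S.mem n c y) : m = n ∧ x = y := by
  obtain ⟨t, ht, hp⟩ := h
  obtain ⟨t', ht', hp'⟩ := h'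
  obtain ⟨rfl, rfl⟩ := hZ.pair_inj hp hp'
  exact ⟨hZ.num_inj ht ht', rfl⟩

theorem tagged₂_inj {m n : ℕ} {c x y x' y' : S.Dom} (h : isTagged₂ S.mem m c x y)
    (h' : isTagged₂ S.mem n c x' y') : x = x' ∧ y = y' := by
  obtain ⟨p, hp, ht⟩ := h
  obtain ⟨p', hp', ht'⟩ := h'
  obtain rfl := (hZ.tagged_inj ht ht').2
  exact hZ.pair_inj hp hp'

theorem exists_tagged (n : ℕ) (x : S.Dom) : ∃ c, isTagged S.mem n c x := by
  obtain ⟨t, ht⟩ := hZ.exists_isNum n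
  obtain ⟨c, hc⟩ := hZ.exists_pair t x
  exact ⟨c, t, ht, hc⟩

theorem exists_tagged₂ (n : ℕ) (x y : S.Dom) : ∃ c, isTagged₂ S.mem n c x y := by
  obtain ⟨p, hp⟩ := hZ.exists_pair x y
  obtain ⟨c, hc⟩ := hZ.exists_tagged n p
  exact ⟨c, p, hp, hc⟩

theorem exists_isBotCode : ∃ b, isBotCode S.mem b := by
  obtain ⟨e, he⟩ := hZ.exists_empty
  obtain ⟨c, hc⟩ := hZ.exists_tagged 0 e
  exact ⟨c, e, he, hc⟩

theorem exists_isCode (φ : Fml) (hφ : φ.isFO = true) : ∃ c, isCode S.mem φ c := by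
  induction φ with
  | bot => exact hZ.exists_isBotCode
  | mem s t =>
    obtain ⟨i, hi⟩ := hZ.exists_isNum s
    obtain ⟨j, hj⟩ := hZ.exists_isNum t
    obtain ⟨c, hc⟩ := hZ.exists_tagged₂ 1 i j
    exact ⟨c, i, j, hi, hj, hc⟩
  | eq s t =>
    obtain ⟨i, hi⟩ := hZ.exists_isNum s
    obtain ⟨j, hj⟩ := hZ.exists_isNum t
    obtain ⟨c, hc⟩ := hZ.exists_tagged₂ 2 i j
    exact ⟨c, i, j, hi, hj, hc⟩
  | rel k i ts => cases hφ
  | imp φ ψ ih₁ ih₂ =>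
    simp only [Fml.isFO, Bool.and_eq_true] at hφ
    obtain ⟨a, ha⟩ := ih₁ hφ.1
    obtain ⟨b, hb⟩ := ih₂ hφ.2
    obtain ⟨c, hc⟩ := hZ.exists_tagged₂ 3 a b
    exact ⟨c, a, b, ha, hb, hc⟩
  | all φ ih =>
    obtain ⟨a, ha⟩ := ih hφ
    obtain ⟨c, hc⟩ := hZ.exists_tagged 4 a
    exact ⟨c, a, ha, hc⟩
  | all₂ k φ => cases hφ

end IsZermelo

/-- The tag of the code of a formula. -/
def tag : Fml → ℕ
  | .bot => 0
  | .mem _ _ => 1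
  | .eq _ _ => 2
  | .imp _ _ => 3
  | .all _ => 4
  | .rel _ _ _ => 5
  | .all₂ _ _ => 6

/-- The tags `5` and `6` are never used, because formulas that are not first-order have no code. -/
theorem isTagged_of_isCode {S : GenStr} {φ : Fml} {c : S.Dom} (h : isCode S.mem φ c) :
    ∃ x, isTagged S.mem (tag φ) c x := by
  cases φ with
  | bot => exact ⟨_, h.choose_spec.2⟩
  | mem s t => obtain ⟨_, _, _, _, p, _, h⟩ := h; exact ⟨p, h⟩
  | eq s t => obtain ⟨_, _, _, _, p, _, h⟩ := h; exact ⟨p, h⟩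
  | rel k i ts => exact h.elim
  | imp φ ψ => obtain ⟨_, _, _, _, p, _, h⟩ := h; exact ⟨p, h⟩
  | all φ => exact ⟨_, h.choose_spec.2⟩
  | all₂ k φ => exact h.elim

/-- A set is the code of at most one formula. -/
theorem IsZermelo.code_inj {S : GenStr} (hZ : S.IsZermelo) {φ ψ : Fml} {c : S.Dom}
    (h : isCode S.mem φ c) (h' : isCode S.mem ψ c) : φ = ψ := by
  induction φ generalizing ψ c with
  | bot =>
    have ht := (hZ.tagged_inj (isTagged_of_isCode h).choose_spec
      (isTagged_of_isCode h').choose_spec).1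
    cases ψ with
    | bot => rfl
    | _ => simp [tag] at ht
  | mem s t =>
    have ht := (hZ.tagged_inj (isTagged_of_isCode h).choose_spec
      (isTagged_of_isCode h').choose_spec).1
    cases ψ with
    | mem s' t' =>
      obtain ⟨i, j, hi, hj, hc⟩ := h
      obtain ⟨i', j', hi', hj', hc'⟩ := h'
      obtain ⟨rfl, rfl⟩ := hZ.tagged₂_inj hc hc'
      rw [hZ.num_inj hi hi', hZ.num_inj hj hj']
    | _ => simp [tag] at ht
  | eq s t =>
    have ht := (hZ.tagged_inj (isTagged_of_isCode h).choose_spec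
      (isTagged_of_isCode h').choose_spec).1
    cases ψ with
    | eq s' t' =>
      obtain ⟨i, j, hi, hj, hc⟩ := h
      obtain ⟨i', j', hi', hj', hc'⟩ := h'
      obtain ⟨rfl, rfl⟩ := hZ.tagged₂_inj hc hc'
      rw [hZ.num_inj hi hi', hZ.num_inj hj hj']
    | _ => simp [tag] at ht
  | rel k i ts => exact h.elim
  | imp φ₁ φ₂ ih₁ ih₂ =>
    have ht := (hZ.tagged_inj (isTagged_of_isCode h).choose_spec
      (isTagged_of_isCode h').choose_spec).1
    cases ψ with
    | imp ψ₁ ψ₂ =>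
      obtain ⟨a, b, ha, hb, hc⟩ := h
      obtain ⟨a', b', ha', hb', hc'⟩ := h'
      obtain ⟨rfl, rfl⟩ := hZ.tagged₂_inj hc hc'
      rw [ih₁ ha ha', ih₂ hb hb']
    | _ => simp [tag] at ht
  | all φ ih =>
    have ht := (hZ.tagged_inj (isTagged_of_isCode h).choose_spec
      (isTagged_of_isCode h').choose_spec).1
    cases ψ with
    | all ψ =>
      obtain ⟨a, ha, hc⟩ := h
      obtain ⟨a', ha', hc'⟩ := h'
      obtain rfl := (hZ.tagged_inj hc hc').2
      rw [ih ha ha']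
    | _ => simp [tag] at ht
  | all₂ k φ => exact h.elim

/-! ### Assignments -/

/-- The axiom of Replacement holds in the structure. -/
def Replacement (S : GenStr) : Prop :=
  ∀ F : S.Rel 2, (∀ x y z, ext₂ F x y ∧ ext₂ F x z → y = z) →
    ∀ u, ∃ v, ∀ y, y ε v ↔ ∃ x, x ε u ∧ ext₂ F x y

theorem sat_replacement {S : GenStr} (v : ℕ → S.Dom) (V : S.RelEnv) :
    S.Sat FmlAt.replacement.close v V ↔ S.Replacement := by
  simp (disch := omega) only [FmlAt.close, FmlAt.replacement, sat_all₂, sat_imp, sat_all, sat_conj,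
    sat_app₂, sat_eq, sat_ex, sat_iff, sat_mem, look_new, look_old, look₂_new, Replacement]

section Assignments

variable {S : GenStr} [S.Henkin] (hZ : S.IsZermelo) (hR : S.Replacement)
include hZ hR

/-- A definable function on a set is a set. -/
theorem IsZermelo.exists_function (F : S.Dom → S.Dom → Prop) (hF : S.Dfn fun v => F (v 0) (v 1))
    (w : S.Dom) (htot : ∀ u, u ε w → ∃ v, F u v) (huniq : ∀ u v v', F u v → F u v' → v = v') :
    ∃ g, isFunOn S.mem g w ∧ ∀ u v, maps S.mem g u v ↔ u ε w ∧ F u v := by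
  have : ∀ (t u : (ℕ → S.Dom) → S.Dom) [IsTerm t] [IsTerm u], S.Dfn fun v => F (t v) (u v) :=
    fun t u _ _ => hF.subst₂ t u
  obtain ⟨G, hG⟩ := exists_ext₂ (P := fun u p => ∃ v, F u v ∧ isPair S.mem p u v) inferInstance
  obtain ⟨g, hg⟩ := hR G (by
    rintro u p p' ⟨hp, hp'⟩
    obtain ⟨v, hv, hp⟩ := (hG u p).1 hp
    obtain ⟨v', hv', hp'⟩ := (hG u p').1 hp'
    obtain rfl := huniq u v v' hv hv'
    exact hZ.pair_unique hp hp') w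
  have hmaps : ∀ u v, maps S.mem g u v ↔ u ε w ∧ F u v := by
    intro u v
    constructor
    · rintro ⟨p, hp, hpg⟩
      obtain ⟨u', hu', h⟩ := (hg p).1 hpg
      obtain ⟨v', hv', hp'⟩ := (hG u' p).1 h
      obtain ⟨rfl, rfl⟩ := hZ.pair_inj hp hp'
      exact ⟨hu', hv'⟩
    · rintro ⟨hu, hv⟩
      obtain ⟨p, hp⟩ := hZ.exists_pair u v
      exact ⟨p, hp, (hg p).2 ⟨u, hu, (hG u p).2 ⟨v, hv, hp⟩⟩⟩
  refine ⟨g, ⟨fun p hp => ?_, fun u hu => ?_⟩, hmaps⟩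
  · obtain ⟨u, hu, h⟩ := (hg p).1 hp
    obtain ⟨v, _, hp⟩ := (hG u p).1 h
    exact ⟨u, v, hu, hp⟩
  · obtain ⟨v, hv⟩ := htot u hu
    exact ⟨v, (hmaps u v).2 ⟨hu, hv⟩, fun v' hv' => huniq u v' v ((hmaps u v').1 hv').2 hv⟩

/-- Assignments can be extended by one value. -/
theorem IsZermelo.exists_isCons {X : S.Dom → Prop} {w f a : S.Dom} (hw : isOmega S.mem w)
    (hf : isAssignment S.mem X w f) (ha : X a) :
    ∃ g, isAssignment S.mem X w g ∧ isCons S.mem w g a f := by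
  let F : S.Dom → S.Dom → Prop := fun j v =>
    (isEmpty S.mem j ∧ v = a) ∨ ∃ i, isAdjoin S.mem j i i ∧ maps S.mem f i v
  have htot : ∀ u, u ε w → ∃ v, F u v := by
    intro u hu
    rcases hZ.omega_cases hw hu with he | ⟨m, hm, hum⟩
    · exact ⟨a, .inl ⟨he, rfl⟩⟩
    · obtain ⟨v, hv, _⟩ := hf.1.2 m hm
      exact ⟨v, .inr ⟨m, hum, hv⟩⟩
  have huniq : ∀ u v v', F u v → F u v' → v = v' := by
    rintro u v v' (⟨he, rfl⟩ | ⟨i, hi, h⟩) (⟨he', rfl⟩ | ⟨i', hi', h'⟩)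
    · rfl
    · exact (IsZermelo.succ_not_empty hi' he).elim
    · exact (IsZermelo.succ_not_empty hi he').elim
    · obtain rfl := hZ.succ_inj hi hi'
      exact hZ.maps_unique hf.1 h h'
  have hF : S.Dfn fun v => F (v 0) (v 1) := by unfold F; infer_instance
  obtain ⟨g, hg, hmaps⟩ := hZ.exists_function hR F hF w htot huniq
  refine ⟨g, ⟨hg, fun u v huv => ?_⟩, ?_, fun j hj j' hj' v => ?_⟩
  · rcases ((hmaps u v).1 huv).2 with ⟨_, rfl⟩ | ⟨i, _, hi⟩
    exacts [ha, hf.2 _ _ hi]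
  · obtain ⟨e, he⟩ := hZ.exists_empty
    exact ⟨e, he, (hmaps e a).2 ⟨hZ.zero_mem_omega hw he, .inl ⟨he, rfl⟩⟩⟩
  · rw [hmaps]
    constructor
    · exact fun h => ⟨hZ.succ_mem_omega hw hj hj', .inr ⟨j, hj', h⟩⟩
    · rintro ⟨_, ⟨he, _⟩ | ⟨i, hi, h⟩⟩
      · exact (IsZermelo.succ_not_empty hj' he).elim
      · exact hZ.succ_inj hj' hi ▸ h

end Assignments

/-! ### Satisfaction classes -/

/-- Satisfaction of a formula by an assignment in `⟨A, B⟩`, by recursion on the formula, with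
assignments that are sets of the structure. -/
def SatBy {S : GenStr} (A : S.Rel 1) (B : S.Rel 2) (w : S.Dom) : Fml → S.Dom → Prop
  | .bot, _ => False
  | .mem s t, f => ∃ i j a b, isNum S.mem s i ∧ isNum S.mem t j ∧ maps S.mem f i a ∧
      maps S.mem f j b ∧ ext₂ B a b
  | .eq s t, f => ∃ i j a b, isNum S.mem s i ∧ isNum S.mem t j ∧ maps S.mem f i a ∧
      maps S.mem f j b ∧ a = b
  | .rel _ _ _, _ => False
  | .imp φ ψ, f => SatBy A B w φ f → SatBy A B w ψ f
  | .all φ, f => ∀ a, ext₁ A a → ∀ g, isAssignment S.mem (ext₁ A) w g ∧ isCons S.mem w g a f →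
      SatBy A B w φ g
  | .all₂ _ _, _ => False

section Satisfaction

variable {S : GenStr} [S.Henkin] {A : S.Rel 1} {B : S.Rel 2} {w : S.Dom}

instance (φ : Fml) (t : (ℕ → S.Dom) → S.Dom) [IsTerm t] :
    S.Dfn fun v => SatBy A B w φ (t v) := by
  have h : S.Dfn fun v => SatBy A B w φ (v 0) := by
    induction φ with
    | imp φ ψ ih₁ ih₂ => exact Dfn.imp _ _ (hP := ih₁) (hQ := ih₂)
    | all φ ih =>
      have h : ∀ (t : (ℕ → S.Dom) → S.Dom) [IsTerm t], S.Dfn fun v => SatBy A B w φ (t v) :=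
        fun t _ => ih.subst₁ t
      unfold SatBy; infer_instance
    | _ => unfold SatBy; infer_instance
  exact h.subst₁ t

/-- Satisfaction by an assignment that is a set agrees with satisfaction in the inner structure. -/
theorem satBy_iff (hZ : S.IsZermelo) (hR : S.Replacement) (hw : isOmega S.mem w) (φ : Fml)
    (hφ : φ.isFO = true) (f : S.Dom) (hf : isAssignment S.mem (ext₁ A) w f)
    (v : ℕ → (S.inner A B).Dom) (hv : ∀ n i, isNum S.mem n i → maps S.mem f i (v n).1)
    (V : (S.inner A B).RelEnv) : SatBy A B w φ f ↔ (S.inner A B).Sat φ v V := by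
  induction φ generalizing f v with
  | bot => rfl
  | mem s t =>
    constructor
    · rintro ⟨i, j, a, b, hi, hj, ha, hb, h⟩
      obtain rfl := hZ.maps_unique hf.1 ha (hv s i hi)
      obtain rfl := hZ.maps_unique hf.1 hb (hv t j hj)
      exact h
    · intro h
      obtain ⟨i, hi⟩ := hZ.exists_isNum s
      obtain ⟨j, hj⟩ := hZ.exists_isNum t
      exact ⟨i, j, _, _, hi, hj, hv s i hi, hv t j hj, h⟩
  | eq s t =>
    constructor
    · rintro ⟨i, j, a, b, hi, hj, ha, hb, h⟩
      obtain rfl := hZ.maps_unique hf.1 ha (hv s i hi)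
      obtain rfl := hZ.maps_unique hf.1 hb (hv t j hj)
      exact Subtype.ext h
    · intro h
      obtain ⟨i, hi⟩ := hZ.exists_isNum s
      obtain ⟨j, hj⟩ := hZ.exists_isNum t
      exact ⟨i, j, _, _, hi, hj, hv s i hi, hv t j hj, congrArg Subtype.val h⟩
  | rel k i ts => cases hφ
  | imp φ ψ ih₁ ih₂ =>
    simp only [Fml.isFO, Bool.and_eq_true] at hφ
    exact imp_congr (ih₁ hφ.1 f hf v hv) (ih₂ hφ.2 f hf v hv)
  | all φ ih =>
    have step : ∀ (a : (S.inner A B).Dom) (g : S.Dom), isAssignment S.mem (ext₁ A) w g →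
        isCons S.mem w g a.1 f → (SatBy A B w φ g ↔ (S.inner A B).Sat φ (scons a v) V) := by
      intro a g hg hcons
      refine ih hφ g hg (scons a v) ?_
      rintro (_ | n) i hi
      · obtain ⟨e, he, h⟩ := hcons.1
        exact hZ.empty_unique he hi ▸ h
      · obtain ⟨j, hj, hij⟩ := hi
        exact (hcons.2 j (hZ.num_mem_omega hw hj) i hij _).1 (hv n j hj)
    constructor
    · intro h a
      obtain ⟨g, hg, hcons⟩ := hZ.exists_isCons hR hw hf a.2
      exact (step a g hg hcons).1 (h a.1 a.2 g ⟨hg, hcons⟩)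
    · rintro h a ha g ⟨hg, hcons⟩
      exact (step ⟨a, ha⟩ g hg hcons).2 (h ⟨a, ha⟩)
  | all₂ k φ => cases hφ

/-- The subformulas of a formula; second-order quantifications are not taken apart. -/
def subformulas : Fml → List Fml
  | .imp φ ψ => .imp φ ψ :: (subformulas φ ++ subformulas ψ)
  | .all φ => .all φ :: subformulas φ
  | .all₂ k φ => [.all₂ k φ]
  | φ => [φ]

theorem self_mem_subformulas (φ : Fml) : φ ∈ subformulas φ := by
  cases φ <;> simp [subformulas]

theorem imp_mem_subformulas {φ ψ χ : Fml} (h : φ.imp ψ ∈ subformulas χ) :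
    φ ∈ subformulas χ ∧ ψ ∈ subformulas χ := by
  induction χ with
  | imp χ₁ χ₂ ih₁ ih₂ =>
    simp only [subformulas, List.mem_cons, List.mem_append] at h ⊢
    rcases h with h | h | h
    · cases h
      exact ⟨.inr (.inl (self_mem_subformulas _)), .inr (.inr (self_mem_subformulas _))⟩
    · exact ⟨.inr (.inl (ih₁ h).1), .inr (.inl (ih₁ h).2)⟩
    · exact ⟨.inr (.inr (ih₂ h).1), .inr (.inr (ih₂ h).2)⟩
  | all χ ih =>
    simp only [subformulas, List.mem_cons, reduceCtorEq, false_or] at h ⊢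
    exact ⟨.inr (ih h).1, .inr (ih h).2⟩
  | _ => simp [subformulas] at h

theorem all_mem_subformulas {φ χ : Fml} (h : φ.all ∈ subformulas χ) : φ ∈ subformulas χ := by
  induction χ with
  | imp χ₁ χ₂ ih₁ ih₂ =>
    simp only [subformulas, List.mem_cons, List.mem_append, reduceCtorEq, false_or] at h ⊢
    exact .inr (h.imp ih₁ ih₂)
  | all χ ih =>
    simp only [subformulas, List.mem_cons] at h ⊢
    rcases h with h | h
    · cases h
      exact .inr (self_mem_subformulas _)
    · exact .inr (ih h)
  | _ => simp [subformulas] at h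

/-- A first-order sentence that is true in the inner structure `⟨A, B⟩` satisfies
`Sat(A, B, ⌜φ⌝)`. -/
theorem isSat_of_sat (hZ : S.IsZermelo) (hR : S.Replacement) {φ : Fml} (hφ : φ.isFO = true)
    {c : S.Dom} (hc : isCode S.mem φ c)
    (h : ∀ v V, (S.inner A B).Sat φ v V) : S.IsSat (ext₁ A) (ext₂ B) c := by
  obtain ⟨w, hw⟩ := hZ.exists_isOmega
  obtain ⟨C, hC⟩ := Cls.of_dfn (P := fun c => ∃ ψ ∈ subformulas φ, isCode S.mem ψ c)
    (Dfn.exists_mem_list _ _ fun ψ => inferInstance)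
  obtain ⟨Z, hZ'⟩ := exists_ext₂
    (P := fun c f => ∃ ψ ∈ subformulas φ, isCode S.mem ψ c ∧ SatBy A B w ψ f)
    (Dfn.exists_mem_list _ _ fun ψ => inferInstance)
  have hZ_iff : ∀ {ψ c}, ψ ∈ subformulas φ → isCode S.mem ψ c → ∀ f,
      (ext₂ Z c f ↔ SatBy A B w ψ f) := by
    intro ψ c hψ hc f
    rw [hZ']
    constructor
    · rintro ⟨ψ', _, hc', hs⟩
      rwa [hZ.code_inj hc hc']
    · exact fun hs => ⟨ψ, hψ, hc, hs⟩
  refine ⟨w, hw, C, Z, (hC c).2 ⟨φ, self_mem_subformulas φ, hc⟩, fun c' hc' => ?_, fun f hf => ?_⟩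
  · obtain ⟨ψ, hψ, hc'⟩ := (hC c').1 hc'
    have hiff := hZ_iff hψ hc'
    cases ψ with
    | bot => exact .inl ⟨hc', fun f _ => (hiff f).1⟩
    | mem s t =>
      obtain ⟨i, j, hi, hj, hcode⟩ := hc'
      refine .inr (.inl ⟨i, j, hZ.num_mem_omega hw hi, hZ.num_mem_omega hw hj, hcode,
        fun f _ => (hiff f).trans ⟨?_, ?_⟩⟩)
      · rintro ⟨i', j', a, b, hi', hj', ha, hb, hab⟩
        obtain rfl := hZ.num_unique hi hi'
        obtain rfl := hZ.num_unique hj hj'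
        exact ⟨a, b, ha, hb, hab⟩
      · rintro ⟨a, b, ha, hb, hab⟩
        exact ⟨i, j, a, b, hi, hj, ha, hb, hab⟩
    | eq s t =>
      obtain ⟨i, j, hi, hj, hcode⟩ := hc'
      refine .inr (.inr (.inl ⟨i, j, hZ.num_mem_omega hw hi, hZ.num_mem_omega hw hj, hcode,
        fun f _ => (hiff f).trans ⟨?_, ?_⟩⟩))
      · rintro ⟨i', j', a, b, hi', hj', ha, hb, hab⟩
        obtain rfl := hZ.num_unique hi hi'
        obtain rfl := hZ.num_unique hj hj'
        exact ⟨a, b, ha, hb, hab⟩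
      · rintro ⟨a, b, ha, hb, hab⟩
        exact ⟨i, j, a, b, hi, hj, ha, hb, hab⟩
    | rel k i ts => exact hc'.elim
    | imp ψ₁ ψ₂ =>
      obtain ⟨a, b, ha, hb, hcode⟩ := hc'
      obtain ⟨h₁, h₂⟩ := imp_mem_subformulas hψ
      refine .inr (.inr (.inr (.inl ⟨a, b, (hC a).2 ⟨_, h₁, ha⟩, (hC b).2 ⟨_, h₂, hb⟩, hcode,
        fun f _ => ?_⟩)))
      rw [hiff, hZ_iff h₁ ha, hZ_iff h₂ hb]
      rfl
    | all ψ =>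
      obtain ⟨a, ha, hcode⟩ := hc'
      have h₁ := all_mem_subformulas hψ
      refine .inr (.inr (.inr (.inr ⟨a, (hC a).2 ⟨_, h₁, ha⟩, hcode, fun f _ => ?_⟩)))
      simp only [hiff, hZ_iff h₁ ha]
      rfl
    | all₂ k ψ => exact hc'.elim
  · rw [hZ_iff (self_mem_subformulas φ) hc]
    have hval : ∀ n, ∃ a : (S.inner A B).Dom, ∀ i, isNum S.mem n i → maps S.mem f i a.1 := by
      intro n
      obtain ⟨i, hi⟩ := hZ.exists_isNum n
      obtain ⟨a, ha, _⟩ := hf.1.2 i (hZ.num_mem_omega hw hi)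
      exact ⟨⟨a, hf.2 _ _ ha⟩, fun i' hi' => hZ.num_unique hi hi' ▸ ha⟩
    choose v hv using hval
    exact (satBy_iff hZ hR hw φ hφ f hf v hv (Classical.arbitrary _)).2 (h _ _)

end Satisfaction

/-- In models of second-order Zermelo-Fraenkel set theory, the Continuum Hypothesis is
mathematically definite. -/
theorem sat_definite_chi {S : GenStr} [S.Henkin] (hZ : S.IsZermelo) (hR : S.Replacement)
    (v : ℕ → S.Dom) (V : S.RelEnv) : S.Sat (definite chi) v V := by
  have hFO : chi.isFO = true := by decide
  obtain ⟨c, hc⟩ := hZ.exists_isCode chi hFO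
  rw [sat_definite]
  refine ⟨c, hc, ?_⟩
  by_cases h : S.Sat chi v V
  · refine .inl fun A B _ hAB => isSat_of_sat hZ hR hFO hc fun v' V' => ?_
    exact (sat_chi_inner hZ (.of_relativize _ _ hAB) v V v' V').1 h
  · obtain ⟨b, hb⟩ := hZ.exists_isBotCode
    obtain ⟨c', hc'⟩ := hZ.exists_tagged₂ 3 c b
    refine .inr ⟨c', ⟨b, hb, hc'⟩, fun A B _ hAB => ?_⟩
    refine isSat_of_sat hZ hR (φ := chi.neg) (by decide) ⟨c, b, hc, hb, hc'⟩ fun v' V' h' => h ?_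
    exact (sat_chi_inner hZ (.of_relativize _ _ hAB) v V v' V').2 h'

end GenStr

end Kreisel

theorem theorem6 : Kreisel.Proves Kreisel.ZF2 (Kreisel.definite Kreisel.chi) := by
  open Kreisel in
  refine ⟨[FmlAt.extensionality.close, FmlAt.foundation.close, FmlAt.pairing.close,
    FmlAt.union.close, FmlAt.powerSet.close, FmlAt.infinity.close,
    FmlAt.comprehensiveness.close, FmlAt.replacement.close], ?_, ?_⟩
  · simp [ZF2, Z2]
  · refine Deriv.of_models fun S hS v V hΓ => ?_
    have : S.Henkin := ⟨fun k => ⟨V k 0⟩, hS⟩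
    simp only [List.mem_cons, List.not_mem_nil, or_false, forall_eq_or_imp, forall_eq] at hΓ
    obtain ⟨h₁, h₂, h₃, h₄, h₅, h₆, h₇, h₈⟩ := hΓ
    refine GenStr.sat_definite_chi ((GenStr.sat_zermelo v V).1 ?_)
      ((GenStr.sat_replacement v V).1 h₈) v V
    simp only [FmlAt.close, FmlAt.zermelo, GenStr.sat_conj]
    exact ⟨h₁, h₂, h₃, h₄, h₅, h₆, h₇⟩
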